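/- Let $k$ be a number field and let $n\ge 1$. A fake weighted projective space of dimension $n$ over $k$ is the toric variety $W$ over $k$ with split torus $T$ of a complete simplicial fan in a lattice $N\cong\mathbb Z^n$ with exactly $n+1$ rays; that is, the primitive generators $v_0,\dots,v_n\in N$ of the rays span $N\otimes\mathbb Q$ and satisfy $\sum_i a_iv_i=0$ for some positive integers $a_0,\dots,a_n$, and the cones of the fan are generated by the proper subsets of $\{v_0,\dots,v_n\}$. Let $W$ be a fake weighted projective space over $k$ and let $P\in W(k)$. Then there is a rational curve $C\subseteq W$ over $k$, unibranch at each of its points, which passes through $P$ and has the following properties: (a) There are a $T$-orbit closure $Z\subseteq W$ with torus $T_Z$, a one-parameter subgroup $\lambda\colon\mathbb G_m\to T_Z$ and a point $t\in T_Z(k)$ such that $C\subseteq Z$ is the closure of the translate $t\cdot\lambda(\mathbb G_m)$. (b) $-K_W\cdot C\le 1+\dim W$. (c) If $W$ has terminal singularities and is not isomorphic to $\mathbb P^n$ over $k$, then $C$ can be chosen to satisfy in addition $-K_W\cdot C\le\dim W$. -/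

import Mathlib

open CategoryTheory AlgebraicGeometry

universe u

/-! # Fake weighted projective spaces as toric varieties over a field -/

/-- The fan of a fake weighted projective space of dimension `n`, in the lattice `N = ℤⁿ`: its
`n + 1` rays are generated by primitive vectors `v₀, …, vₙ` which span `N_ℚ` and satisfy a relation
`∑ aᵢ vᵢ = 0` with positive integers `aᵢ`; its cones are the cones
`σ_I = cone (vᵢ : i ∈ I)` for the proper subsets `I` of `{0, …, n}`. Equivalently this is a complete
simplicial fan with `n + 1` rays. There is no such fan for `n = 0`, since `ℤ⁰` contains no
primitive vector. -/
structure FakeWPSFan (n : ℕ) where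
  v : Fin (n + 1) → (Fin n → ℤ)
  primitive : ∀ i (d : ℤ) (w : Fin n → ℤ), v i = d • w → IsUnit d
  span_eq_top : Submodule.span ℚ (Set.range fun i j => (v i j : ℚ)) = ⊤
  relation : ∃ a : Fin (n + 1) → ℤ, (∀ i, 0 < a i) ∧ ∑ i, a i • v i = 0

namespace FakeWPSFan
variable {n : ℕ} (F : FakeWPSFan n)

/-- The cones `σ_I` of the fan, indexed by the proper subsets `I` of `{0, …, n}` and ordered by
the face relation. -/
abbrev Cone (n : ℕ) : Type := {I : Finset (Fin (n + 1)) // I ≠ Finset.univ}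

/-- The monoid `σ_I^∨ ∩ M` in the dual lattice `M = ℤⁿ`, paired with `N` by the dot product. -/
def dualCone (I : Finset (Fin (n + 1))) : AddSubmonoid (Fin n → ℤ) where
  carrier := {m | ∀ i ∈ I, 0 ≤ m ⬝ᵥ F.v i}
  zero_mem' := by simp
  add_mem' := by
    intro a b ha hb i hi
    rw [add_dotProduct]
    exact add_nonneg (ha i hi) (hb i hi)

lemma dualCone_mono {I J : Finset (Fin (n + 1))} (h : I ⊆ J) : F.dualCone J ≤ F.dualCone I :=
  fun _ hm i hi => hm i (h hi)

/-- For `J` proper and `j ∈ J` there is a lattice functional positive on `v_j` and zero on the other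
rays of `σ_J`. -/
lemma exists_dual (J : Finset (Fin (n + 1))) (hJ : J ≠ Finset.univ) (j : Fin (n+1)) (hj : j ∈ J) :
    ∃ m : Fin n → ℤ, (∀ i ∈ J, i ≠ j → m ⬝ᵥ F.v i = 0) ∧ 0 < m ⬝ᵥ F.v j := by
  classical
  obtain ⟨i₀, hi₀⟩ : ∃ i, i ∉ J := by
    by_contra! h
    exact hJ (Finset.eq_univ_iff_forall.2 h)
  obtain ⟨a, ha, hrel⟩ := F.relation
  let q : Fin (n + 1) → (Fin n → ℚ) := fun i j => (F.v i j : ℚ)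
  have hrelq : ∑ i, (a i : ℚ) • q i = 0 := by
    ext l
    have := congrFun hrel l
    simp only [Finset.sum_apply, Pi.smul_apply, smul_eq_mul, Pi.zero_apply, q] at this ⊢
    exact_mod_cast this
  let w : {i : Fin (n + 1) // i ≠ i₀} → (Fin n → ℚ) := fun i => q i
  have hspan : ⊤ ≤ Submodule.span ℚ (Set.range w) := by
    rw [← F.span_eq_top, Submodule.span_le]
    rintro _ ⟨i, rfl⟩
    by_cases hi : i = i₀
    · subst hi
      have h1 : q i = -((a i : ℚ)⁻¹ • ∑ l ∈ Finset.univ.erase i, (a l : ℚ) • q l) := by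
        rw [← Finset.add_sum_erase _ _ (Finset.mem_univ i)] at hrelq
        have : (a i : ℚ) ≠ 0 := by exact_mod_cast (ha i).ne'
        rw [eq_neg_of_add_eq_zero_right hrelq, smul_neg, neg_neg, smul_smul,
          inv_mul_cancel₀ this, one_smul]
      change q i ∈ Submodule.span ℚ (Set.range w)
      rw [h1]
      refine Submodule.neg_mem _ (Submodule.smul_mem _ _ (Submodule.sum_mem _ fun l hl => ?_))
      exact Submodule.smul_mem _ _ (Submodule.subset_span ⟨⟨l, Finset.ne_of_mem_erase hl⟩, rfl⟩)
    · exact Submodule.subset_span ⟨⟨i, hi⟩, rfl⟩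
  have hcard : Fintype.card {i : Fin (n + 1) // i ≠ i₀} = Module.finrank ℚ (Fin n → ℚ) := by
    simp
  let B := basisOfTopLeSpanOfCardEqFinrank w hspan hcard
  have hB : ∀ i, B i = w i := fun i => by simp [B]
  have hji : j ≠ i₀ := fun h => hi₀ (h ▸ hj)
  let φ : (Fin n → ℚ) →ₗ[ℚ] ℚ := B.coord ⟨j, hji⟩
  obtain ⟨⟨d, hd⟩, hd'⟩ := IsLocalization.exist_integer_multiples_of_finset (nonZeroDivisors ℤ)
    (Finset.univ.image fun l : Fin n => φ (Pi.single l 1))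
  have hd0 : d ≠ 0 := nonZeroDivisors.ne_zero hd
  have hex : ∀ l : Fin n, ∃ z : ℤ, (z : ℚ) = d * φ (Pi.single l 1) := by
    intro l
    obtain ⟨z, hz⟩ := hd' (φ (Pi.single l 1)) (Finset.mem_image_of_mem _ (Finset.mem_univ l))
    exact ⟨z, by simpa using hz⟩
  choose z hz using hex
  have hdot : ∀ i, ((z ⬝ᵥ F.v i : ℤ) : ℚ) = d * φ (q i) := by
    intro i
    have : q i = ∑ l, (F.v i l : ℚ) • Pi.single l (1 : ℚ) := by
      ext l
      simp [q, Finset.sum_apply, Pi.single_apply]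
    rw [this, map_sum, Finset.mul_sum, dotProduct]
    push_cast
    refine Finset.sum_congr rfl fun l _ => ?_
    rw [hz, map_smul, smul_eq_mul]
    ring
  have hφj : φ (q j) = 1 := by
    have := hB ⟨j, hji⟩
    change φ (w ⟨j, hji⟩) = 1
    rw [← this]
    simp [φ]
  have hφi : ∀ i, i ≠ i₀ → i ≠ j → φ (q i) = 0 := by
    intro i hi hij
    change φ (w ⟨i, hi⟩) = 0
    rw [← hB ⟨i, hi⟩]
    simp [φ, hij]
  refine ⟨d • z, fun i hi hij => ?_, ?_⟩
  · have : ((z ⬝ᵥ F.v i : ℤ) : ℚ) = 0 := by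
      rw [hdot, hφi i (fun h => hi₀ (h ▸ hi)) hij, mul_zero]
    rw [smul_dotProduct, show z ⬝ᵥ F.v i = 0 by exact_mod_cast this, smul_zero]
  · have : ((z ⬝ᵥ F.v j : ℤ) : ℚ) = d := by rw [hdot, hφj, mul_one]
    rw [smul_dotProduct, show z ⬝ᵥ F.v j = d by exact_mod_cast this]
    exact mul_self_pos.2 hd0

/-- A lattice functional supporting the face of `σ_J` spanned by the rays in `I`. -/
lemma exists_facet (I J : Finset (Fin (n + 1))) (hJ : J ≠ Finset.univ) :
    ∃ m : Fin n → ℤ, (∀ i ∈ J, i ∈ I → m ⬝ᵥ F.v i = 0) ∧ ∀ i ∈ J, i ∉ I → 0 < m ⬝ᵥ F.v i := by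
  classical
  have : ∀ j : Fin (n+1), ∃ m : Fin n → ℤ, j ∈ J →
     ((∀ i ∈ J, i ≠ j → m ⬝ᵥ F.v i = 0) ∧ 0 < m ⬝ᵥ F.v j) := by
    intro j
    by_cases hj : j ∈ J
    · obtain ⟨m, hm⟩ := F.exists_dual J hJ j hj
      exact ⟨m, fun _ => hm⟩
    · exact ⟨0, fun h => absurd h hj⟩
  choose m hm using this
  refine ⟨∑ j ∈ J \ I, m j, fun i hi hiI => ?_, fun i hi hiI => ?_⟩
  · rw [sum_dotProduct]
    refine Finset.sum_eq_zero fun j hj => ?_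
    rw [Finset.mem_sdiff] at hj
    exact (hm j hj.1).1 i hi (fun h => hj.2 (h ▸ hiI))
  · rw [sum_dotProduct, Finset.sum_eq_single_of_mem i (by simp [hi, hiI])]
    · exact (hm i hi).2
    · intro j hj hji
      rw [Finset.mem_sdiff] at hj
      exact (hm j hj.1).1 i hi hji.symm



variable (k : Type u) [Field k]

/-- The coordinate ring `k[σ_I^∨ ∩ M]` of the affine toric variety `U_{σ_I}`. -/
abbrev CoordRing (I : Finset (Fin (n + 1))) : Type u := AddMonoidAlgebra k (F.dualCone I)

/-- The inclusion `k[σ_J^∨ ∩ M] → k[σ_I^∨ ∩ M]` for a face `σ_I` of `σ_J`. -/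
noncomputable def restrictCoord {I J : Finset (Fin (n + 1))} (h : I ⊆ J) :
    F.CoordRing k J →ₐ[k] F.CoordRing k I :=
  AddMonoidAlgebra.mapDomainAlgHom k k (AddSubmonoid.inclusion (F.dualCone_mono h))

lemma restrictCoord_single {I J : Finset (Fin (n + 1))} (h : I ⊆ J) (m : F.dualCone J) (c : k) :
    F.restrictCoord k h (AddMonoidAlgebra.single m c) =
      AddMonoidAlgebra.single (AddSubmonoid.inclusion (F.dualCone_mono h) m) c := by
  simp [restrictCoord]

lemma restrictCoord_injective {I J : Finset (Fin (n + 1))} (h : I ⊆ J) :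
    Function.Injective (F.restrictCoord k h) :=
  AddMonoidAlgebra.mapDomain_injective (AddSubmonoid.inclusion_injective _)

instance (I : Finset (Fin (n + 1))) : IsDomain (F.CoordRing k I) := by
  have : NoZeroDivisors (F.CoordRing k I) :=
    Function.Injective.noZeroDivisors
      (AddMonoidAlgebra.mapDomainRingHom k (F.dualCone I).subtype)
      (AddMonoidAlgebra.mapDomain_injective Subtype.val_injective) (map_zero _) (map_mul _)
  exact NoZeroDivisors.to_isDomain _

lemma exists_localizing {I J : Finset (Fin (n + 1))} (h : I ⊆ J) (m₀ : F.dualCone J)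
    (hpos : ∀ i ∈ J, i ∉ I → 0 < (m₀ : Fin n → ℤ) ⬝ᵥ F.v i) (y : F.CoordRing k I) :
    ∃ (N : ℕ) (x : F.CoordRing k J),
      y * F.restrictCoord k h (AddMonoidAlgebra.single m₀ 1) ^ N = F.restrictCoord k h x := by
  induction y using AddMonoidAlgebra.induction_linear with
  | zero => exact ⟨0, 0, by simp⟩
  | add f g hf hg =>
    obtain ⟨N, x, hx⟩ := hf
    obtain ⟨N', x', hx'⟩ := hg
    refine ⟨N + N', x * AddMonoidAlgebra.single m₀ 1 ^ N' + x' * AddMonoidAlgebra.single m₀ 1 ^ N,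
      ?_⟩
    rw [map_add, map_mul, map_mul, ← hx, ← hx', map_pow, map_pow]
    ring
  | single m c =>
    let N : ℕ := ∑ i, ((m : Fin n → ℤ) ⬝ᵥ F.v i).natAbs
    have hmem : (m : Fin n → ℤ) + N • (m₀ : Fin n → ℤ) ∈ F.dualCone J := by
      intro i hi
      rw [add_dotProduct, smul_dotProduct]
      by_cases hiI : i ∈ I
      · exact add_nonneg (m.2 i hiI) (nsmul_nonneg (m₀.2 i hi) _)
      · have h1 := hpos i hi hiI
        have h2 : ((m : Fin n → ℤ) ⬝ᵥ F.v i).natAbs ≤ N :=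
          Finset.single_le_sum (f := fun i => ((m : Fin n → ℤ) ⬝ᵥ F.v i).natAbs)
            (fun _ _ => Nat.zero_le _) (Finset.mem_univ i)
        rw [nsmul_eq_mul]
        have h3 : (N : ℤ) * 1 ≤ (N : ℤ) * ((m₀ : Fin n → ℤ) ⬝ᵥ F.v i) :=
          mul_le_mul_of_nonneg_left (by omega) (by positivity)
        omega
    refine ⟨N, AddMonoidAlgebra.single ⟨_, hmem⟩ c, ?_⟩
    rw [← map_pow, AddMonoidAlgebra.single_pow, restrictCoord_single, restrictCoord_single,
      AddMonoidAlgebra.single_mul_single, one_pow, mul_one]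
    rfl

lemma isLocalization {I J : Finset (Fin (n + 1))} (h : I ⊆ J) (m₀ : F.dualCone J)
    (h0 : ∀ i ∈ I, (m₀ : Fin n → ℤ) ⬝ᵥ F.v i = 0)
    (hpos : ∀ i ∈ J, i ∉ I → 0 < (m₀ : Fin n → ℤ) ⬝ᵥ F.v i) :
    @IsLocalization.Away _ _ (AddMonoidAlgebra.single m₀ 1 : F.CoordRing k J) (F.CoordRing k I) _
      (F.restrictCoord k h).toRingHom.toAlgebra := by
  let _ := (F.restrictCoord k h).toRingHom.toAlgebra
  have hal : ∀ x, algebraMap (F.CoordRing k J) (F.CoordRing k I) x = F.restrictCoord k h x :=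
    fun _ => rfl
  refine IsLocalization.Away.mk _ ?_ (fun y => ?_) (fun x y hxy => ?_)
  · have hneg : -(m₀ : Fin n → ℤ) ∈ F.dualCone I := fun i hi => by
      rw [neg_dotProduct, h0 i hi, neg_zero]
    refine IsUnit.of_mul_eq_one (AddMonoidAlgebra.single ⟨_, hneg⟩ 1) ?_
    rw [hal, restrictCoord_single, AddMonoidAlgebra.single_mul_single, AddMonoidAlgebra.one_def,
      mul_one]
    congr 1
    ext l
    simp
  · obtain ⟨N, x, hx⟩ := F.exists_localizing k h m₀ hpos y
    exact ⟨N, x, by rw [hal, hal]; exact hx⟩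
  · exact ⟨0, by rw [F.restrictCoord_injective k h hxy]⟩

/-- The affine toric variety `U_{σ_I} = Spec k[σ_I^∨ ∩ M]`; for `I = ∅` it is the torus `T`. -/
noncomputable def chart (I : Finset (Fin (n + 1))) : Scheme.{u} := Spec (.of (F.CoordRing k I))

/-- The inclusion `U_{σ_I} → U_{σ_J}` of affine toric varieties, for a face `σ_I` of `σ_J`. -/
noncomputable def chartMap {I J : Finset (Fin (n + 1))} (h : I ⊆ J) : F.chart k I ⟶ F.chart k J :=
  Spec.map (CommRingCat.ofHom (F.restrictCoord k h).toRingHom)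

lemma isOpenImmersion_chartMap {I J : Finset (Fin (n + 1))} (h : I ⊆ J) (hJ : J ≠ Finset.univ) :
    IsOpenImmersion (F.chartMap k h) := by
  obtain ⟨m, h0, hpos⟩ := F.exists_facet I J hJ
  have hm : m ∈ F.dualCone J := fun i hi => by
    by_cases hiI : i ∈ I
    · exact (h0 i hi hiI).ge
    · exact (hpos i hi hiI).le
  let _ := (F.restrictCoord k h).toRingHom.toAlgebra
  have := F.isLocalization k h ⟨m, hm⟩ (fun i hi => h0 i (h hi) hi) hpos
  exact IsOpenImmersion.of_isLocalization
    (AddMonoidAlgebra.single ⟨m, hm⟩ 1 : F.CoordRing k J)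

lemma range_chartMap {I J : Finset (Fin (n + 1))} (h : I ⊆ J) (m₀ : F.dualCone J)
    (h0 : ∀ i ∈ I, (m₀ : Fin n → ℤ) ⬝ᵥ F.v i = 0)
    (hpos : ∀ i ∈ J, i ∉ I → 0 < (m₀ : Fin n → ℤ) ⬝ᵥ F.v i) :
    Set.range (F.chartMap k h) =
      {x : PrimeSpectrum (F.CoordRing k J) | AddMonoidAlgebra.single m₀ 1 ∉ x.asIdeal} := by
  let _ := (F.restrictCoord k h).toRingHom.toAlgebra
  have := F.isLocalization k h m₀ h0 hpos
  exact PrimeSpectrum.localization_away_comap_range (F.CoordRing k I)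
    (AddMonoidAlgebra.single m₀ 1 : F.CoordRing k J)

/-- The gluing diagram of the affine toric varieties of the fan. -/
noncomputable def diagram : Cone n ⥤ Scheme.{u} where
  obj I := F.chart k I.1
  map f := F.chartMap k (leOfHom f)
  map_id I := by
    have : F.restrictCoord k (Finset.Subset.refl I.1) = AlgHom.id k _ := by
      ext m
      simp [restrictCoord_single]
      rfl
    change Spec.map (CommRingCat.ofHom (F.restrictCoord k (Finset.Subset.refl I.1)).toRingHom) = _
    rw [this]
    exact Spec.map_id _
  map_comp {I J K} f g := by
    have : F.restrictCoord k (leOfHom (f ≫ g)) =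
        (F.restrictCoord k (leOfHom f)).comp (F.restrictCoord k (leOfHom g)) := by
      ext m
      simp [restrictCoord_single]
      rfl
    change Spec.map (CommRingCat.ofHom (F.restrictCoord k (leOfHom (f ≫ g))).toRingHom) = _
    rw [this]
    exact Spec.map_comp (CommRingCat.ofHom (F.restrictCoord k (leOfHom g)).toRingHom)
      (CommRingCat.ofHom (F.restrictCoord k (leOfHom f)).toRingHom)

instance {I J : Cone n} (f : I ⟶ J) : IsOpenImmersion ((F.diagram k).map f) :=
  F.isOpenImmersion_chartMap k (leOfHom f) J.2

instance : (F.diagram k ⋙ Scheme.forget).IsLocallyDirected := by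
  constructor
  rintro ⟨I, hI⟩ ⟨J, hJ⟩ ⟨K, hK⟩ fi fj xi xj hx
  have hIK : I ⊆ K := leOfHom fi
  have hJK : J ⊆ K := leOfHom fj
  have hL : I ∩ J ≠ Finset.univ := fun h =>
    hI (Finset.eq_univ_iff_forall.2 fun i => Finset.inter_subset_left (h ▸ Finset.mem_univ i))
  obtain ⟨a, ha0, hapos⟩ := F.exists_facet I K hK
  obtain ⟨b, hb0, hbpos⟩ := F.exists_facet J K hK
  have ha : a ∈ F.dualCone K := fun i hi => by
    by_cases hiI : i ∈ I
    · exact (ha0 i hi hiI).ge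
    · exact (hapos i hi hiI).le
  have hb : b ∈ F.dualCone K := fun i hi => by
    by_cases hiJ : i ∈ J
    · exact (hb0 i hi hiJ).ge
    · exact (hbpos i hi hiJ).le
  let x : PrimeSpectrum (F.CoordRing k K) := F.chartMap k hIK xi
  have hxJ : F.chartMap k hJK xj = x := hx.symm
  have hxa : AddMonoidAlgebra.single (⟨a, ha⟩ : F.dualCone K) (1 : k) ∉ x.asIdeal := by
    have : x ∈ Set.range (F.chartMap k hIK) := ⟨xi, rfl⟩
    rwa [F.range_chartMap k hIK ⟨a, ha⟩ (fun i hi => ha0 i (hIK hi) hi) hapos] at this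
  have hxb : AddMonoidAlgebra.single (⟨b, hb⟩ : F.dualCone K) (1 : k) ∉ x.asIdeal := by
    have : x ∈ Set.range (F.chartMap k hJK) := ⟨xj, hxJ⟩
    rwa [F.range_chartMap k hJK ⟨b, hb⟩ (fun i hi => hb0 i (hJK hi) hi) hbpos] at this
  have hLK : I ∩ J ⊆ K := Finset.inter_subset_left.trans hIK
  have hxab : x ∈ Set.range (F.chartMap k hLK) := by
    rw [F.range_chartMap k hLK (⟨a, ha⟩ + ⟨b, hb⟩)]
    · change _ ∉ x.asIdeal
      have := fun h => (x.2.mem_or_mem h).elim hxa hxb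
      rwa [AddMonoidAlgebra.single_mul_single, one_mul] at this
    · intro i hi
      rw [Finset.mem_inter] at hi
      change (a + b) ⬝ᵥ F.v i = 0
      rw [add_dotProduct, ha0 i (hIK hi.1) hi.1, hb0 i (hJK hi.2) hi.2, add_zero]
    · intro i hi hiL
      change 0 < (a + b) ⬝ᵥ F.v i
      rw [add_dotProduct]
      by_cases hiI : i ∈ I
      · have hiJ : i ∉ J := fun h => hiL (Finset.mem_inter.2 ⟨hiI, h⟩)
        exact add_pos_of_nonneg_of_pos (ha i hi) (hbpos i hi hiJ)
      · exact add_pos_of_pos_of_nonneg (hapos i hi hiI) (hb i hi)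
  obtain ⟨z, hz⟩ := hxab
  let L : Cone n := ⟨I ∩ J, hL⟩
  let fLI : L ⟶ ⟨I, hI⟩ := homOfLE Finset.inter_subset_left
  let fLJ : L ⟶ ⟨J, hJ⟩ := homOfLE Finset.inter_subset_right
  refine ⟨L, fLI, fLJ, z, ?_, ?_⟩
  · apply ((F.diagram k).map fi).isOpenEmbedding.injective
    refine Eq.trans ?_ hz
    refine (Scheme.Hom.comp_apply ((F.diagram k).map fLI) ((F.diagram k).map fi) z).symm.trans ?_
    rw [← Functor.map_comp]
    rfl
  · apply ((F.diagram k).map fj).isOpenEmbedding.injective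
    refine Eq.trans ?_ (hz.trans hxJ.symm)
    refine (Scheme.Hom.comp_apply ((F.diagram k).map fLJ) ((F.diagram k).map fj) z).symm.trans ?_
    rw [← Functor.map_comp]
    rfl

/-- The fake weighted projective space `W` over `k`: the toric variety of the fan, that is the affine
toric varieties `U_σ` glued along the inclusions of faces. -/
noncomputable def toricVariety : Scheme.{u} := Limits.colimit (F.diagram k)

/-- The open immersion `U_{σ_I} → W`. -/
noncomputable def ι (I : Cone n) : F.chart k I.1 ⟶ F.toricVariety k :=
  Limits.colimit.ι (F.diagram k) I

/-- The structure morphism `W → Spec k`. -/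
noncomputable instance : (F.toricVariety k).Over (Spec (.of k)) where
  hom := Limits.colimit.desc (F.diagram k)
    { pt := Spec (.of k)
      ι := { app := fun I => Spec.map (CommRingCat.ofHom (algebraMap k (F.CoordRing k I.1)))
             naturality := by
              intro I J f
              change Spec.map _ ≫ Spec.map _ = _
              rw [← Spec.map_comp, ← CommRingCat.ofHom_comp]
              erw [Category.comp_id]
              congr 2
              refine RingHom.ext fun c => ?_
              exact (F.restrictCoord k (leOfHom f)).commutes c } }

instance (I : Cone n) : IsOpenImmersion (F.ι k I) :=
  Scheme.IsLocallyDirected.instIsOpenImmersionι (F.diagram k) I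

instance (I : Finset (Fin (n + 1))) : IsIntegral (F.chart k I) :=
  inferInstanceAs (IsIntegral (Spec (.of (F.CoordRing k I))))

lemma chartMap_ι {I J : Cone n} (h : I.1 ⊆ J.1) : F.chartMap k h ≫ F.ι k J = F.ι k I :=
  Limits.colimit.w (F.diagram k) (homOfLE h : I ⟶ J)

lemma ι_jointly_surjective (x : F.toricVariety k) : ∃ I, ∃ y, F.ι k I y = x :=
  Scheme.IsLocallyDirected.ι_jointly_surjective (F.diagram k) x

instance : IsReduced (F.toricVariety k) :=
  have : ∀ I, IsReduced ((Scheme.IsLocallyDirected.openCover (F.diagram k)).X I) := fun I =>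
    inferInstanceAs (IsReduced (F.chart k I.1))
  IsReduced.of_openCover _ (Scheme.IsLocallyDirected.openCover (F.diagram k))

instance : IrreducibleSpace (F.toricVariety k) := by
  have hne : (∅ : Finset (Fin (n + 1))) ≠ Finset.univ := Finset.univ_nonempty.ne_empty.symm
  let x₀ : F.chart k ∅ := genericPoint (F.chart k ∅)
  have hmem : ∀ I : Cone n, F.ι k ⟨∅, hne⟩ x₀ ∈ (F.ι k I).opensRange := fun I =>
    ⟨F.chartMap k (Finset.empty_subset I.1) x₀, by
      rw [← Scheme.Hom.comp_apply, F.chartMap_ι k (I := ⟨∅, hne⟩)]⟩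
  have : PreirreducibleSpace (F.toricVariety k) := by
    refine PreirreducibleSpace.of_isOpenCover (U := fun I => (F.ι k I).opensRange) ?_ ?_ ?_
    · intro I J _ h
      exact Set.disjoint_left.1 (TopologicalSpace.Opens.coe_disjoint.2 h) (hmem I) (hmem J)
    · refine .mk (eq_top_iff.2 fun x _ => ?_)
      obtain ⟨I, y, hy⟩ := F.ι_jointly_surjective k x
      exact TopologicalSpace.Opens.mem_iSup.2 ⟨I, y, hy⟩
    · intro I
      exact ((F.ι k I).isOpenEmbedding.toIsEmbedding.toHomeomorph.irreducibleSpace_iff.1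
        inferInstance).toPreirreducibleSpace
  exact ⟨⟨F.ι k ⟨∅, hne⟩ x₀⟩⟩

instance : IsIntegral (F.toricVariety k) :=
  isIntegral_of_irreducibleSpace_of_isReduced _

/-! ### Torus orbits and one-parameter subgroups -/

/-- The lattice `σ_I^⊥ ∩ M`. -/
def perp (I : Finset (Fin (n + 1))) : AddSubgroup (Fin n → ℤ) where
  carrier := {m | ∀ i ∈ I, m ⬝ᵥ F.v i = 0}
  zero_mem' := by simp
  add_mem' := by
    intro a b ha hb i hi
    rw [add_dotProduct, ha i hi, hb i hi, add_zero]
  neg_mem' := by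
    intro a ha i hi
    rw [neg_dotProduct, ha i hi, neg_zero]

open Classical in
/-- The multiplicative map `σ_I^∨ ∩ M → k[σ_I^⊥ ∩ M]` sending `m` to `χ^m` if `m ∈ σ_I^⊥`, and to `0`
otherwise. -/
noncomputable def orbitChar (I : Finset (Fin (n + 1))) :
    Multiplicative (F.dualCone I) →* AddMonoidAlgebra k (F.perp I) where
  toFun m := if h : (m.toAdd : Fin n → ℤ) ∈ F.perp I then AddMonoidAlgebra.single ⟨_, h⟩ 1 else 0
  map_one' := by
    rw [dif_pos (show ((1 : Multiplicative (F.dualCone I)).toAdd : Fin n → ℤ) ∈ F.perp I from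
      (F.perp I).zero_mem)]
    rfl
  map_mul' a b := by
    have key : ((a * b).toAdd : Fin n → ℤ) ∈ F.perp I ↔
        (a.toAdd : Fin n → ℤ) ∈ F.perp I ∧ (b.toAdd : Fin n → ℤ) ∈ F.perp I := by
      constructor
      · intro h
        have h' : ∀ i ∈ I, (a.toAdd : Fin n → ℤ) ⬝ᵥ F.v i = 0 ∧
            (b.toAdd : Fin n → ℤ) ⬝ᵥ F.v i = 0 := by
          intro i hi
          have h1 : ((a.toAdd : Fin n → ℤ) + (b.toAdd : Fin n → ℤ)) ⬝ᵥ F.v i = 0 := h i hi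
          rw [add_dotProduct] at h1
          exact (add_eq_zero_iff_of_nonneg (a.toAdd.2 i hi) (b.toAdd.2 i hi)).1 h1
        exact ⟨fun i hi => (h' i hi).1, fun i hi => (h' i hi).2⟩
      · rintro ⟨ha, hb⟩
        exact (F.perp I).add_mem ha hb
    by_cases ha : (a.toAdd : Fin n → ℤ) ∈ F.perp I
    · by_cases hb : (b.toAdd : Fin n → ℤ) ∈ F.perp I
      · rw [dif_pos (key.2 ⟨ha, hb⟩), dif_pos ha, dif_pos hb, AddMonoidAlgebra.single_mul_single,
          one_mul]
        rfl
      · rw [dif_neg (fun h => hb (key.1 h).2), dif_neg hb, mul_zero]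
    · rw [dif_neg (fun h => ha (key.1 h).1), dif_neg ha, zero_mul]

/-- The torus `O_{σ_I} = Spec k[σ_I^⊥ ∩ M]`. It is the `T`-orbit in `W` that corresponds to `σ_I`,
i.e. the quotient of `T` by the stabilizer of the distinguished point of `U_{σ_I}`, and it is the
torus `T_Z` of the orbit closure `Z = V(σ_I)`. -/
noncomputable def orbitTorus (I : Cone n) : Scheme.{u} :=
  Spec (.of (AddMonoidAlgebra k (F.perp I.1)))

/-- The inclusion `O_{σ_I} → U_{σ_I} → W` of the `T`-orbit that corresponds to `σ_I`. -/
noncomputable def orbitι (I : Cone n) : F.orbitTorus k I ⟶ F.toricVariety k :=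
  Spec.map (CommRingCat.ofHom
    (AddMonoidAlgebra.lift k (AddMonoidAlgebra k (F.perp I.1)) (F.dualCone I.1)
      (F.orbitChar k I.1)).toRingHom) ≫ F.ι k I

/-- The `T`-orbit closure `Z = V(σ_I)` in `W`. Every `T`-orbit closure is of this form. -/
def orbitClosure (I : Cone n) : Set (F.toricVariety k) := closure (Set.range (F.orbitι k I))

/-- The one-parameter subgroup `𝔾ₘ → T_Z` given by the cocharacter `l`, i.e. `χ^m ↦ s^{l m}`. -/
noncomputable def onePS (I : Cone n) (l : F.perp I.1 →+ ℤ) :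
    Spec (.of (AddMonoidAlgebra k ℤ)) ⟶ F.orbitTorus k I :=
  Spec.map (CommRingCat.ofHom (AddMonoidAlgebra.mapDomainAlgHom k k l).toRingHom)

/-- Translation on the torus `T_Z` by the `k`-point `t ∈ T_Z(k) = Hom (σ_I^⊥ ∩ M, kˣ)`. -/
noncomputable def translation (I : Cone n) (t : Multiplicative (F.perp I.1) →* kˣ) :
    F.orbitTorus k I ⟶ F.orbitTorus k I :=
  Spec.map (CommRingCat.ofHom
    (AddMonoidAlgebra.lift k (AddMonoidAlgebra k (F.perp I.1)) (F.perp I.1)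
      { toFun := fun m => AddMonoidAlgebra.single m.toAdd (t m : k)
        map_one' := by
          rw [t.map_one]
          rfl
        map_mul' := fun a b => by
          rw [AddMonoidAlgebra.single_mul_single, t.map_mul]
          rfl }).toRingHom)

end FakeWPSFan

/-! # Orders of functions and of differential forms along discrete valuations -/

section
variable {k K : Type*} [Field k] [Field K] [Algebra k K]

/-- `f` is a unit times the `a`-th power of a uniformizer of `R`, for a discrete valuation ring `R`
with fraction field `K`: the order of `f` along `R` is `a`. -/
def HasOrd (R : Subalgebra k K) (f : K) (a : ℤ) : Prop :=
  ∃ p u : R, Irreducible p ∧ IsUnit u ∧ f = (u : K) * (p : K) ^ a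

/-- The lattice of regular `n`-forms: the `R`-submodule of `Λⁿ Ω_{K/k}` generated by all
`dr₁ ∧ … ∧ drₙ` with `rⱼ ∈ R`, i.e. the image of `Λⁿ Ω_{R/k}`. -/
noncomputable def formLattice (n : ℕ) (R : Subalgebra k K) : Submodule R (⋀[K]^n (Ω[K⁄k])) :=
  Submodule.span R (Set.range fun r : Fin n → R =>
    exteriorPower.ιMulti K n fun j => KaehlerDifferential.D k K (r j))

/-- The order of the rational `n`-form `ω` along the discrete valuation ring `R` is `a`: up to the
factor `p ^ a`, with `p` a uniformizer, `ω` generates the lattice of regular forms. Here `n` is the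
transcendence degree of `K` over `k`. -/
def HasFormOrd {n : ℕ} (R : Subalgebra k K) (ω : ⋀[K]^n (Ω[K⁄k])) (a : ℤ) : Prop :=
  ∃ p : R, Irreducible p ∧ Submodule.span R {((p : K) ^ (-a)) • ω} = formLattice n R

variable (k K) in
/-- A discrete valuation ring of `K` containing `k`, with fraction field `K`. -/
structure DVRSubalgebra where
  ring : Subalgebra k K
  isDVR : IsDiscreteValuationRing ring
  isFractionRing : IsFractionRing ring K

attribute [instance] DVRSubalgebra.isDVR DVRSubalgebra.isFractionRing
end

/-! # Divisors, intersection numbers and terminal singularities on integral schemes over `k` -/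

section
variable (k : Type u) [Field k] {X : Scheme.{u}} [X.Over (Spec (.of k))] [IsIntegral X]

/-- The function field of a `k`-scheme as an extension of `k`. -/
noncomputable instance functionFieldAlgebra : Algebra k X.functionField :=
  ((Scheme.ΓSpecIso (.of k)).inv ≫ (X ↘ Spec (.of k)).appTop ≫
    X.presheaf.germ ⊤ (genericPoint X) trivial).hom.toAlgebra

/-- The local ring at `x`, as a subring of the function field. -/
noncomputable def localRing (x : X) : Subalgebra k X.functionField where
  toSubsemiring := (algebraMap (X.presheaf.stalk x) X.functionField).rangeS
  algebraMap_mem' c := by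
    refine ⟨((Scheme.ΓSpecIso (.of k)).inv ≫ (X ↘ Spec (.of k)).appTop ≫
      X.presheaf.germ ⊤ x trivial).hom c, ?_⟩
    have : Nonempty (⊤ : X.Opens) := ⟨⟨x, trivial⟩⟩
    exact Scheme.algebraMap_germ_eq_germToFunctionField (X := X) (U := ⊤) (x := x) trivial _

/-- `x` is the generic point of a prime divisor. On a normal locally Noetherian scheme the points of
codimension one are exactly the points whose local ring is a discrete valuation ring. -/
def IsPrimeDivisorPoint (x : X) : Prop := IsDiscreteValuationRing (localRing k x)

/-- The Weil divisor `D` is the divisor of the rational top form `ω`. A Weil divisor is given by its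
coefficients `D x` at the generic points `x` of prime divisors; other values of `D` are ignored. -/
def IsDivisorOfForm {n : ℕ} (ω : ⋀[X.functionField]^n (Ω[X.functionField⁄k])) (D : X → ℤ) : Prop :=
  ∀ x : X, IsPrimeDivisorPoint k x → HasFormOrd (localRing k x) ω (D x)

/-- `D` is a canonical divisor of `X`, where `n = dim X`. -/
def IsCanonicalDivisor (n : ℕ) (D : X → ℤ) : Prop :=
  ∃ ω : ⋀[X.functionField]^n (Ω[X.functionField⁄k]), ω ≠ 0 ∧ IsDivisorOfForm k ω D

/-- `f` is an equation of the Weil divisor `D` on a neighbourhood of `x`. -/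
def IsLocalEquation (D : X → ℤ) (x : X) (f : X.functionField) : Prop :=
  f ≠ 0 ∧ ∃ U : X.Opens, x ∈ U ∧ ∀ z ∈ U, IsPrimeDivisorPoint k z → HasOrd (localRing k z) f (D z)

/-- Some positive multiple of the Weil divisor `D` is Cartier. -/
def IsQCartier (D : X → ℤ) : Prop :=
  ∃ m : ℕ, 0 < m ∧ ∀ x : X, ∃ f, IsLocalEquation k (fun z => m * D z) x f

/-- `x` is the center of the valuation ring `R` on `X`: `R` dominates the local ring at `x`. -/
def IsCenter (R : Subalgebra k X.functionField) (x : X) : Prop :=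
  localRing k x ≤ R ∧ ∀ a ∈ localRing k x, a⁻¹ ∈ R → a⁻¹ ∈ localRing k x

variable (X) in
/-- `X`, of dimension `n`, has terminal singularities: it is normal, its canonical divisor is
`ℚ`-Cartier, and every exceptional prime divisor over `X` has positive discrepancy. A prime divisor
over `X` is a discrete valuation ring `R` of the function field that has a center on `X` and whose
residue field has transcendence degree `n - 1`; it is exceptional if its center is not the generic
point of a prime divisor on `X`. If `f` is a local equation of `m K_X = m div ω` at the center, then
the discrepancy is `ord_R ω - (1 / m) ord_R f`. -/
def IsTerminal (n : ℕ) : Prop :=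
  (∀ x : X, IsIntegrallyClosed (X.presheaf.stalk x)) ∧
  (∃ D : X → ℤ, IsCanonicalDivisor k n D ∧ IsQCartier k D) ∧
  ∀ (ω : ⋀[X.functionField]^n (Ω[X.functionField⁄k])) (D : X → ℤ), ω ≠ 0 → IsDivisorOfForm k ω D →
  ∀ (R : DVRSubalgebra k X.functionField) (x : X),
    Algebra.trdeg k (IsLocalRing.ResidueField R.ring) + 1 = (n : Cardinal) →
    IsCenter k R.ring x → ¬ IsPrimeDivisorPoint k x →
  ∀ (m : ℕ) (f : X.functionField), 0 < m → IsLocalEquation k (fun z => m * D z) x f →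
  ∀ a b : ℤ, HasFormOrd R.ring ω a → HasOrd R.ring f b → 0 < m * a - b

/-- `q = D · C` for a complete integral curve `i : C → X` and a Weil divisor `D` on `X` such that `m D`
is Cartier for some `m > 0` (near `C`): replace `m D` by the linearly equivalent
divisor `m D - div h`, whose local equations `g x` at the points of `C` are units at the generic
point of `C`, restrict them to `C`, and take the degree on the normalization of `C`. The closed
points of the normalization are the discrete valuation rings `R` of the function field of `C` over
`k`; such a point has degree `[κ(R) : k]` and lies over the center `x` of `R`. -/
def IsIntersectionNumber {C : Scheme.{u}} [C.Over (Spec (.of k))] [IsIntegral C]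
    (D : X → ℤ) (i : C ⟶ X) (q : ℚ) : Prop :=
  ∃ (m : ℕ) (h : X.functionField) (g : C → X.presheaf.stalk (i (genericPoint C)))
    (e : DVRSubalgebra k C.functionField → ℤ),
    0 < m ∧ h ≠ 0 ∧ (∀ x, IsUnit (g x)) ∧
    (∀ x, IsLocalEquation k (fun z => m * D z) (i x)
      (h * algebraMap (X.presheaf.stalk (i (genericPoint C))) X.functionField (g x))) ∧
    (∀ R, ∃ x, IsCenter k R.ring x ∧ HasOrd R.ring (i.stalkMap (genericPoint C) (g x)) (e R)) ∧
    e.support.Finite ∧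
    m * q = ∑ᶠ R, (Module.finrank k (IsLocalRing.ResidueField R.ring) : ℚ) * e R

variable (X) in
/-- `X` is birational over `k` to the affine line. -/
def IsRationalCurve : Prop :=
  Scheme.BirationalOver (X ↘ Spec (.of k)) (𝔸(PUnit.{u + 1}; Spec (.of k)) ↘ Spec (.of k))
end

/-- `C` is unibranch at each of its points: the integral closure of the local ring in its fraction
field is local. -/
def IsUnibranch (C : Scheme.{u}) [IsIntegral C] : Prop :=
  ∀ x : C, IsLocalRing (integralClosure (C.presheaf.stalk x) C.functionField)

section
attribute [local instance] MvPolynomial.gradedAlgebra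

/-- Projective space `ℙⁿ` over `k`. -/
noncomputable def projSpace (k : Type u) [Field k] (n : ℕ) : Scheme.{u} :=
  Proj (MvPolynomial.homogeneousSubmodule (Fin (n + 1)) k)

/-- The structure morphism `ℙⁿ → Spec k`. -/
noncomputable instance (k : Type u) [Field k] (n : ℕ) :
    (projSpace k n).Over (Spec (.of k)) where
  hom := Proj.toSpecZero (MvPolynomial.homogeneousSubmodule (Fin (n + 1)) k) ≫
    Spec.map (CommRingCat.ofHom
      (algebraMap k (MvPolynomial.homogeneousSubmodule (Fin (n + 1)) k 0)))
end

/-!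
The curve is the closure of a translate of a one-parameter subgroup. Its direction is chosen by the
geometry of numbers of the fan, and its degree is read off from the two ends of the curve.

*Divisors.* All local rings of `W` consist of fractions of Laurent polynomials. A cocharacter `u`
defines a discrete valuation ring `toricRing` of the function field, and the local rings of the
torus invariant prime divisors are those of the rays. The form `dx₁/x₁ ∧ … ∧ dxₙ/xₙ` has a simple
pole along each toric valuation and has neither zeros nor poles on the torus, so that minus the
boundary is a canonical divisor (`isCanonicalDivisor_canonicalDivisor`). On the chart of a cone a
multiple `N K_W` has a monomial as equation (`exists_uniform_weight`,
`isLocalEquation_laurent_single`).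

*Curves.* For a surjective cocharacter `l` of the torus of a cone `σ_J`, the closure of a translate
of the one-parameter subgroup contains `𝔾ₘ` as an open subset, hence is rational
(`isRationalCurve_curve`). In each chart its coordinate ring contains two consecutive powers of the
coordinate of `𝔾ₘ`. Therefore only one valuation ring lies over each of its local rings away from
`𝔾ₘ`, and the curve is unibranch (`isLocalRing_integralClosure`, `isUnibranch_curve`). The
valuation rings of its function field are those of the points of `𝔾ₘ` and of the two ends `0` and
`∞`. As the local equations of `N K_W` are monomials, only the two ends contribute to the degree
(`isIntersectionNumber_curve`). Let `∑ aᵢ vᵢ = 0` be the relation between the rays. If the direction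
is `∑ cᵢ vᵢ`, then the degree of `-K_W` is at most `∑ aᵢ` times the difference between the maximum
and the minimum of `cᵢ / aᵢ` over the rays off `J` (`exists_hasToricCurve`).

*The point.* Let `P` lie in the orbit of `σ_I`. A direction `∑ cᵢ vᵢ` with `0 ≤ cᵢ ≤ β aᵢ` and with
a coefficient zero off `I` yields a curve through `P` of degree at most `β ∑ aᵢ`: if a coefficient
off `I` is not zero, this is a curve in the closure of the orbit, with `P` on its open part;
otherwise it is a curve in a larger orbit closure, with `P` as one of its ends
(`exists_cone_hasToricCurve`). With one of `v_{i₀}` and `-v_{i₀}` as direction, where `a_{i₀}` is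
the largest weight, this gives degree at most `∑ aᵢ / a_{i₀} ≤ n + 1`
(`exists_hasToricCurve_le_div`).

*Terminal singularities.* Suppose that this bound exceeds `n`. Then the lattice vector
`∑ vᵢ = ∑ (1 - aᵢ / a_{i₀}) vᵢ` lies in a cone and its coefficients have sum less than `1`. Unless
it is zero, the toric valuation on its ray is an exceptional divisor of discrepancy at most `0`
(`eq_zero_of_isTerminal`). So `∑ vᵢ = 0`, and all weights may be taken to be `1`. If the rays
generate the lattice, then `W` is projective space, by homogeneous coordinates
(`exists_iso_projSpace`). If not, there is a vector `w` of prime order `p` modulo the sublattice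
that they generate, and its multiples modulo the sublattice are represented by vectors with
coefficients in `{0, 1/p, …, (p - 1)/p}`, one of which, off `I`, is zero. Each of the other `n`
coefficients exceeds `n / (n + 1)` for at most `(p - 1) / (n + 1)` of the multiples, hence some
nonzero multiple has all coefficients at most `n / (n + 1)` (`exists_small_multiples`), and it is
the direction of a curve of degree at most `n` (`exists_hasToricCurve_le_of_span_ne_top`).
-/

/-! ### Discrete valuation rings inside a field -/

section Fraction
variable {k A K : Type*} [Field k] [CommRing A] [Algebra k A] [Field K] [Algebra k K]

/-- The fractions `φ a / φ s` with `s ∈ S`, as a subalgebra of `K`. The defining equation is written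
as `x * φ s = φ a`, so that no condition on `φ s` is needed for closure under the operations. -/
def fracSubalgebra (φ : A →ₐ[k] K) (S : Submonoid A) : Subalgebra k K where
  carrier := {x | ∃ a, ∃ s ∈ S, x * φ s = φ a}
  mul_mem' := by
    rintro x y ⟨a, s, hs, hx⟩ ⟨b, t, ht, hy⟩
    exact ⟨a * b, s * t, S.mul_mem hs ht, by rw [map_mul, map_mul, ← hx, ← hy]; ring⟩
  add_mem' := by
    rintro x y ⟨a, s, hs, hx⟩ ⟨b, t, ht, hy⟩
    exact ⟨a * t + b * s, s * t, S.mul_mem hs ht, by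
      rw [map_add, map_mul, map_mul, map_mul, ← hx, ← hy]; ring⟩
  algebraMap_mem' c := ⟨algebraMap k A c, 1, S.one_mem, by simp⟩

lemma mem_fracSubalgebra {φ : A →ₐ[k] K} {S : Submonoid A} {x : K} :
    x ∈ fracSubalgebra φ S ↔ ∃ a, ∃ s ∈ S, x * φ s = φ a := Iff.rfl

lemma map_mem_fracSubalgebra (φ : A →ₐ[k] K) (S : Submonoid A) (a : A) :
    φ a ∈ fracSubalgebra φ S := ⟨a, 1, S.one_mem, by simp⟩

/-- `K` is the field of fractions of `A` by means of `φ`. -/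
structure IsFractionMap (φ : A →ₐ[k] K) : Prop where
  injective : Function.Injective φ
  exists_frac : ∀ x, ∃ a b, b ≠ 0 ∧ x * φ b = φ a

end Fraction

section DVR
variable {k K : Type*} [Field k] [Field K] [Algebra k K]

lemma isUnit_subalgebra_iff {R : Subalgebra k K} (x : R) (hx : (x : K) ≠ 0) :
    IsUnit x ↔ (x : K)⁻¹ ∈ R := by
  constructor
  · rintro ⟨v, rfl⟩
    have : ((v : R) : K)⁻¹ = ((v⁻¹ : Rˣ) : R) := by
      refine (eq_inv_of_mul_eq_one_left ?_).symm
      rw [← MulMemClass.coe_mul, Units.inv_mul]; rfl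
    rw [this]; exact SetLike.coe_mem _
  · intro h
    exact IsUnit.of_mul_eq_one ⟨_, h⟩ (Subtype.ext (mul_inv_cancel₀ hx))

section Uniformizer
variable {R : Subalgebra k K} {π : K} (hπ : π ∈ R) (hπ0 : π ≠ 0) (hinv : π⁻¹ ∉ R)
  (hfac : ∀ x : K, x ≠ 0 → ∃ v : K, ∃ c : ℤ, v ∈ R ∧ v⁻¹ ∈ R ∧ x = v * π ^ c)
include hπ hπ0 hinv

lemma zpow_mem_subalgebra_iff {c : ℤ} : π ^ c ∈ R ↔ 0 ≤ c := by
  constructor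
  · intro h
    by_contra! hc
    obtain ⟨d, rfl⟩ : ∃ d : ℕ, c = -1 - d := ⟨(-1 - c).toNat, by omega⟩
    apply hinv
    have : π⁻¹ = π ^ (-1 - d : ℤ) * π ^ d := by
      rw [← zpow_natCast, ← zpow_add₀ hπ0]; simp
    rw [this]
    exact R.mul_mem h (R.pow_mem hπ d)
  · intro hc
    lift c to ℕ using hc
    rw [zpow_natCast]; exact R.pow_mem hπ c

include hfac

lemma irreducible_of_uniformizer : Irreducible (⟨π, hπ⟩ : R) := by
  have hz := fun c => zpow_mem_subalgebra_iff hπ hπ0 hinv (c := c)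
  have hu : ∀ x : R, (x : K) ≠ 0 →
      ∃ v : K, ∃ c : ℕ, v ∈ R ∧ v⁻¹ ∈ R ∧ v ≠ 0 ∧ (x : K) = v * π ^ c := by
    intro x hx
    obtain ⟨v, c, hv, hv', h⟩ := hfac x hx
    have hv0 : v ≠ 0 := by rintro rfl; simp at h; exact hx (by simpa using h)
    have hc : 0 ≤ c := by
      rw [← hz]
      have : π ^ c = v⁻¹ * x := by rw [h, inv_mul_cancel_left₀ hv0]
      rw [this]; exact R.mul_mem hv' x.2
    lift c to ℕ using hc
    exact ⟨v, c, hv, hv', hv0, by simpa using h⟩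
  refine ⟨fun h => hinv ((isUnit_subalgebra_iff _ hπ0).1 h), fun x y hxy => ?_⟩
  have hxy' : π = x * y := congrArg Subtype.val hxy
  have hx0 : (x : K) ≠ 0 := fun h => hπ0 (by rw [hxy', h, zero_mul])
  have hy0 : (y : K) ≠ 0 := fun h => hπ0 (by rw [hxy', h, mul_zero])
  obtain ⟨v, c, hv, hv', hv0, hx⟩ := hu x hx0
  obtain ⟨w, d, hw, hw', hw0, hy⟩ := hu y hy0
  have hunit : ∀ (x : R) (v : K), v⁻¹ ∈ R → v ≠ 0 → (x : K) = v * π ^ 0 → IsUnit x := by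
    intro x v hv' hv0 h
    rw [isUnit_subalgebra_iff x (by rw [h]; simpa using hv0), h]
    simpa using hv'
  rcases Nat.eq_zero_or_pos c with rfl | hc
  · exact Or.inl (hunit x v hv' hv0 hx)
  rcases Nat.eq_zero_or_pos d with rfl | hd
  · exact Or.inr (hunit y w hw' hw0 hy)
  exfalso
  apply hinv
  obtain ⟨c, rfl⟩ := Nat.exists_eq_add_of_lt hc
  obtain ⟨d, rfl⟩ := Nat.exists_eq_add_of_lt hd
  have : π⁻¹ = v * w * π ^ (c + d) := by
    refine (eq_inv_of_mul_eq_one_right ?_).symm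
    have h1 : π * 1 = π * (π * (v * w * π ^ (c + d))) := by
      rw [mul_one]
      nth_rw 1 [hxy', hx, hy]
      ring
    exact (mul_left_cancel₀ hπ0 h1).symm
  rw [this]
  exact R.mul_mem (R.mul_mem hv hw) (R.pow_mem hπ _)

/-- A subring of a field in which every nonzero element of the field is a unit times a power of a
fixed nonunit is a discrete valuation ring. -/
lemma isDiscreteValuationRing_of_uniformizer : IsDiscreteValuationRing R := by
  refine IsDiscreteValuationRing.ofHasUnitMulPowIrreducibleFactorization
    ⟨⟨π, hπ⟩, irreducible_of_uniformizer hπ hπ0 hinv hfac, fun {x} hx => ?_⟩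
  have hx0 : (x : K) ≠ 0 := fun h => hx (Subtype.ext h)
  obtain ⟨v, c, hv, hv', h⟩ := hfac x hx0
  have hv0 : v ≠ 0 := by rintro rfl; exact hx0 (by simpa using h)
  have hc : 0 ≤ c := by
    rw [← zpow_mem_subalgebra_iff hπ hπ0 hinv]
    have : π ^ c = v⁻¹ * x := by rw [h, inv_mul_cancel_left₀ hv0]
    rw [this]; exact R.mul_mem hv' x.2
  lift c to ℕ using hc
  obtain ⟨w, hw⟩ := (isUnit_subalgebra_iff (⟨v, hv⟩ : R) hv0).2 hv'
  refine ⟨c, w, Subtype.ext ?_⟩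
  rw [hw, h, zpow_natCast, mul_comm]
  rfl

omit hinv in
lemma isFractionRing_of_uniformizer : IsFractionRing R K := by
  refine ⟨fun y => ?_, fun x => ?_, fun {x y} h => ⟨1, by simpa using h⟩⟩
  · have : ((y : R) : K) ≠ 0 := fun h => nonZeroDivisors.ne_zero y.2 (Subtype.ext h)
    exact isUnit_iff_ne_zero.2 this
  · by_cases hx : x = 0
    · exact ⟨⟨0, 1⟩, by simp [hx]⟩
    obtain ⟨v, c, hv, hv', h⟩ := hfac x hx
    obtain ⟨a, b, rfl⟩ : ∃ a b : ℕ, c = a - b := ⟨c.toNat, (-c).toNat, by omega⟩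
    have hb : (⟨π ^ b, R.pow_mem hπ b⟩ : R) ∈ nonZeroDivisors R :=
      mem_nonZeroDivisors_of_ne_zero fun h => pow_ne_zero b hπ0 (congrArg Subtype.val h)
    refine ⟨⟨⟨v * π ^ a, R.mul_mem hv (R.pow_mem hπ a)⟩, ⟨_, hb⟩⟩, ?_⟩
    change x * π ^ b = v * π ^ a
    rw [h, zpow_sub₀ hπ0, zpow_natCast, zpow_natCast, mul_assoc,
      div_mul_cancel₀ _ (pow_ne_zero b hπ0)]

end Uniformizer

section IsDVR
variable {R : Subalgebra k K}

/-- The factorization into a unit and a power of a uniformizer, for elements of the fraction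
field. -/
lemma exists_eq_unit_mul_zpow [IsDiscreteValuationRing R] [IsFractionRing R K] {p : R}
    (hp : Irreducible p) (x : K) (hx : x ≠ 0) :
    ∃ (v : Rˣ) (c : ℤ), x = ((v : R) : K) * (p : K) ^ c := by
  have hp0 : (p : K) ≠ 0 := fun h => hp.ne_zero (Subtype.ext h)
  obtain ⟨a, b, hb, rfl⟩ := IsFractionRing.div_surjective (A := R) x
  have hb0 : b ≠ 0 := nonZeroDivisors.ne_zero hb
  have ha0 : a ≠ 0 := by rintro rfl; simp at hx
  obtain ⟨i, v, hv⟩ := IsDiscreteValuationRing.eq_unit_mul_pow_irreducible ha0 hp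
  obtain ⟨j, w, hw⟩ := IsDiscreteValuationRing.eq_unit_mul_pow_irreducible hb0 hp
  refine ⟨v * w⁻¹, i - j, ?_⟩
  have hw0 : ((w : R) : K) ≠ 0 := fun h => w.ne_zero (Subtype.ext h)
  have hwi : (((w⁻¹ : Rˣ) : R) : K) = ((w : R) : K)⁻¹ := by
    refine eq_inv_of_mul_eq_one_left ?_
    rw [← MulMemClass.coe_mul, Units.inv_mul]; rfl
  change (a : K) / (b : K) = _
  rw [hv, hw, Units.val_mul, MulMemClass.coe_mul, MulMemClass.coe_mul, MulMemClass.coe_mul, hwi,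
    zpow_sub₀ hp0, zpow_natCast, zpow_natCast]
  simp only [SubmonoidClass.coe_pow]
  field_simp

lemma inv_not_mem_of_irreducible {p : R} (hp : Irreducible p) : (p : K)⁻¹ ∉ R := fun h =>
  hp.not_isUnit ((isUnit_subalgebra_iff p fun h0 => hp.ne_zero (Subtype.ext h0)).2 h)

/-- A discrete valuation ring is a maximal proper subring of its fraction field. -/
lemma eq_of_le_of_isDiscreteValuationRing [IsDiscreteValuationRing R] [IsFractionRing R K]
    {R' : Subalgebra k K} (h : R ≤ R') (htop : R' ≠ ⊤) :
    R = R' := by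
  refine le_antisymm h fun x hx => ?_
  obtain ⟨p, hp⟩ := IsDiscreteValuationRing.exists_irreducible R
  have hp0 : (p : K) ≠ 0 := fun h0 => hp.ne_zero (Subtype.ext h0)
  by_cases hx0 : x = 0
  · rw [hx0]; exact R.zero_mem
  have hpi : (p : K)⁻¹ ∉ R' := by
    intro hpi
    apply htop
    rw [eq_top_iff]
    intro y _
    by_cases hy0 : y = 0
    · rw [hy0]; exact R'.zero_mem
    obtain ⟨v, c, rfl⟩ := exists_eq_unit_mul_zpow hp y hy0
    refine R'.mul_mem (h (SetLike.coe_mem _)) ?_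
    rcases le_total 0 c with hc | hc
    · lift c to ℕ using hc
      rw [zpow_natCast]; exact R'.pow_mem (h p.2) c
    · obtain ⟨d, rfl⟩ : ∃ d : ℕ, c = -d := ⟨(-c).toNat, by omega⟩
      rw [zpow_neg, zpow_natCast, ← inv_pow]; exact R'.pow_mem hpi d
  obtain ⟨v, c, rfl⟩ := exists_eq_unit_mul_zpow hp x hx0
  have hv0 : ((v : R) : K) ≠ 0 := fun h => v.ne_zero (Subtype.ext h)
  have hc : (p : K) ^ c ∈ R' := by
    have := R'.mul_mem (h ((isUnit_subalgebra_iff (v : R) hv0).1 v.isUnit)) hx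
    rwa [inv_mul_cancel_left₀ hv0] at this
  rw [zpow_mem_subalgebra_iff (h p.2) hp0 hpi] at hc
  lift c to ℕ using hc
  rw [zpow_natCast]
  exact R.mul_mem (SetLike.coe_mem _) (R.pow_mem p.2 c)

lemma HasOrd.unique [IsDiscreteValuationRing R] {f : K} {a b : ℤ} (ha : HasOrd R f a)
    (hb : HasOrd R f b) : a = b := by
  obtain ⟨p, v, hp, hv, rfl⟩ := ha
  obtain ⟨q, w, hq, hw, h⟩ := hb
  obtain ⟨z, rfl⟩ := IsDiscreteValuationRing.associated_of_irreducible R hp hq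
  have hp0 : (p : K) ≠ 0 := fun h0 => hp.ne_zero (Subtype.ext h0)
  have hinv := inv_not_mem_of_irreducible (K := K) hp
  have hne : ∀ {t : R}, IsUnit t → (t : K) ≠ 0 := fun ht h0 => ht.ne_zero (Subtype.ext h0)
  have hI : ∀ {t : R}, IsUnit t → (t : K)⁻¹ ∈ R := fun ht => (isUnit_subalgebra_iff _ (hne ht)).1 ht
  have hzp : ∀ (t : R) (_ : IsUnit t) (c : ℤ), (t : K) ^ c ∈ R := by
    intro t ht c
    rcases le_total 0 c with hc | hc
    · lift c to ℕ using hc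
      rw [zpow_natCast]; exact R.pow_mem t.2 c
    · obtain ⟨d, rfl⟩ : ∃ d : ℕ, c = -d := ⟨(-c).toNat, by omega⟩
      rw [zpow_neg, zpow_natCast, ← inv_pow]; exact R.pow_mem (hI ht) d
  rw [MulMemClass.coe_mul, mul_zpow] at h
  have h1 : (p : K) ^ (a - b) = (v : K)⁻¹ * w * ((z : R) : K) ^ b := by
    rw [zpow_sub₀ hp0, div_eq_iff (zpow_ne_zero _ hp0), mul_assoc, mul_assoc,
      mul_comm (((z : R) : K) ^ b), ← h, inv_mul_cancel_left₀ (hne hv)]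
  have h2 : (p : K) ^ (b - a) = (w : K)⁻¹ * v * (((z : R) : K) ^ (-b)) := by
    rw [zpow_sub₀ hp0, div_eq_iff (zpow_ne_zero _ hp0), zpow_neg]
    have := zpow_ne_zero b (hne z.isUnit)
    have hw0 := hne hw
    field_simp
    linear_combination (-1) * h
  have ha : 0 ≤ a - b := by
    rw [← zpow_mem_subalgebra_iff p.2 hp0 hinv, h1]
    exact R.mul_mem (R.mul_mem (hI hv) w.2) (hzp _ z.isUnit _)
  have hb : 0 ≤ b - a := by
    rw [← zpow_mem_subalgebra_iff p.2 hp0 hinv, h2]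
    exact R.mul_mem (R.mul_mem (hI hw) v.2) (hzp _ z.isUnit _)
  omega

end IsDVR
end DVR

/-! ### Toric valuation rings -/

section ToricRing
variable {k : Type*} [Field k] {M : Type*} [AddCommGroup M]

/-- The lattice points on which the cocharacter `u` is nonnegative. -/
def halfSpace (u : M →+ ℤ) : AddSubmonoid M where
  carrier := {m | 0 ≤ u m}
  zero_mem' := by simp
  add_mem' := by
    intro a b ha hb
    change 0 ≤ u (a + b)
    rw [map_add]; exact add_nonneg ha hb

variable (k) in
/-- The inclusion `k[S] → k[M]` for a submonoid `S` of `M`. -/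
noncomputable def monoidEmb (S : AddSubmonoid M) :
    AddMonoidAlgebra k S →ₐ[k] AddMonoidAlgebra k M :=
  AddMonoidAlgebra.mapDomainAlgHom k k S.subtype

@[simp] lemma monoidEmb_single (S : AddSubmonoid M) (m : S) (c : k) :
    monoidEmb k S (AddMonoidAlgebra.single m c) = AddMonoidAlgebra.single (m : M) c := by
  simp [monoidEmb]

lemma monoidEmb_injective (S : AddSubmonoid M) : Function.Injective (monoidEmb k S) :=
  AddMonoidAlgebra.mapDomain_injective Subtype.val_injective

lemma coeff_monoidEmb (S : AddSubmonoid M) (f : AddMonoidAlgebra k S) (m : S) :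
    (monoidEmb k S f).coeff m = f.coeff m :=
  Finsupp.mapDomain_apply Subtype.val_injective _ _

lemma exists_monoidEmb_eq (S : AddSubmonoid M) (f : AddMonoidAlgebra k M)
    (hf : ∀ m ∈ f.coeff.support, m ∈ S) : ∃ g, monoidEmb k S g = f := by
  rw [← AddMonoidAlgebra.sum_coeff_single f]
  refine ⟨∑ m ∈ f.coeff.support.attach, AddMonoidAlgebra.single ⟨m, hf m m.2⟩ (f.coeff m), ?_⟩
  rw [map_sum, Finsupp.sum, ← Finset.sum_attach f.coeff.support]
  simp

open Classical in
/-- The initial form of a function `f ∈ k[u ≥ 0]`: the sum of its terms of weight zero. -/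
noncomputable def initialForm (u : M →+ ℤ) :
    AddMonoidAlgebra k (halfSpace u) →ₐ[k] AddMonoidAlgebra k M :=
  AddMonoidAlgebra.lift k _ _
    { toFun := fun m => if u m.toAdd = 0 then AddMonoidAlgebra.single (m.toAdd : M) 1 else 0
      map_one' := by
        rw [if_pos (by change u 0 = 0; simp)]
        rfl
      map_mul' := fun a b => by
        have ha : 0 ≤ u (a.toAdd : M) := a.toAdd.2
        have hb : 0 ≤ u (b.toAdd : M) := b.toAdd.2
        have key : u ((a * b).toAdd : M) = u (a.toAdd : M) + u (b.toAdd : M) := map_add u _ _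
        by_cases h1 : u (a.toAdd : M) = 0
        · by_cases h2 : u (b.toAdd : M) = 0
          · rw [if_pos h1, if_pos h2, if_pos (by rw [key, h1, h2, add_zero]),
              AddMonoidAlgebra.single_mul_single, one_mul]
            rfl
          · rw [if_neg h2, if_neg (by rw [key]; omega), mul_zero]
        · rw [if_neg h1, if_neg (by rw [key]; omega), zero_mul] }

lemma initialForm_single (u : M →+ ℤ) (m : halfSpace u) (c : k) :
    initialForm u (AddMonoidAlgebra.single m c) =
      if u m = 0 then AddMonoidAlgebra.single (m : M) c else 0 := by
  rw [initialForm, AddMonoidAlgebra.lift_single]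
  change c • (if u m = 0 then AddMonoidAlgebra.single (m : M) (1 : k) else 0) = _
  split_ifs <;> simp

lemma coeff_initialForm (u : M →+ ℤ) (f : AddMonoidAlgebra k (halfSpace u)) (m : M) :
    (initialForm u f).coeff m = if u m = 0 then (monoidEmb k _ f).coeff m else 0 := by
  classical
  induction f using AddMonoidAlgebra.induction_linear with
  | zero => simp
  | add f g hf hg =>
    rw [map_add, map_add, AddMonoidAlgebra.coeff_add, AddMonoidAlgebra.coeff_add,
      Finsupp.add_apply, Finsupp.add_apply, hf, hg]
    split_ifs <;> simp
  | single a c =>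
    rw [initialForm_single, monoidEmb_single]
    by_cases h : (a : M) = m
    · subst h
      split_ifs <;> simp
    · split_ifs <;> simp [h]

lemma initialForm_ne_zero_iff (u : M →+ ℤ) (f : AddMonoidAlgebra k (halfSpace u)) :
    initialForm u f ≠ 0 ↔ ∃ m, u m = 0 ∧ (monoidEmb k _ f).coeff m ≠ 0 := by
  rw [Ne, ← AddMonoidAlgebra.coeff_eq_zero, ← Ne, Finsupp.ne_iff]
  refine exists_congr fun m => ?_
  rw [coeff_initialForm]
  simp

/-- Every nonzero Laurent polynomial is a monomial `χ^{c m₀}` times an element of `k[u ≥ 0]` with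
nonzero initial form. -/
lemma exists_eq_single_mul (u : M →+ ℤ) {m₀ : M} (h₀ : u m₀ = 1) (f : AddMonoidAlgebra k M)
    (hf : f ≠ 0) : ∃ (c : ℤ) (g : AddMonoidAlgebra k (halfSpace u)), initialForm u g ≠ 0 ∧
      f = AddMonoidAlgebra.single (c • m₀) 1 * monoidEmb k _ g := by
  have hne : f.coeff.support.Nonempty := by
    rw [Finsupp.support_nonempty_iff]
    exact fun h => hf (AddMonoidAlgebra.coeff_eq_zero.1 h)
  obtain ⟨m₁, hm₁, hmin⟩ := f.coeff.support.exists_min_image u hne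
  let f' : AddMonoidAlgebra k M := AddMonoidAlgebra.single (-(u m₁ • m₀)) 1 * f
  have hcoeff : ∀ m, f'.coeff m = f.coeff (u m₁ • m₀ + m) := fun m => by
    simp [f', AddMonoidAlgebra.coeff_single_mul_apply]
  obtain ⟨g, hg⟩ := exists_monoidEmb_eq (halfSpace u) f' (fun m hm => by
    rw [Finsupp.mem_support_iff, hcoeff, ← Finsupp.mem_support_iff] at hm
    have := hmin _ hm
    rw [map_add, map_zsmul, h₀, smul_eq_mul, mul_one] at this
    change 0 ≤ u m
    omega)
  refine ⟨u m₁, g, (initialForm_ne_zero_iff u g).2 ⟨m₁ - u m₁ • m₀, ?_, ?_⟩, ?_⟩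
  · rw [map_sub, map_zsmul, h₀, smul_eq_mul, mul_one, sub_self]
  · rw [hg, hcoeff, add_sub_cancel]
    exact Finsupp.mem_support_iff.1 hm₁
  · rw [hg, ← mul_assoc, AddMonoidAlgebra.single_mul_single]
    simp [← AddMonoidAlgebra.one_def]

variable {K : Type*} [Field K] [Algebra k K] (Φ : AddMonoidAlgebra k M →ₐ[k] K)

/-- The valuation ring of the toric valuation of `K = Frac k[M]` given by the cocharacter `u`: the
fractions of elements of `k[u ≥ 0]` whose denominator has nonzero initial form. -/
noncomputable def toricRing (u : M →+ ℤ) : Subalgebra k K :=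
  fracSubalgebra (Φ.comp (monoidEmb k (halfSpace u)))
    ((nonZeroDivisors (AddMonoidAlgebra k M)).comap (initialForm (k := k) u))

variable {Φ} (hΦ : IsFractionMap Φ) (u : M →+ ℤ)
include hΦ

lemma IsFractionMap.isDomain : IsDomain (AddMonoidAlgebra k M) :=
  hΦ.injective.isDomain Φ.toRingHom

lemma mem_toricRing_iff {x : K} : x ∈ toricRing Φ u ↔ ∃ a b : AddMonoidAlgebra k (halfSpace u),
    initialForm u b ≠ 0 ∧ x * Φ (monoidEmb k _ b) = Φ (monoidEmb k _ a) := by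
  have := hΦ.isDomain
  rw [toricRing, mem_fracSubalgebra]
  simp only [Submonoid.mem_comap, mem_nonZeroDivisors_iff_ne_zero]
  rfl

omit hΦ in
lemma single_mem_toricRing (Φ : AddMonoidAlgebra k M →ₐ[k] K) {m : M} (hm : 0 ≤ u m) (c : k) :
    Φ (AddMonoidAlgebra.single m c) ∈ toricRing Φ u := by
  have := map_mem_fracSubalgebra (Φ.comp (monoidEmb k (halfSpace u)))
    ((nonZeroDivisors (AddMonoidAlgebra k M)).comap (initialForm (k := k) u))
    (AddMonoidAlgebra.single ⟨m, hm⟩ c)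
  simpa [toricRing] using this

omit hΦ in
lemma map_single_mul_neg (Φ : AddMonoidAlgebra k M →ₐ[k] K) (m : M) :
    Φ (AddMonoidAlgebra.single m 1) * Φ (AddMonoidAlgebra.single (-m) 1) = 1 := by
  rw [← map_mul, AddMonoidAlgebra.single_mul_single, add_neg_cancel, one_mul,
    ← AddMonoidAlgebra.one_def, map_one]

omit hΦ in
lemma map_single_ne_zero (Φ : AddMonoidAlgebra k M →ₐ[k] K) (m : M) :
    Φ (AddMonoidAlgebra.single m 1) ≠ 0 :=
  left_ne_zero_of_mul_eq_one (map_single_mul_neg Φ m)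

omit hΦ in
lemma map_single_neg (Φ : AddMonoidAlgebra k M →ₐ[k] K) (m : M) :
    Φ (AddMonoidAlgebra.single (-m) 1) = (Φ (AddMonoidAlgebra.single m 1))⁻¹ :=
  eq_inv_of_mul_eq_one_right (map_single_mul_neg Φ m)

omit hΦ in
lemma map_single_zsmul (Φ : AddMonoidAlgebra k M →ₐ[k] K) (m : M) (c : ℤ) :
    Φ (AddMonoidAlgebra.single (c • m) 1) = Φ (AddMonoidAlgebra.single m 1) ^ c := by
  rcases Int.eq_nat_or_neg c with ⟨d, rfl | rfl⟩
  · rw [zpow_natCast, ← map_pow, AddMonoidAlgebra.single_pow, one_pow, natCast_zsmul]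
  · rw [neg_smul, map_single_neg, zpow_neg, zpow_natCast, ← map_pow, AddMonoidAlgebra.single_pow,
      one_pow, natCast_zsmul]

lemma map_emb_ne_zero {u : M →+ ℤ} {b : AddMonoidAlgebra k (halfSpace u)}
    (hb : initialForm u b ≠ 0) : Φ (monoidEmb k _ b) ≠ 0 := by
  intro h
  rw [map_eq_zero_iff _ hΦ.injective, map_eq_zero_iff _ (monoidEmb_injective _)] at h
  exact hb (by rw [h, map_zero])

/-- A monomial of negative weight is not regular along the toric valuation. -/
lemma single_not_mem_toricRing {m : M} (hm : u m < 0) :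
    Φ (AddMonoidAlgebra.single m 1) ∉ toricRing Φ u := by
  have := hΦ.isDomain
  rw [mem_toricRing_iff hΦ]
  rintro ⟨a, b, hb, h⟩
  rw [← map_mul] at h
  have h := hΦ.injective h
  have hm' : -m ∈ halfSpace u := by change 0 ≤ u (-m); rw [map_neg]; omega
  have h2 : b = AddMonoidAlgebra.single ⟨-m, hm'⟩ 1 * a := by
    apply monoidEmb_injective
    rw [map_mul, ← h, ← mul_assoc, monoidEmb_single, AddMonoidAlgebra.single_mul_single]
    simp [← AddMonoidAlgebra.one_def]
  apply hb
  rw [h2, map_mul, initialForm_single, if_neg (by change u (-m) ≠ 0; rw [map_neg]; omega), zero_mul]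

/-- The factorization which makes `toricRing Φ u` a discrete valuation ring: any monomial `χ^{m₀}`
of weight `1` is a uniformizer. -/
lemma exists_unit_mul_zpow_toricRing {m₀ : M} (h₀ : u m₀ = 1) (x : K) (hx : x ≠ 0) :
    ∃ v : K, ∃ c : ℤ, v ∈ toricRing Φ u ∧ v⁻¹ ∈ toricRing Φ u ∧
      x = v * Φ (AddMonoidAlgebra.single m₀ 1) ^ c := by
  obtain ⟨a, b, hb, h⟩ := hΦ.exists_frac x
  have hb0 : Φ b ≠ 0 := fun h0 => hb (hΦ.injective (by rw [h0, map_zero]))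
  have ha : a ≠ 0 := by
    rintro rfl
    rw [map_zero] at h
    exact (mul_ne_zero hx hb0) h
  obtain ⟨c, g, hg, rfl⟩ := exists_eq_single_mul u h₀ a ha
  obtain ⟨d, g', hg', rfl⟩ := exists_eq_single_mul u h₀ b hb
  have h1 := map_emb_ne_zero hΦ hg
  have h2 := map_emb_ne_zero hΦ hg'
  have hπ := map_single_ne_zero Φ m₀
  refine ⟨Φ (monoidEmb k _ g) / Φ (monoidEmb k _ g'), c - d, ?_, ?_, ?_⟩
  · exact (mem_toricRing_iff hΦ u).2 ⟨g, g', hg', div_mul_cancel₀ _ h2⟩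
  · exact (mem_toricRing_iff hΦ u).2 ⟨g', g, hg, by rw [inv_div, div_mul_cancel₀ _ h1]⟩
  · rw [map_mul, map_mul, map_single_zsmul, map_single_zsmul] at h
    rw [zpow_sub₀ hπ]
    have := zpow_ne_zero d hπ
    field_simp
    linear_combination h

variable {u} {m₀ : M} (h₀ : u m₀ = 1)
include h₀

omit hΦ in
lemma uniformizer_mem : Φ (AddMonoidAlgebra.single m₀ 1) ∈ toricRing Φ u :=
  single_mem_toricRing u Φ (by omega) 1

lemma uniformizer_inv_not_mem : (Φ (AddMonoidAlgebra.single m₀ 1))⁻¹ ∉ toricRing Φ u := by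
  rw [← map_single_neg]
  exact single_not_mem_toricRing hΦ u (by rw [map_neg]; omega)

lemma isDiscreteValuationRing_toricRing : IsDiscreteValuationRing (toricRing Φ u) :=
  isDiscreteValuationRing_of_uniformizer (uniformizer_mem h₀) (map_single_ne_zero Φ m₀)
    (uniformizer_inv_not_mem hΦ h₀) (exists_unit_mul_zpow_toricRing hΦ u h₀)

lemma isFractionRing_toricRing : IsFractionRing (toricRing Φ u) K :=
  isFractionRing_of_uniformizer (uniformizer_mem h₀) (map_single_ne_zero Φ m₀)
    (exists_unit_mul_zpow_toricRing hΦ u h₀)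

lemma irreducible_toricRing :
    Irreducible (⟨_, uniformizer_mem (Φ := Φ) h₀⟩ : toricRing Φ u) :=
  irreducible_of_uniformizer (uniformizer_mem h₀) (map_single_ne_zero Φ m₀)
    (uniformizer_inv_not_mem hΦ h₀) (exists_unit_mul_zpow_toricRing hΦ u h₀)

omit h₀ in
lemma toricRing_ne_top {m : M} (hm : 0 < u m) : toricRing Φ u ≠ ⊤ := fun h =>
  single_not_mem_toricRing hΦ u (m := -m) (by rw [map_neg]; omega) (h ▸ Algebra.mem_top)

/-- The order of a monomial along the toric valuation given by `u` is its weight. -/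
lemma hasOrd_toricRing (m : M) (c : k) (hc : c ≠ 0) :
    HasOrd (toricRing Φ u) (Φ (AddMonoidAlgebra.single m c)) (u m) := by
  have hu : u (m - u m • m₀) = 0 := by
    rw [map_sub, map_zsmul, h₀, smul_eq_mul, mul_one, sub_self]
  refine ⟨⟨_, uniformizer_mem h₀⟩,
    ⟨Φ (AddMonoidAlgebra.single (m - u m • m₀) c), single_mem_toricRing u Φ hu.ge c⟩,
    irreducible_toricRing hΦ h₀, ?_, ?_⟩
  · refine IsUnit.of_mul_eq_one ⟨Φ (AddMonoidAlgebra.single (-(m - u m • m₀)) c⁻¹),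
      single_mem_toricRing u Φ (by rw [map_neg]; omega) _⟩ (Subtype.ext ?_)
    change Φ _ * Φ _ = 1
    rw [← map_mul, AddMonoidAlgebra.single_mul_single, add_neg_cancel, mul_inv_cancel₀ hc,
      ← AddMonoidAlgebra.one_def, map_one]
  · change _ = Φ _ * Φ _ ^ (u m)
    rw [← map_single_zsmul, ← map_mul, AddMonoidAlgebra.single_mul_single, sub_add_cancel, mul_one]

end ToricRing

/-! ### Logarithmic differential forms -/

section Forms
variable {k : Type*} [Field k] {M : Type*} [AddCommGroup M]
  {K : Type*} [Field K] [Algebra k K] (Φ : AddMonoidAlgebra k M →ₐ[k] K)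

/-- The logarithmic differential `dχ^m / χ^m`. -/
noncomputable def dlog (m : M) : Ω[K⁄k] :=
  (Φ (AddMonoidAlgebra.single m 1))⁻¹ • KaehlerDifferential.D k K (Φ (AddMonoidAlgebra.single m 1))

lemma D_single (m : M) (c : k) : KaehlerDifferential.D k K (Φ (AddMonoidAlgebra.single m c)) =
    Φ (AddMonoidAlgebra.single m c) • dlog Φ m := by
  have h : Φ (AddMonoidAlgebra.single m c) = c • Φ (AddMonoidAlgebra.single m 1) := by
    rw [← map_smul]; simp
  rw [h, Derivation.map_smul, dlog, smul_assoc, smul_smul,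
    mul_inv_cancel₀ (map_single_ne_zero Φ m), one_smul]

lemma dlog_add (a b : M) : dlog Φ (a + b) = dlog Φ a + dlog Φ b := by
  have h : Φ (AddMonoidAlgebra.single (a + b) 1) =
      Φ (AddMonoidAlgebra.single a 1) * Φ (AddMonoidAlgebra.single b 1) := by
    rw [← map_mul, AddMonoidAlgebra.single_mul_single, one_mul]
  have ha := map_single_ne_zero Φ a
  have hb := map_single_ne_zero Φ b
  rw [dlog, h, Derivation.leibniz, dlog, dlog, smul_add, smul_smul, smul_smul, mul_inv, add_comm]
  congr 2
  · field_simp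
  · field_simp

/-- `dlog` as a homomorphism. -/
noncomputable def dlogHom : M →+ Ω[K⁄k] := AddMonoidHom.mk' (dlog Φ) (dlog_add Φ)

lemma dlog_eq_sum {ι : Type*} [Fintype ι] (b : Module.Basis ι ℤ M) (m : M) :
    dlog Φ m = ∑ j, ((b.repr m j : ℤ) : K) • dlog Φ (b j) := by
  change dlogHom Φ m = _
  conv_lhs => rw [← b.sum_repr m]
  rw [map_sum]
  refine Finset.sum_congr rfl fun j _ => ?_
  rw [map_zsmul, Int.cast_smul_eq_zsmul]
  rfl

/-- The differential of a function of `k[S]`, in terms of logarithmic forms of a basis of `M`. -/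
lemma exists_D_eq_sum {ι : Type*} [Fintype ι] (b : Module.Basis ι ℤ M) (S : AddSubmonoid M)
    (f : AddMonoidAlgebra k S) : ∃ g : ι → AddMonoidAlgebra k S,
      (∀ j m, (g j).coeff m = ((b.repr (m : M) j : ℤ) : k) * f.coeff m) ∧
      KaehlerDifferential.D k K (Φ (monoidEmb k S f)) =
        ∑ j, Φ (monoidEmb k S (g j)) • dlog Φ (b j) := by
  classical
  induction f using AddMonoidAlgebra.induction_linear with
  | zero => exact ⟨0, by simp, by simp⟩
  | add f f' hf hf' =>
    obtain ⟨g, h1, h2⟩ := hf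
    obtain ⟨g', h1', h2'⟩ := hf'
    refine ⟨g + g', fun j m => ?_, ?_⟩
    · rw [Pi.add_apply, AddMonoidAlgebra.coeff_add, AddMonoidAlgebra.coeff_add, Finsupp.add_apply,
        Finsupp.add_apply, h1, h1', mul_add]
    · simp only [map_add, h2, h2', Pi.add_apply, add_smul, Finset.sum_add_distrib]
  | single a c =>
    refine ⟨fun j => AddMonoidAlgebra.single a (((b.repr (a : M) j : ℤ) : k) * c),
      fun j m => ?_, ?_⟩
    · by_cases h : a = m
      · subst h; simp
      · simp [h]
    · rw [monoidEmb_single, D_single, dlog_eq_sum Φ b, Finset.smul_sum]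
      refine Finset.sum_congr rfl fun j _ => ?_
      have h : AddMonoidAlgebra.single (a : M) (((b.repr (a : M) j : ℤ) : k) * c) =
          ((b.repr (a : M) j : ℤ) : k) • AddMonoidAlgebra.single (a : M) c := by simp
      rw [smul_smul, monoidEmb_single, h, map_smul, Algebra.smul_def, map_intCast, mul_comm]

/-- The differential of a fraction. -/
lemma D_of_mul_eq {x s a : K} (hs : s ≠ 0) (h : x * s = a) :
    KaehlerDifferential.D k K x =
      s⁻¹ • (KaehlerDifferential.D k K a - x • KaehlerDifferential.D k K s) := by
  rw [← h, Derivation.leibniz, add_sub_cancel_left, smul_smul, inv_mul_cancel₀ hs, one_smul]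

end Forms

section Wedge
variable {K V : Type*} [Field K] [AddCommGroup V] [Module K V] {n : ℕ}

/-- A wedge of `R`-linear combinations of the `θ j` is an `R`-multiple of the wedge of the `θ j`. -/
lemma ιMulti_mem_span {k : Type*} [Field k] [Algebra k K] (R : Subalgebra k K) (θ x : Fin n → V)
    (hx : ∀ i, ∃ ρ : Fin n → K, (∀ j, ρ j ∈ R) ∧ x i = ∑ j, ρ j • θ j) :
    exteriorPower.ιMulti K n x ∈ Submodule.span R {exteriorPower.ιMulti K n θ} := by
  classical
  choose ρ hρ hx using hx
  rw [funext hx]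
  change (exteriorPower.ιMulti K n (M := V)).toMultilinearMap (fun i => ∑ j, ρ i j • θ j) ∈ _
  rw [MultilinearMap.map_sum]
  refine Submodule.sum_mem _ fun σ _ => ?_
  rw [MultilinearMap.map_smul_univ (exteriorPower.ιMulti K n (M := V)).toMultilinearMap
    (fun i => ρ i (σ i)) (fun i => θ (σ i))]
  have hprod : ∏ i, ρ i (σ i) ∈ R := R.prod_mem fun i _ => hρ i _
  refine Submodule.smul_mem _ (⟨_, hprod⟩ : R) ?_
  change exteriorPower.ιMulti K n (fun i => θ (σ i)) ∈ _
  by_cases hσ : Function.Injective σ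
  · let e : Equiv.Perm (Fin n) := Equiv.ofBijective σ (Finite.injective_iff_bijective.1 hσ)
    have := (exteriorPower.ιMulti K n (M := V)).map_perm θ e
    change exteriorPower.ιMulti K n (fun i => θ (σ i)) = _ at this
    rw [this]
    rcases Int.units_eq_one_or (Equiv.Perm.sign e) with h | h
    · rw [h, one_smul]; exact Submodule.mem_span_singleton_self _
    · rw [h, Units.neg_smul, one_smul]
      exact Submodule.neg_mem _ (Submodule.mem_span_singleton_self _)
  · rw [Function.Injective] at hσ
    push Not at hσ
    obtain ⟨i, j, hij, hne⟩ := hσ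
    rw [(exteriorPower.ιMulti K n (M := V)).map_eq_zero_of_eq (fun i => θ (σ i))
      (by rw [hij]) hne]
    exact Submodule.zero_mem _

end Wedge

section LogForm
variable {k : Type*} [Field k] {M : Type*} [AddCommGroup M]
  {K : Type*} [Field K] [Algebra k K] {Φ : AddMonoidAlgebra k M →ₐ[k] K} {n : ℕ}

variable (Φ) in
/-- The form `dlog χ^{b₁} ∧ … ∧ dlog χ^{bₙ}` for a basis `b` of `M`. Up to sign, it does not depend
on the basis. -/
noncomputable def logForm (b : Module.Basis (Fin n) ℤ M) : ⋀[K]^n (Ω[K⁄k]) :=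
  exteriorPower.ιMulti K n fun j => dlog Φ (b j)

lemma logForm_mem_span (R : Subalgebra k K) (b b' : Module.Basis (Fin n) ℤ M) :
    logForm Φ b ∈ Submodule.span R {logForm Φ b'} :=
  ιMulti_mem_span R _ _ fun i => ⟨fun j => ((b'.repr (b i) j : ℤ) : K),
    fun _ => intCast_mem _ _, dlog_eq_sum Φ b' _⟩

lemma ιMulti_D_mem_formLattice {R : Subalgebra k K} (x : Fin n → K) (hx : ∀ i, x i ∈ R) :
    exteriorPower.ιMulti K n (fun i => KaehlerDifferential.D k K (x i)) ∈ formLattice n R :=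
  Submodule.subset_span ⟨fun i => ⟨x i, hx i⟩, rfl⟩

/-- Suppose that the monomials of the basis `b` lie in `R`, those with index off `T` being units,
and that the differentials of elements of `R` are `R`-linear combinations of the `dlog χ^{bᵢ}` in
which the coefficient at `i ∈ T` is divisible by `χ^{bᵢ}`. Then the regular forms are the multiples
of `∏_{i ∈ T} χ^{bᵢ} · dlog χ^{b₁} ∧ … ∧ dlog χ^{bₙ}`. -/
lemma formLattice_eq_span {R : Subalgebra k K} (b : Module.Basis (Fin n) ℤ M) (T : Finset (Fin n))
    (hb : ∀ i, Φ (AddMonoidAlgebra.single (b i) 1) ∈ R)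
    (hbinv : ∀ i ∉ T, Φ (AddMonoidAlgebra.single (-b i) 1) ∈ R)
    (hD : ∀ x ∈ R, ∃ ρ : Fin n → K, (∀ j, ρ j ∈ R) ∧
      (∀ j ∈ T, Φ (AddMonoidAlgebra.single (-b j) 1) * ρ j ∈ R) ∧
      KaehlerDifferential.D k K x = ∑ j, ρ j • dlog Φ (b j)) :
    formLattice n R = Submodule.span R
      {(∏ i ∈ T, Φ (AddMonoidAlgebra.single (b i) 1)) • logForm Φ b} := by
  classical
  have key : (∏ i ∈ T, Φ (AddMonoidAlgebra.single (b i) 1)) • logForm Φ b =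
      exteriorPower.ιMulti K n fun j =>
        (if j ∈ T then Φ (AddMonoidAlgebra.single (b j) 1) else 1) • dlog Φ (b j) := by
    rw [AlternatingMap.map_smul_univ, Finset.prod_ite_mem, Finset.univ_inter]
    rfl
  rw [key]
  apply le_antisymm
  · rw [formLattice, Submodule.span_le]
    rintro _ ⟨r, rfl⟩
    refine ιMulti_mem_span R _ _ fun i => ?_
    obtain ⟨ρ, h1, h2, h3⟩ := hD (r i) (r i).2
    refine ⟨fun j => if j ∈ T then Φ (AddMonoidAlgebra.single (-b j) 1) * ρ j else ρ j,
      fun j => ?_, ?_⟩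
    · by_cases hj : j ∈ T
      · simpa only [if_pos hj] using h2 j hj
      · simpa only [if_neg hj] using h1 j
    · rw [h3]
      refine Finset.sum_congr rfl fun j _ => ?_
      by_cases hj : j ∈ T
      · simp only [if_pos hj]
        rw [smul_smul, mul_right_comm, mul_comm (Φ (AddMonoidAlgebra.single (-b j) 1)),
          map_single_mul_neg, one_mul]
      · simp only [if_neg hj, one_smul]
  · rw [Submodule.span_singleton_le_iff_mem]
    have h : (fun j => (if j ∈ T then Φ (AddMonoidAlgebra.single (b j) 1) else 1) • dlog Φ (b j)) =
        fun j => (if j ∈ T then 1 else Φ (AddMonoidAlgebra.single (-b j) 1)) •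
          KaehlerDifferential.D k K (Φ (AddMonoidAlgebra.single (b j) 1)) := by
      funext j
      rw [D_single]
      split_ifs
      · rw [one_smul]
      · rw [one_smul, smul_smul, mul_comm, map_single_mul_neg, one_smul]
    rw [h, AlternatingMap.map_smul_univ]
    have hprod : ∏ j, (if j ∈ T then (1 : K) else Φ (AddMonoidAlgebra.single (-b j) 1)) ∈ R := by
      refine R.prod_mem fun j _ => ?_
      split_ifs with hj
      · exact R.one_mem
      · exact hbinv j hj
    exact Submodule.smul_mem _ (⟨_, hprod⟩ : R) (ιMulti_D_mem_formLattice _ hb)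

lemma span_smul_logForm (R : Subalgebra k K) (b b' : Module.Basis (Fin n) ℤ M) (c : K) :
    Submodule.span R {c • logForm Φ b} = Submodule.span R {c • logForm Φ b'} := by
  have : ∀ b b' : Module.Basis (Fin n) ℤ M,
      Submodule.span R {c • logForm Φ b} ≤ Submodule.span R {c • logForm Φ b'} := by
    intro b b'
    rw [Submodule.span_singleton_le_iff_mem]
    obtain ⟨r, hr⟩ := Submodule.mem_span_singleton.1 (logForm_mem_span (Φ := Φ) R b b')
    refine Submodule.mem_span_singleton.2 ⟨r, ?_⟩
    rw [← hr, smul_comm]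
  exact le_antisymm (this b b') (this b' b)

/-- The logarithmic form has no zeros or poles on the torus: it has order `0` along each discrete
valuation ring that is a localization of the ring of Laurent polynomials. -/
lemma hasFormOrd_logForm_zero (hΦ : IsFractionMap Φ) {R : Subalgebra k K}
    [IsDiscreteValuationRing R] (b : Module.Basis (Fin n) ℤ M) (hR : ∀ f, Φ f ∈ R)
    (hfrac : ∀ x ∈ R, ∃ f g : AddMonoidAlgebra k M, g ≠ 0 ∧ (Φ g)⁻¹ ∈ R ∧ x * Φ g = Φ f) :
    HasFormOrd R (logForm Φ b) 0 := by
  obtain ⟨p, hp⟩ := IsDiscreteValuationRing.exists_irreducible R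
  refine ⟨p, hp, ?_⟩
  rw [formLattice_eq_span (Φ := Φ) b ∅ (fun _ => hR _) (fun _ _ => hR _) (fun x hx => ?_)]
  · simp
  · obtain ⟨f, g, hg, hgi, h⟩ := hfrac x hx
    have hg0 : Φ g ≠ 0 := fun h0 => hg (hΦ.injective (by rw [h0, map_zero]))
    obtain ⟨f', rfl⟩ := exists_monoidEmb_eq ⊤ f (fun _ _ => trivial)
    obtain ⟨g', rfl⟩ := exists_monoidEmb_eq ⊤ g (fun _ _ => trivial)
    obtain ⟨ρ, -, hρ⟩ := exists_D_eq_sum Φ b ⊤ f'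
    obtain ⟨τ, -, hτ⟩ := exists_D_eq_sum Φ b ⊤ g'
    refine ⟨fun j => (Φ (monoidEmb k ⊤ g'))⁻¹ *
      (Φ (monoidEmb k ⊤ (ρ j)) - x * Φ (monoidEmb k ⊤ (τ j))), fun j => ?_, by simp, ?_⟩
    · exact R.mul_mem hgi (R.sub_mem (hR _) (R.mul_mem hx (hR _)))
    · rw [D_of_mul_eq hg0 h, hρ, hτ, Finset.smul_sum, ← Finset.sum_sub_distrib, Finset.smul_sum]
      refine Finset.sum_congr rfl fun j _ => ?_
      rw [mul_smul, sub_smul, mul_smul]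

/-- The logarithmic form has a simple pole along each toric valuation. -/
lemma hasFormOrd_logForm_toricRing (hΦ : IsFractionMap Φ) {u : M →+ ℤ}
    (b b' : Module.Basis (Fin n) ℤ M)
    (i₀ : Fin n) (hi₀ : u (b i₀) = 1) (hi : ∀ i, i ≠ i₀ → u (b i) = 0) :
    HasFormOrd (toricRing Φ u) (logForm Φ b') (-1) := by
  classical
  have hu : ∀ m, u m = b.repr m i₀ := by
    intro m
    conv_lhs => rw [← b.sum_repr m]
    rw [map_sum, Finset.sum_eq_single i₀ (fun i _ h => by rw [map_zsmul, hi i h, smul_zero])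
      (fun h => absurd (Finset.mem_univ _) h), map_zsmul, hi₀, smul_eq_mul, mul_one]
  have hub : ∀ i, 0 ≤ u (b i) := fun i => by
    by_cases h : i = i₀
    · rw [h, hi₀]; norm_num
    · rw [hi i h]
  refine ⟨⟨_, uniformizer_mem hi₀⟩, irreducible_toricRing hΦ hi₀, ?_⟩
  rw [formLattice_eq_span (Φ := Φ) b {i₀} (fun i => single_mem_toricRing u Φ (hub i) 1)
    (fun i h => single_mem_toricRing u Φ (by rw [map_neg, hi i (by simpa using h), neg_zero]) 1)
    (fun x hx => ?_)]
  · rw [Finset.prod_singleton, neg_neg, zpow_one]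
    exact span_smul_logForm _ _ _ _
  · obtain ⟨f, g, hg, h⟩ := (mem_toricRing_iff hΦ u).1 hx
    have hg0 := map_emb_ne_zero hΦ hg
    have hgi : (Φ (monoidEmb k _ g))⁻¹ ∈ toricRing Φ u :=
      (mem_toricRing_iff hΦ u).2 ⟨1, g, hg, by rw [inv_mul_cancel₀ hg0, map_one, map_one]⟩
    have hR : ∀ f : AddMonoidAlgebra k (halfSpace u), Φ (monoidEmb k _ f) ∈ toricRing Φ u :=
      map_mem_fracSubalgebra (Φ.comp (monoidEmb k (halfSpace u))) _
    obtain ⟨ρ, hρ1, hρ⟩ := exists_D_eq_sum Φ b _ f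
    obtain ⟨τ, hτ1, hτ⟩ := exists_D_eq_sum Φ b _ g
    -- the coefficients along `i₀` have no terms of weight zero, so they are divisible by `χ^{b i₀}`
    have hdiv : ∀ f g : AddMonoidAlgebra k (halfSpace u),
        (∀ m, g.coeff m = ((b.repr (m : M) i₀ : ℤ) : k) * f.coeff m) →
        Φ (AddMonoidAlgebra.single (-b i₀) 1) * Φ (monoidEmb k _ g) ∈ toricRing Φ u := by
      intro f g hfg
      obtain ⟨g', hg'⟩ := exists_monoidEmb_eq (halfSpace u)
        (AddMonoidAlgebra.single (-b i₀) 1 * monoidEmb k _ g) (fun m hm => by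
          rw [Finsupp.mem_support_iff, AddMonoidAlgebra.coeff_single_mul_apply, one_mul,
            neg_neg] at hm
          by_contra hneg
          have hneg' : u m < 0 := not_le.1 hneg
          apply hm
          by_cases h0 : b i₀ + m ∈ halfSpace u
          · have : u (b i₀ + m) = 0 := by
              have : 0 ≤ u (b i₀ + m) := h0
              rw [map_add, hi₀] at this ⊢
              omega
            rw [coeff_monoidEmb _ g ⟨_, h0⟩, hfg]
            change ((b.repr (b i₀ + m) i₀ : ℤ) : k) * _ = 0
            rw [← hu, this]; simp
          · refine Finsupp.mapDomain_of_notMem_range _ _ ?_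
            rintro ⟨a, ha⟩
            exact h0 (ha ▸ a.2))
      rw [← map_mul, ← hg']
      exact hR g'
    refine ⟨fun j => (Φ (monoidEmb k _ g))⁻¹ *
      (Φ (monoidEmb k _ (ρ j)) - x * Φ (monoidEmb k _ (τ j))), fun j => ?_, fun j hj => ?_, ?_⟩
    · exact Subalgebra.mul_mem _ hgi (Subalgebra.sub_mem _ (hR _) (Subalgebra.mul_mem _ hx (hR _)))
    · obtain rfl : j = i₀ := by simpa using hj
      have h1 := hdiv f (ρ j) (hρ1 j)
      have h2 := hdiv g (τ j) (hτ1 j)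
      have := Subalgebra.mul_mem _ hgi (Subalgebra.sub_mem _ h1 (Subalgebra.mul_mem _ hx h2))
      convert this using 1
      ring
    · rw [D_of_mul_eq hg0 h, hρ, hτ, Finset.smul_sum, ← Finset.sum_sub_distrib, Finset.smul_sum]
      refine Finset.sum_congr rfl fun j _ => ?_
      rw [mul_smul, sub_smul, mul_smul]

/-- A homomorphism `M → ℤ` extends to a linear functional on `Ω`, with `dlog χ^m ↦ w m`. -/
lemma exists_functional_dlog (hΦ : IsFractionMap Φ) (w : M →+ ℤ) :
    ∃ ψ : Ω[K⁄k] →ₗ[K] K, ∀ m, ψ (dlog Φ m) = ((w m : ℤ) : K) := by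
  classical
  let _ : Algebra (AddMonoidAlgebra k M) K := Φ.toRingHom.toAlgebra
  have hal : ∀ f, algebraMap (AddMonoidAlgebra k M) K f = Φ f := fun _ => rfl
  have : IsScalarTower k (AddMonoidAlgebra k M) K :=
    IsScalarTower.of_algebraMap_eq fun c => (Φ.commutes c).symm
  have hdom := hΦ.isDomain
  have : IsFractionRing (AddMonoidAlgebra k M) K := by
    refine ⟨fun y => ?_, fun x => ?_, fun {x y} h => ⟨1, by rw [hΦ.injective h]⟩⟩
    · exact isUnit_iff_ne_zero.2 fun h => nonZeroDivisors.ne_zero y.2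
        (hΦ.injective (by rw [← hal, h, map_zero]))
    · obtain ⟨a, b, hb, h⟩ := hΦ.exists_frac x
      exact ⟨⟨a, b, mem_nonZeroDivisors_of_ne_zero hb⟩, h⟩
  have := Algebra.FormallyEtale.of_isLocalization (Rₘ := K)
    (nonZeroDivisors (AddMonoidAlgebra k M))
  let L : AddMonoidAlgebra k M →ₗ[k] K := Φ.toLinearMap ∘ₗ
    (Finsupp.lsum k (fun m => ((w m : ℤ) : k) • AddMonoidAlgebra.lsingle m) :
      (M →₀ k) →ₗ[k] AddMonoidAlgebra k M) ∘ₗ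
      (AddMonoidAlgebra.coeffLinearEquiv k).toLinearMap
  have hL : ∀ m c, L (AddMonoidAlgebra.single m c) =
      ((w m : ℤ) : K) * Φ (AddMonoidAlgebra.single m c) := by
    intro m c
    have : L (AddMonoidAlgebra.single m c) =
        Φ (Finsupp.lsum k (fun m => ((w m : ℤ) : k) • AddMonoidAlgebra.lsingle m)
          (Finsupp.single m c)) := rfl
    rw [this, Finsupp.lsum_single, LinearMap.smul_apply, map_smul, Algebra.smul_def, map_intCast]
    rfl
  let d : Derivation k (AddMonoidAlgebra k M) K := Derivation.mk' L (by
    intro f g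
    induction f using AddMonoidAlgebra.induction_linear with
    | zero => simp
    | add f f' hf hf' => rw [add_mul, map_add, hf, hf', map_add, add_smul, smul_add]; abel
    | single a c =>
      induction g using AddMonoidAlgebra.induction_linear with
      | zero => simp
      | add f f' hf hf' => rw [mul_add, map_add, hf, hf', map_add, add_smul, smul_add]; abel
      | single a' c' =>
        rw [AddMonoidAlgebra.single_mul_single, hL, hL, hL, ← AddMonoidAlgebra.single_mul_single,
          map_add, map_mul, Algebra.smul_def, Algebra.smul_def, hal, hal]
        push_cast
        ring)
  refine ⟨(LinearMap.liftBaseChange K d.liftKaehlerDifferential) ∘ₗ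
    (KaehlerDifferential.tensorKaehlerEquivOfFormallyEtale k
      (AddMonoidAlgebra k M) K).symm.toLinearMap,
    fun m => ?_⟩
  rw [dlog, map_smul, ← hal, LinearMap.comp_apply, LinearEquiv.coe_coe,
    KaehlerDifferential.tensorKaehlerEquivOfFormallyEtale_symm_D_algebraMap,
    LinearMap.liftBaseChange_tmul, Derivation.liftKaehlerDifferential_comp_D, one_smul]
  change _ • L _ = _
  rw [hL, hal, smul_eq_mul, mul_left_comm, inv_mul_cancel₀ (map_single_ne_zero Φ m), mul_one]

lemma logForm_ne_zero (hΦ : IsFractionMap Φ) (b : Module.Basis (Fin n) ℤ M) : logForm Φ b ≠ 0 := by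
  classical
  choose ψ hψ using fun j => exists_functional_dlog hΦ (b.coord j).toAddMonoidHom
  intro h
  have h1 := congrArg (exteriorPower.alternatingMapLinearEquiv
    ((Pi.basisFun K (Fin n)).det.compLinearMap (LinearMap.pi ψ))) h
  rw [logForm, exteriorPower.alternatingMapLinearEquiv_apply_ιMulti, map_zero,
    AlternatingMap.compLinearMap_apply] at h1
  have h2 : (fun i => LinearMap.pi ψ (dlog Φ (b i))) = Pi.basisFun K (Fin n) := by
    funext i j
    rw [LinearMap.pi_apply, hψ]
    change ((b.repr (b i) j : ℤ) : K) = _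
    simp [Finsupp.single_apply, Pi.single_apply, eq_comm]
  have h3 := (Pi.basisFun K (Fin n)).det_self
  rw [← h2] at h3
  exact one_ne_zero (h3.symm.trans h1)

end LogForm

/-! ### Residue fields of toric valuations -/

section Adapted
variable {M : Type*} [AddCommGroup M] {n : ℕ}

/-- The lattice points on which the cocharacter `u` vanishes. -/
def weightZero (u : M →+ ℤ) : Submodule ℤ M := LinearMap.ker u.toIntLinearMap

/-- A surjective cocharacter of a lattice is a coordinate of some basis. -/
lemma exists_adapted_basis (b : Module.Basis (Fin n) ℤ M) (u : M →+ ℤ) {m₀ : M} (h₀ : u m₀ = 1) :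
    ∃ (r : ℕ) (_ : Module.Basis (Fin r) ℤ (weightZero u)), r + 1 = n ∧
      ∃ (b' : Module.Basis (Fin n) ℤ M) (i₀ : Fin n), u (b' i₀) = 1 ∧
        ∀ i, i ≠ i₀ → u (b' i) = 0 := by
  obtain ⟨r, ⟨c⟩⟩ := Submodule.nonempty_basis_of_pid b (weightZero u)
  have hN : ∀ m, m ∈ weightZero u ↔ u m = 0 := fun m => Iff.rfl
  have hli : ∀ (a : ℤ), ∀ x ∈ weightZero u, a • m₀ + x = 0 → a = 0 := by
    intro a x hx h
    have := congrArg u h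
    rw [map_add, map_zsmul, h₀, (hN x).1 hx] at this
    simpa using this
  have hsp : ∀ z : M, ∃ a : ℤ, z + a • m₀ ∈ weightZero u := fun z => ⟨-u z, by
    rw [hN, map_add, map_zsmul, h₀]; simp⟩
  let b' := Module.Basis.mkFinCons m₀ c hli hsp
  have hr : r + 1 = n := by simpa using Fintype.card_congr (b'.indexEquiv b)
  subst hr
  refine ⟨r, c, rfl, b', 0, ?_, fun i hi => ?_⟩
  · rw [Module.Basis.coe_mkFinCons, Fin.cons_zero, h₀]
  · obtain ⟨j, rfl⟩ := Fin.exists_succ_eq_of_ne_zero hi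
    rw [Module.Basis.coe_mkFinCons, Fin.cons_succ]
    exact (hN _).1 (c j).2

end Adapted

section TrDeg
variable {k : Type*} [Field k] {N : Type*} [AddCommGroup N] {F : Type*} [Field F] [Algebra k F]
  {θ : AddMonoidAlgebra k N →ₐ[k] F} {r : ℕ}

open MvPolynomial in
/-- The monomials of a basis of the lattice form a transcendence basis of the field of fractions of
the ring of Laurent polynomials. -/
lemma IsFractionMap.isTranscendenceBasis (hθ : IsFractionMap θ) (c : Module.Basis (Fin r) ℤ N) :
    IsTranscendenceBasis k fun i => θ (AddMonoidAlgebra.single (c i) 1) := by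
  have hind : AlgebraicIndependent k fun i => θ (AddMonoidAlgebra.single (c i) 1) := by
    let e : (Fin r →₀ ℕ) →+ N := (Finsupp.liftAddHom (fun i => (multiplesHom N) (c i)))
    have he : ∀ a, e a = ∑ i, a i • c i := fun a => by
      change a.sum _ = _
      rw [Finsupp.sum_fintype _ _ (by simp)]
      rfl
    have hinj : Function.Injective e := by
      intro a a' h
      rw [he, he] at h
      have hr : ∀ a : Fin r →₀ ℕ, ∀ i, c.repr (∑ i, a i • c i) i = a i := by
        intro a i
        have : ∑ i, a i • c i = ∑ i, (a i : ℤ) • c i := by simp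
        rw [this, c.repr_sum_self]
      ext i
      have := hr a i
      rw [h, hr a' i] at this
      exact_mod_cast this.symm
    let g : MvPolynomial (Fin r) k →ₐ[k] AddMonoidAlgebra k N :=
      AddMonoidAlgebra.mapDomainAlgHom k k e
    have hg : Function.Injective g := AddMonoidAlgebra.mapDomain_injective hinj
    have : MvPolynomial.aeval (fun i => θ (AddMonoidAlgebra.single (c i) 1)) = θ.comp g := by
      refine MvPolynomial.algHom_ext fun i => ?_
      rw [aeval_X, AlgHom.comp_apply]
      congr 1
      change _ = AddMonoidAlgebra.mapDomainAlgHom k k e (AddMonoidAlgebra.single _ _)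
      rw [AddMonoidAlgebra.mapDomainAlgHom_apply, AddMonoidAlgebra.mapDomain_single]
      congr 1
      rw [he, Finset.sum_eq_single i] <;> simp +contextual [eq_comm]
    rw [AlgebraicIndependent, this]
    exact hθ.injective.comp hg
  refine hind.isTranscendenceBasis_iff_isAlgebraic.2 ?_
  set A := Algebra.adjoin k (Set.range fun i => θ (AddMonoidAlgebra.single (c i) 1))
  have hmon : ∀ m, IsAlgebraic A (θ (AddMonoidAlgebra.single m 1)) := by
    intro m
    have hm : m ∈ Submodule.span ℤ (Set.range c) := c.span_eq ▸ Submodule.mem_top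
    induction hm using Submodule.span_induction with
    | mem x hx =>
      obtain ⟨i, rfl⟩ := hx
      exact isAlgebraic_algebraMap (⟨_, Algebra.subset_adjoin ⟨i, rfl⟩⟩ : A)
    | zero =>
      rw [← AddMonoidAlgebra.one_def, map_one]
      exact isAlgebraic_one
    | add x y _ _ hx hy =>
      have : θ (AddMonoidAlgebra.single (x + y) 1) =
          θ (AddMonoidAlgebra.single x 1) * θ (AddMonoidAlgebra.single y 1) := by
        rw [← map_mul, AddMonoidAlgebra.single_mul_single, one_mul]
      rw [this]
      exact hx.mul hy
    | smul a x _ hx =>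
      rw [map_single_zsmul]
      rcases Int.eq_nat_or_neg a with ⟨d, rfl | rfl⟩
      · rw [zpow_natCast]; exact hx.pow d
      · rw [zpow_neg, zpow_natCast]; exact (hx.pow d).inv
  have hall : ∀ f, IsAlgebraic A (θ f) := by
    intro f
    induction f using AddMonoidAlgebra.induction_linear with
    | zero => rw [map_zero]; exact isAlgebraic_zero
    | add f g hf hg => rw [map_add]; exact hf.add hg
    | single m a =>
      have : θ (AddMonoidAlgebra.single m a) =
          algebraMap A F (algebraMap k A a) * θ (AddMonoidAlgebra.single m 1) := by
        rw [← IsScalarTower.algebraMap_apply, ← Algebra.smul_def, ← map_smul]; simp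
      rw [this]
      exact (isAlgebraic_algebraMap _).mul (hmon m)
  refine ⟨fun x => ?_⟩
  obtain ⟨a, b, hb, h⟩ := hθ.exists_frac x
  have hb0 : θ b ≠ 0 := fun h0 => hb (hθ.injective (by rw [h0, map_zero]))
  rw [eq_div_of_mul_eq hb0 h, div_eq_mul_inv]
  exact (hall a).mul (hall b).inv

end TrDeg

section Residue
variable {k : Type*} [Field k] {M : Type*} [AddCommGroup M] {K : Type*} [Field K] [Algebra k K]
  {Φ : AddMonoidAlgebra k M →ₐ[k] K}

/-- The residue field of the toric valuation given by `u` is the field of fractions of the ring of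
Laurent polynomials of weight zero. -/
lemma exists_isFractionMap_residueField (hΦ : IsFractionMap Φ) {u : M →+ ℤ}
    [IsLocalRing (toricRing Φ u)] :
    ∃ θ : AddMonoidAlgebra k (weightZero u) →ₐ[k] IsLocalRing.ResidueField (toricRing Φ u),
      IsFractionMap θ := by
  have hdom := hΦ.isDomain
  let ψ : AddMonoidAlgebra k (halfSpace u) →ₐ[k] toricRing Φ u :=
    (Φ.comp (monoidEmb k (halfSpace u))).codRestrict _
      (map_mem_fracSubalgebra (Φ.comp (monoidEmb k (halfSpace u))) _)
  have hψ : ∀ f, (ψ f : K) = Φ (monoidEmb k _ f) := fun _ => rfl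
  let j : weightZero u →+ halfSpace u :=
    { toFun := fun m => ⟨m, (show u m = 0 from m.2).ge⟩
      map_zero' := rfl
      map_add' := fun _ _ => rfl }
  let J : AddMonoidAlgebra k (weightZero u) →ₐ[k] AddMonoidAlgebra k (halfSpace u) :=
    AddMonoidAlgebra.mapDomainAlgHom k k j
  let ρ : toricRing Φ u →ₐ[k] IsLocalRing.ResidueField (toricRing Φ u) :=
    IsScalarTower.toAlgHom k _ _
  have hρ : ∀ x, ρ x = IsLocalRing.residue _ x := fun _ => rfl
  have hunit : ∀ f, initialForm u f ≠ 0 → IsUnit (ψ f) := by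
    intro f hf
    have h0 := map_emb_ne_zero hΦ hf
    rw [isUnit_subalgebra_iff _ (by rw [hψ]; exact h0), hψ]
    exact (mem_toricRing_iff hΦ u).2 ⟨1, f, hf, by rw [inv_mul_cancel₀ h0, map_one, map_one]⟩
  have hnonunit : ∀ f, initialForm u f = 0 → ρ (ψ f) = 0 := by
    intro f hf
    rw [hρ, IsLocalRing.residue_eq_zero_iff, IsLocalRing.mem_maximalIdeal, mem_nonunits_iff]
    by_cases h0 : (ψ f : K) = 0
    · rw [show ψ f = 0 from Subtype.ext h0]; exact not_isUnit_zero
    rw [isUnit_subalgebra_iff _ h0, mem_toricRing_iff hΦ, hψ]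
    rintro ⟨a, b, hb, h⟩
    rw [hψ] at h0
    have h1 : Φ (monoidEmb k _ (f * a)) = Φ (monoidEmb k _ b) := by
      rw [map_mul, map_mul, ← h, mul_inv_cancel_left₀ h0]
    apply hb
    rw [← monoidEmb_injective _ (hΦ.injective h1), map_mul, hf, zero_mul]
  have hJ : ∀ f, initialForm u (J f) = monoidEmb k (weightZero u).toAddSubmonoid f := by
    intro f
    induction f using AddMonoidAlgebra.induction_linear with
    | zero => rw [map_zero, map_zero, map_zero]
    | add f g hf hg => rw [map_add, map_add, hf, hg, map_add]
    | single m c =>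
      have hm : u m = 0 := m.2
      change initialForm u (AddMonoidAlgebra.mapDomainAlgHom k k j _) = _
      rw [AddMonoidAlgebra.mapDomainAlgHom_apply, AddMonoidAlgebra.mapDomain_single,
        initialForm_single, if_pos (show u (j m : M) = 0 from hm), monoidEmb_single]
      rfl
  have hlift : ∀ f, ∃ g, ρ (ψ f) = ρ (ψ (J g)) ∧ initialForm u f = initialForm u (J g) := by
    intro f
    have : ∃ g, initialForm u f = initialForm u (J g) := by
      obtain ⟨g, hg⟩ := exists_monoidEmb_eq (weightZero u).toAddSubmonoid (initialForm u f)
        (fun m hm => by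
          rw [Finsupp.mem_support_iff, coeff_initialForm] at hm
          by_contra h
          exact hm (if_neg h))
      exact ⟨g, by rw [hJ, hg]⟩
    obtain ⟨g, hg⟩ := this
    refine ⟨g, ?_, hg⟩
    rw [← sub_eq_zero, ← map_sub, ← map_sub]
    exact hnonunit _ (by rw [map_sub, hg, sub_self])
  have hJinj : ∀ f, f ≠ 0 → initialForm u (J f) ≠ 0 := fun f hf h => by
    rw [hJ, map_eq_zero_iff _ (monoidEmb_injective _)] at h
    exact hf h
  refine ⟨(ρ.comp ψ).comp J, ?_, fun x => ?_⟩
  · rw [injective_iff_map_eq_zero]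
    intro f hf
    by_contra hf0
    exact ((hunit _ (hJinj f hf0)).map ρ).ne_zero hf
  · obtain ⟨y, rfl⟩ := IsLocalRing.residue_surjective x
    obtain ⟨a, b, hb, h⟩ := (mem_toricRing_iff hΦ u).1 y.2
    have h' : y * ψ b = ψ a := Subtype.ext h
    obtain ⟨a', ha', -⟩ := hlift a
    obtain ⟨b', hb', hb''⟩ := hlift b
    refine ⟨a', b', fun h0 => hb (by rw [hb'', h0, map_zero, map_zero]), ?_⟩
    change ρ y * ρ (ψ (J b')) = ρ (ψ (J a'))
    rw [← ha', ← hb', ← map_mul, h']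

/-- Toric valuations of the function field of a torus of dimension `n` are divisorial: their residue
fields have transcendence degree `n - 1`. -/
lemma trdeg_residueField_toricRing (hΦ : IsFractionMap Φ) {u : M →+ ℤ} {r : ℕ}
    [IsLocalRing (toricRing Φ u)] (c : Module.Basis (Fin r) ℤ (weightZero u)) :
    Algebra.trdeg k (IsLocalRing.ResidueField (toricRing Φ u)) = r := by
  obtain ⟨θ, hθ⟩ := exists_isFractionMap_residueField hΦ (u := u)
  have := (hθ.isTranscendenceBasis c).lift_cardinalMk_eq_trdeg
  simpa using this.symm

/-- If only `0` has weight zero, then the residue field of the toric valuation is `k`. -/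
lemma finrank_residueField_toricRing (hΦ : IsFractionMap Φ) {u : M →+ ℤ}
    [IsLocalRing (toricRing Φ u)] (hu : Function.Injective u) :
    Module.finrank k (IsLocalRing.ResidueField (toricRing Φ u)) = 1 := by
  obtain ⟨θ, hθ⟩ := exists_isFractionMap_residueField hΦ (u := u)
  have hsub : ∀ m : weightZero u, m = 0 := fun m =>
    Subtype.ext (hu ((show u m = 0 from m.2).trans (map_zero u).symm))
  have hs : ∀ f : AddMonoidAlgebra k (weightZero u), ∃ c, algebraMap k _ c = f := by
    intro f
    refine ⟨f.coeff 0, ?_⟩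
    ext m
    rw [hsub m, AddMonoidAlgebra.coe_algebraMap]
    simp
  rw [finrank_eq_one_iff']
  refine ⟨1, one_ne_zero, fun x => ?_⟩
  obtain ⟨a, b, hb, h⟩ := hθ.exists_frac x
  obtain ⟨a, rfl⟩ := hs a
  obtain ⟨b, rfl⟩ := hs b
  have hb0 : b ≠ 0 := fun h0 => hb (by rw [h0, map_zero])
  rw [AlgHom.commutes, AlgHom.commutes] at h
  have hb1 : algebraMap k (IsLocalRing.ResidueField (toricRing Φ u)) b ≠ 0 := by
    simpa using hb0
  refine ⟨a / b, ?_⟩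
  rw [Algebra.smul_def, mul_one, map_div₀, div_eq_iff hb1, h]

end Residue

/-! ### Local rings in an affine chart -/

section ChartHom
variable {C X : Scheme.{u}} {A : Type u} [CommRing A] (f : C ⟶ X) (j : Spec (.of A) ⟶ X)
  [IsOpenImmersion j]

lemma range_fromSpecStalk_comp_subset {x : C} (h : f x ∈ Set.range j) :
    Set.range (C.fromSpecStalk x ≫ f) ⊆ Set.range j := by
  rintro _ ⟨y, rfl⟩
  have hy : C.fromSpecStalk x y ∈ Set.range (C.fromSpecStalk x) := ⟨y, rfl⟩
  rw [Scheme.range_fromSpecStalk] at hy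
  rw [Scheme.Hom.comp_apply]
  exact (hy.map f.continuous).mem_open j.isOpenEmbedding.isOpen_range h

/-- The pull-back of functions along `f : C → X` from the affine chart `Spec A` of `X` to the local
ring of `C` at a point `x`, the image of which lies in this chart. -/
noncomputable def chartHom (x : C) (h : f x ∈ Set.range j) : A →+* C.presheaf.stalk x :=
  (Spec.preimage (IsOpenImmersion.lift j (C.fromSpecStalk x ≫ f)
    (range_fromSpecStalk_comp_subset f j h))).hom

lemma specMap_chartHom (x : C) (h : f x ∈ Set.range j) :
    Spec.map (CommRingCat.ofHom (chartHom f j x h)) ≫ j = C.fromSpecStalk x ≫ f := by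
  rw [chartHom, CommRingCat.ofHom_hom, Spec.map_preimage, IsOpenImmersion.lift_fac]

lemma chartHom_unique {x : C} (h : f x ∈ Set.range j) (g : A →+* C.presheaf.stalk x)
    (hg : Spec.map (CommRingCat.ofHom g) ≫ j = C.fromSpecStalk x ≫ f) : g = chartHom f j x h := by
  rw [← specMap_chartHom f j x h, cancel_mono] at hg
  have := Spec.map_injective hg
  exact congrArg CommRingCat.Hom.hom this

lemma isUnit_chartHom_iff {x : C} (h : f x ∈ Set.range j) {y : PrimeSpectrum A} (hy : f x = j y)
    (a : A) : IsUnit (chartHom f j x h a) ↔ a ∉ y.asIdeal := by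
  have h1 : Spec.map (CommRingCat.ofHom (chartHom f j x h))
      (IsLocalRing.closedPoint (C.presheaf.stalk x)) = y := by
    apply j.isOpenEmbedding.injective
    have h2 := congrArg (fun g : Spec (C.presheaf.stalk x) ⟶ X =>
      g (IsLocalRing.closedPoint (C.presheaf.stalk x))) (specMap_chartHom f j x h)
    refine (Scheme.Hom.comp_apply _ _ _).symm.trans (h2.trans ?_)
    refine (Scheme.Hom.comp_apply _ _ _).trans (Eq.trans ?_ hy)
    exact congrArg f Scheme.fromSpecStalk_closedPoint
  rw [← h1]
  change _ ↔ ¬ (chartHom f j x h a ∈ IsLocalRing.maximalIdeal _)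
  rw [IsLocalRing.mem_maximalIdeal, mem_nonunits_iff, not_not]

/-- Pull-back commutes with passage to the local ring of a generization. -/
lemma stalkSpecializes_chartHom {x x' : C} (hx : x' ⤳ x) (h : f x ∈ Set.range j)
    (h' : f x' ∈ Set.range j) :
    (C.presheaf.stalkSpecializes hx).hom.comp (chartHom f j x h) = chartHom f j x' h' := by
  apply chartHom_unique
  rw [CommRingCat.ofHom_comp, Spec.map_comp, Category.assoc, specMap_chartHom,
    CommRingCat.ofHom_hom, Scheme.SpecMap_stalkSpecializes_fromSpecStalk_assoc]

lemma chartHom_comp_of_chart {B : Type u} [CommRing B] (j' : Spec (.of B) ⟶ X) [IsOpenImmersion j']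
    (φ : A →+* B) (hφ : Spec.map (CommRingCat.ofHom φ) ≫ j = j') {x : C}
    (h : f x ∈ Set.range j) (h' : f x ∈ Set.range j') :
    (chartHom f j' x h').comp φ = chartHom f j x h := by
  apply chartHom_unique
  rw [CommRingCat.ofHom_comp, Spec.map_comp, Category.assoc, hφ, specMap_chartHom]

/-- Pull-back from a chart of `X` to a chart of `C`. -/
lemma chartHom_comp_of_hom {B : Type u} [CommRing B] (j' : Spec (.of B) ⟶ C) [IsOpenImmersion j']
    (φ : A →+* B) (hφ : Spec.map (CommRingCat.ofHom φ) ≫ j = j' ≫ f) {x : C}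
    (h : f x ∈ Set.range j) (h' : (𝟙 C : C ⟶ C) x ∈ Set.range j') :
    (chartHom (𝟙 C) j' x h').comp φ = chartHom f j x h := by
  apply chartHom_unique
  rw [CommRingCat.ofHom_comp, Spec.map_comp, Category.assoc, hφ, ← Category.assoc,
    specMap_chartHom, Category.comp_id]

lemma stalkMap_chartHom {x : C} (h : f x ∈ Set.range j)
    (h' : (𝟙 X : X ⟶ X) (f x) ∈ Set.range j) :
    (f.stalkMap x).hom.comp (chartHom (𝟙 X) j (f x) h') = chartHom f j x h := by
  apply chartHom_unique
  rw [CommRingCat.ofHom_comp, Spec.map_comp, Category.assoc, specMap_chartHom, Category.comp_id,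
    CommRingCat.ofHom_hom, Scheme.SpecMap_stalkMap_fromSpecStalk]

/-- The elements of the local ring at a point of the chart are fractions of functions on it. -/
lemma exists_mul_chartHom_id {x : X} (h : (𝟙 X : X ⟶ X) x ∈ Set.range j) {y : PrimeSpectrum A}
    (hy : x = j y) (c : X.presheaf.stalk x) :
    ∃ a b, b ∉ y.asIdeal ∧ c * chartHom (𝟙 X) j x h b = chartHom (𝟙 X) j x h a := by
  subst hy
  let y' : Spec (.of A) := y
  let e : X.presheaf.stalk (j y') ⟶ (Spec (.of A)).presheaf.stalk y' := j.stalkMap y'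
  have he : Function.Bijective e.hom :=
    (ConcreteCategory.isIso_iff_bijective e).1 (inferInstanceAs (IsIso (j.stalkMap y')))
  let t : A →+* (Spec (.of A)).presheaf.stalk y' :=
    ((Scheme.ΓSpecIso (.of A)).inv ≫ (Spec (.of A)).presheaf.germ ⊤ y' trivial).hom
  have ht : e.hom.comp (chartHom (𝟙 X) j (j y) h) = t := by
    have h1 : Spec.map (CommRingCat.ofHom (e.hom.comp (chartHom (𝟙 X) j (j y) h))) ≫ j =
        Spec.map (CommRingCat.ofHom t) ≫ j := by
      rw [CommRingCat.ofHom_comp, Spec.map_comp, Category.assoc, specMap_chartHom, Category.comp_id,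
        CommRingCat.ofHom_hom, CommRingCat.ofHom_hom]
      exact (Scheme.SpecMap_stalkMap_fromSpecStalk j).trans
        (congrArg (· ≫ j) (Spec.fromSpecStalk_eq (.of A) y'))
    rw [cancel_mono] at h1
    exact congrArg CommRingCat.Hom.hom (Spec.map_injective h1)
  have hloc : @IsLocalization.AtPrime A _ ((Spec (.of A)).presheaf.stalk y') _ t.toAlgebra
      y.asIdeal _ := StructureSheaf.IsLocalization.to_stalk A y
  let _ := t.toAlgebra
  obtain ⟨⟨a, b⟩, hab⟩ := IsLocalization.surj (M := y.asIdeal.primeCompl) (e.hom c)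
  refine ⟨a, b, b.2, he.1 ?_⟩
  rw [map_mul]
  have h2 : ∀ a, e.hom (chartHom (𝟙 X) j (j y) h a) = t a := fun a => RingHom.congr_fun ht a
  rw [h2, h2]
  exact hab

/-- If `f` is surjective on stalks, then the elements of the local ring of `C` at `x` are fractions
of functions pulled back from a chart. -/
lemma exists_mul_chartHom [SurjectiveOnStalks f] {x : C} (h : f x ∈ Set.range j)
    {y : PrimeSpectrum A} (hy : f x = j y) (c : C.presheaf.stalk x) :
    ∃ a b, b ∉ y.asIdeal ∧ c * chartHom f j x h b = chartHom f j x h a := by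
  obtain ⟨d, rfl⟩ := f.stalkMap_surjective x c
  obtain ⟨a, b, hb, hab⟩ := exists_mul_chartHom_id j (x := f x) h hy d
  refine ⟨a, b, hb, ?_⟩
  have h2 : ∀ a, (f.stalkMap x).hom (chartHom (𝟙 X) j (f x) h a) = chartHom f j x h a :=
    fun a => RingHom.congr_fun (stalkMap_chartHom f j h h) a
  rw [← h2, ← h2, ← hab, map_mul]

end ChartHom

section OverField
variable (k : Type u) [Field k] {C X : Scheme.{u}} [C.Over (Spec (.of k))] [X.Over (Spec (.of k))]
  [IsIntegral C]
  {A : Type u} [CommRing A] [Algebra k A] (f : C ⟶ X) [f.IsOver (Spec (.of k))]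
  (j : Spec (.of A) ⟶ X) [IsOpenImmersion j]
  (hj : j ≫ (X ↘ Spec (.of k)) = Spec.map (CommRingCat.ofHom (algebraMap k A)))

lemma specMap_algebraMap_functionField :
    Spec.map (CommRingCat.ofHom (algebraMap k C.functionField)) =
      C.fromSpecStalk (genericPoint C) ≫ (C ↘ Spec (.of k)) := by
  have h1 : CommRingCat.ofHom (algebraMap k C.functionField) = (Scheme.ΓSpecIso (.of k)).inv ≫
      (C ↘ Spec (.of k)).appTop ≫ C.presheaf.germ ⊤ (genericPoint C) trivial := rfl
  rw [h1, Spec.map_comp, Spec.map_comp, ← Scheme.fromSpecStalk_toSpecΓ, Category.assoc,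
    Category.assoc, ← Scheme.toSpecΓ_naturality_assoc, toSpecΓ_SpecMap_ΓSpecIso_inv,
    Category.comp_id]

variable {k} in
lemma mem_range_genericPoint {x : C} (h : f x ∈ Set.range j) :
    f (genericPoint C) ∈ Set.range j :=
  (((genericPoint_spec C).specializes trivial : genericPoint C ⤳ x).map f.continuous).mem_open
    j.isOpenEmbedding.isOpen_range h

/-- The pull-back of functions from a chart of `X` to the function field of `C`, as a homomorphism
of `k`-algebras. -/
noncomputable def chartAlgHom (h : f (genericPoint C) ∈ Set.range j) : A →ₐ[k] C.functionField where
  __ := chartHom f j (genericPoint C) h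
  commutes' c := by
    have : (chartHom f j (genericPoint C) h).comp (algebraMap k A) =
        algebraMap k C.functionField := by
      have h1 : Spec.map (CommRingCat.ofHom ((chartHom f j (genericPoint C) h).comp
          (algebraMap k A))) = Spec.map (CommRingCat.ofHom (algebraMap k C.functionField)) := by
        rw [CommRingCat.ofHom_comp, Spec.map_comp, ← hj, ← Category.assoc, specMap_chartHom,
          Category.assoc, comp_over, specMap_algebraMap_functionField]
      exact congrArg CommRingCat.Hom.hom (Spec.map_injective h1)
    exact RingHom.congr_fun this c

lemma algebraMap_chartHom {x : C} (h : f x ∈ Set.range j) (a : A) :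
    algebraMap (C.presheaf.stalk x) C.functionField (chartHom f j x h a) =
      chartAlgHom k f j hj (mem_range_genericPoint f j h) a :=
  RingHom.congr_fun (stalkSpecializes_chartHom f j ((genericPoint_spec C).specializes trivial) h
    (mem_range_genericPoint f j h)) a

lemma mem_localRing_iff {x : C} {z : C.functionField} :
    z ∈ localRing k x ↔ ∃ c, algebraMap (C.presheaf.stalk x) C.functionField c = z := Iff.rfl

/-- The local ring of `C` at a point, in terms of a chart of `X`. -/
lemma localRing_eq_fracSubalgebra [SurjectiveOnStalks f] {x : C} (h : f x ∈ Set.range j)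
    {y : PrimeSpectrum A} (hy : f x = j y) :
    localRing k x = fracSubalgebra (chartAlgHom k f j hj (mem_range_genericPoint f j h))
      y.asIdeal.primeCompl := by
  ext z
  rw [mem_localRing_iff, mem_fracSubalgebra]
  constructor
  · rintro ⟨c, rfl⟩
    obtain ⟨a, b, hb, hab⟩ := exists_mul_chartHom f j h hy c
    refine ⟨a, b, hb, ?_⟩
    rw [← algebraMap_chartHom k f j hj h, ← algebraMap_chartHom k f j hj h, ← map_mul, hab]
  · rintro ⟨a, b, hb, hab⟩
    obtain ⟨v, hv⟩ := (isUnit_chartHom_iff f j h hy b).2 hb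
    have hv1 : algebraMap (C.presheaf.stalk x) C.functionField (v⁻¹ : _ˣ) *
        algebraMap (C.presheaf.stalk x) C.functionField v = 1 := by
      rw [← map_mul, Units.inv_mul, map_one]
    refine ⟨(v⁻¹ : (C.presheaf.stalk x)ˣ) * chartHom f j x h a, ?_⟩
    rw [← algebraMap_chartHom k f j hj h, ← algebraMap_chartHom k f j hj h, ← hv] at hab
    rw [map_mul, ← hab, mul_left_comm, hv1, mul_one]

lemma chartAlgHom_inv_mem {x : C} (h : f x ∈ Set.range j)
    {y : PrimeSpectrum A} (hy : f x = j y) {b : A} (hb : b ∉ y.asIdeal) :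
    chartAlgHom k f j hj (mem_range_genericPoint f j h) b ≠ 0 ∧
    (chartAlgHom k f j hj (mem_range_genericPoint f j h) b)⁻¹ ∈ localRing k x := by
  obtain ⟨v, hv⟩ := (isUnit_chartHom_iff f j h hy b).2 hb
  have hv1 : algebraMap (C.presheaf.stalk x) C.functionField v *
      algebraMap (C.presheaf.stalk x) C.functionField (v⁻¹ : _ˣ) = 1 := by
    rw [← map_mul, Units.mul_inv, map_one]
  rw [← algebraMap_chartHom k f j hj h, ← hv]
  exact ⟨left_ne_zero_of_mul_eq_one hv1, _, eq_inv_of_mul_eq_one_right hv1⟩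

end OverField

section FunctionField
variable (k : Type u) [Field k] {X : Scheme.{u}} [X.Over (Spec (.of k))] [IsIntegral X]
  {A : Type u} [CommRing A] [IsDomain A] [Algebra k A] (j : Spec (.of A) ⟶ X) [IsOpenImmersion j]
  (hj : j ≫ (X ↘ Spec (.of k)) = Spec.map (CommRingCat.ofHom (algebraMap k A)))

lemma genericPoint_eq_chart : genericPoint X = j (⊥ : PrimeSpectrum A) := by
  have := genericPoint_eq_of_isOpenImmersion j
  rw [← this, genericPoint_eq_bot_of_affine]

/-- The function field of an integral scheme is the field of fractions of the coordinate ring of any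
chart. -/
lemma isFractionMap_chartAlgHom (h : (𝟙 X : X ⟶ X) (genericPoint X) ∈ Set.range j) :
    IsFractionMap (chartAlgHom k (𝟙 X) j hj h) := by
  have hy : (𝟙 X : X ⟶ X) (genericPoint X) = j (⊥ : PrimeSpectrum A) := genericPoint_eq_chart j
  constructor
  · rw [injective_iff_map_eq_zero]
    intro a ha
    by_contra ha0
    exact (chartAlgHom_inv_mem k (𝟙 X) j hj h hy (b := a) ha0).1 ha
  · intro z
    have hz : z ∈ localRing k (genericPoint X) := ⟨z, by
      change (X.presheaf.stalkSpecializes _).hom z = z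
      simp⟩
    rw [localRing_eq_fracSubalgebra k (𝟙 X) j hj h hy] at hz
    obtain ⟨a, b, hb, hab⟩ := hz
    exact ⟨a, b, fun h0 => hb (by rw [h0]; exact Ideal.zero_mem _), hab⟩

end FunctionField

/-! ### The charts of the toric variety -/

namespace FakeWPSFan
variable {n : ℕ} (F : FakeWPSFan n) (k : Type u) [Field k]

/-- The affine chart `U_{σ_I}` of `W`, as a morphism from a spectrum. -/
noncomputable def openChart (I : Cone n) :
    Spec (.of (F.CoordRing k I.1)) ⟶ F.toricVariety k := F.ι k I

instance (I : Cone n) : IsOpenImmersion (F.openChart k I) :=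
  inferInstanceAs (IsOpenImmersion (F.ι k I))

lemma openChart_over (I : Cone n) : F.openChart k I ≫ (F.toricVariety k ↘ Spec (.of k)) =
    Spec.map (CommRingCat.ofHom (algebraMap k (F.CoordRing k I.1))) :=
  Limits.colimit.ι_desc _ _

lemma specMap_restrictCoord {I J : Cone n} (h : I.1 ⊆ J.1) :
    Spec.map (CommRingCat.ofHom (F.restrictCoord k h : F.CoordRing k J.1 →+* F.CoordRing k I.1)) ≫
      F.openChart k J = F.openChart k I :=
  F.chartMap_ι k h

lemma exists_openChart_eq (x : F.toricVariety k) :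
    ∃ (I : Cone n) (y : PrimeSpectrum (F.CoordRing k I.1)), x = F.openChart k I y := by
  obtain ⟨I, y, hy⟩ := F.ι_jointly_surjective k x
  exact ⟨I, y, hy.symm⟩

lemma genericPoint_mem_openChart (I : Cone n) :
    (𝟙 (F.toricVariety k) : F.toricVariety k ⟶ F.toricVariety k)
      (genericPoint (F.toricVariety k)) ∈ Set.range (F.openChart k I) :=
  ⟨_, (genericPoint_eq_chart (F.openChart k I)).symm⟩

/-- The functions on a chart, as rational functions on `W`. -/
noncomputable def chartFun (I : Cone n) :
    F.CoordRing k I.1 →ₐ[k] (F.toricVariety k).functionField :=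
  chartAlgHom k (𝟙 (F.toricVariety k)) (F.openChart k I) (F.openChart_over k I)
    (F.genericPoint_mem_openChart k I)

lemma chartFun_restrictCoord {I J : Cone n} (h : I.1 ⊆ J.1) (f : F.CoordRing k J.1) :
    F.chartFun k I (F.restrictCoord k h f) = F.chartFun k J f :=
  RingHom.congr_fun (chartHom_comp_of_chart (𝟙 (F.toricVariety k)) (F.openChart k J)
    (F.openChart k I) (F.restrictCoord k h : F.CoordRing k J.1 →+* F.CoordRing k I.1)
    (F.specMap_restrictCoord k h)
    (F.genericPoint_mem_openChart k J) (F.genericPoint_mem_openChart k I)) f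

/-- The cone `0`, the chart of which is the torus. -/
def zeroCone (n : ℕ) : Cone n := ⟨∅, Finset.univ_nonempty.ne_empty.symm⟩

/-- The Laurent polynomials, as rational functions on `W`. -/
noncomputable def laurent :
    AddMonoidAlgebra k (Fin n → ℤ) →ₐ[k] (F.toricVariety k).functionField :=
  (F.chartFun k (zeroCone n)).comp (AddMonoidAlgebra.mapDomainAlgHom k k
    ((AddMonoidHom.id (Fin n → ℤ)).codRestrict (F.dualCone (zeroCone n).1)
      (by simp [dualCone, zeroCone])))

lemma laurent_monoidEmb (I : Cone n) (f : F.CoordRing k I.1) :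
    F.laurent k (monoidEmb k (F.dualCone I.1) f) = F.chartFun k I f := by
  rw [← F.chartFun_restrictCoord k (I := zeroCone n) (Finset.empty_subset I.1), laurent,
    AlgHom.comp_apply]
  congr 1
  induction f using AddMonoidAlgebra.induction_linear with
  | zero => simp
  | add f g hf hg => simp only [map_add, hf, hg]
  | single m c =>
    rw [monoidEmb_single]
    refine Eq.trans ?_ (F.restrictCoord_single k (I := (zeroCone n).1) (Finset.empty_subset I.1)
      m c).symm
    simp
    rfl

lemma chartFun_single (I : Cone n) (m : F.dualCone I.1) (c : k) :
    F.chartFun k I (AddMonoidAlgebra.single m c) =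
      F.laurent k (AddMonoidAlgebra.single (m : Fin n → ℤ) c) := by
  rw [← laurent_monoidEmb, monoidEmb_single]

lemma isFractionMap_laurent : IsFractionMap (F.laurent k) := by
  have h := isFractionMap_chartAlgHom k (F.openChart k (zeroCone n))
    (F.openChart_over k (zeroCone n)) (F.genericPoint_mem_openChart k (zeroCone n))
  have hs : Function.Surjective (monoidEmb k (F.dualCone (zeroCone n).1)) := fun f =>
    exists_monoidEmb_eq _ f fun m _ => by simp [zeroCone, dualCone]
  constructor
  · intro f g hfg
    obtain ⟨f, rfl⟩ := hs f
    obtain ⟨g, rfl⟩ := hs g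
    rw [laurent_monoidEmb, laurent_monoidEmb] at hfg
    rw [h.injective hfg]
  · intro x
    obtain ⟨a, b, hb, hab⟩ := h.exists_frac x
    refine ⟨monoidEmb k _ a, monoidEmb k _ b, ?_, ?_⟩
    · rwa [Ne, map_eq_zero_iff _ (monoidEmb_injective _)]
    · rw [laurent_monoidEmb, laurent_monoidEmb]; exact hab

lemma laurent_comp_monoidEmb (I : Cone n) :
    (F.laurent k).comp (monoidEmb k (F.dualCone I.1)) = F.chartFun k I :=
  AlgHom.ext (F.laurent_monoidEmb k I)

lemma localRing_openChart (I : Cone n) (y : PrimeSpectrum (F.CoordRing k I.1)) :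
    localRing k (F.openChart k I y) = fracSubalgebra (F.chartFun k I) y.asIdeal.primeCompl :=
  localRing_eq_fracSubalgebra k (𝟙 (F.toricVariety k)) (F.openChart k I) (F.openChart_over k I)
    (x := F.openChart k I y) ⟨y, rfl⟩ rfl

variable {k} in
lemma chartFun_mem_localRing {I : Cone n} (y : PrimeSpectrum (F.CoordRing k I.1))
    (f : F.CoordRing k I.1) : F.chartFun k I f ∈ localRing k (F.openChart k I y) := by
  rw [localRing_openChart]
  exact map_mem_fracSubalgebra _ _ f

variable {k} in
lemma chartFun_inv_mem_localRing {I : Cone n} {y : PrimeSpectrum (F.CoordRing k I.1)}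
    {f : F.CoordRing k I.1} (hf : f ∉ y.asIdeal) :
    (F.chartFun k I f)⁻¹ ∈ localRing k (F.openChart k I y) :=
  (chartAlgHom_inv_mem k (𝟙 (F.toricVariety k)) (F.openChart k I) (F.openChart_over k I)
    (x := F.openChart k I y) ⟨y, rfl⟩ rfl hf).2

lemma exists_supporting {I J : Cone n} (h : I.1 ⊆ J.1) :
    ∃ m : F.dualCone J.1, (∀ i ∈ I.1, (m : Fin n → ℤ) ⬝ᵥ F.v i = 0) ∧
      ∀ i ∈ J.1, i ∉ I.1 → 0 < (m : Fin n → ℤ) ⬝ᵥ F.v i := by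
  obtain ⟨m, h0, hpos⟩ := F.exists_facet I.1 J.1 J.2
  refine ⟨⟨m, fun i hi => ?_⟩, fun i hi => h0 i (h hi) hi, hpos⟩
  by_cases hiI : i ∈ I.1
  · exact (h0 i hi hiI).ge
  · exact (hpos i hi hiI).le

variable {k} in
/-- The points of the chart of a face are those at which a monomial supporting this face does not
vanish. -/
lemma exists_openChart_face {I J : Cone n} (h : I.1 ⊆ J.1) {m₀ : F.dualCone J.1}
    (h0 : ∀ i ∈ I.1, (m₀ : Fin n → ℤ) ⬝ᵥ F.v i = 0)
    (hpos : ∀ i ∈ J.1, i ∉ I.1 → 0 < (m₀ : Fin n → ℤ) ⬝ᵥ F.v i)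
    {y : PrimeSpectrum (F.CoordRing k J.1)} (hy : AddMonoidAlgebra.single m₀ 1 ∉ y.asIdeal) :
    ∃ y' : PrimeSpectrum (F.CoordRing k I.1), F.openChart k I y' = F.openChart k J y := by
  have : y ∈ Set.range (F.chartMap k h) := by
    rw [F.range_chartMap k h m₀ h0 hpos]; exact hy
  obtain ⟨y', hy'⟩ := this
  refine ⟨y', ?_⟩
  have h1 : (F.chartMap k h ≫ F.ι k J) y' = F.ι k I y' := by rw [F.chartMap_ι k h]
  refine h1.symm.trans ((Scheme.Hom.comp_apply _ _ _).trans ?_)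
  exact congrArg (F.ι k J) hy'

/-- Every point of `W` lies in a torus orbit: it has a chart in which all monomials of nonnegative,
not all zero, weights vanish. -/
lemma exists_minimal_openChart (x : F.toricVariety k) :
    ∃ (I : Cone n) (y : PrimeSpectrum (F.CoordRing k I.1)), x = F.openChart k I y ∧
      ∀ m : F.dualCone I.1, (m : Fin n → ℤ) ∉ F.perp I.1 →
        AddMonoidAlgebra.single m 1 ∈ y.asIdeal := by
  classical
  let p : ℕ → Prop := fun N => ∃ (I : Cone n) (y : PrimeSpectrum (F.CoordRing k I.1)),
      x = F.openChart k I y ∧ I.1.card = N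
  have _ : DecidablePred p := Classical.decPred p
  have hex : ∃ N : ℕ, p N := by
    obtain ⟨I, y, hy⟩ := F.exists_openChart_eq k x
    exact ⟨_, I, y, hy, rfl⟩
  obtain ⟨I, y, hy, hcard⟩ := Nat.find_spec hex
  refine ⟨I, y, hy, fun m hm => ?_⟩
  by_contra hmy
  let L : Cone n := ⟨I.1.filter fun i => (m : Fin n → ℤ) ⬝ᵥ F.v i = 0, fun h =>
    I.2 (Finset.eq_univ_iff_forall.2 fun i => (Finset.mem_filter.1 (h ▸ Finset.mem_univ i)).1)⟩
  obtain ⟨y', hy'⟩ := F.exists_openChart_face (I := L) (J := I) (Finset.filter_subset _ _) (m₀ := m)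
    (fun i hi => (Finset.mem_filter.1 hi).2)
    (fun i hi hi' => lt_of_le_of_ne (m.2 i hi) fun h => hi' (Finset.mem_filter.2 ⟨hi, h.symm⟩)) hmy
  refine Nat.find_min hex ?_ ⟨L, y', hy.trans hy'.symm, rfl⟩
  rw [← hcard]
  refine Finset.card_lt_card (Finset.ssubset_iff_subset_ne.2
    ⟨Finset.filter_subset _ _, fun h => ?_⟩)
  exact hm fun i hi => by rw [← h] at hi; exact (Finset.mem_filter.1 hi).2

lemma exists_openChart_inter {I J : Cone n} {y : PrimeSpectrum (F.CoordRing k I.1)}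
    {z : PrimeSpectrum (F.CoordRing k J.1)} (h : F.openChart k I y = F.openChart k J z) :
    ∃ (L : Cone n) (w : PrimeSpectrum (F.CoordRing k L.1)), L.1 ⊆ I.1 ∧ L.1 ⊆ J.1 ∧
      F.openChart k L w = F.openChart k I y := by
  obtain ⟨L, f, g, w, hw, hw'⟩ := (Scheme.IsLocallyDirected.ι_eq_ι_iff (F.diagram k)).1 h
  refine ⟨L, w, leOfHom f, leOfHom g, ?_⟩
  have h1 : (F.chartMap k (leOfHom f) ≫ F.ι k I) w = F.ι k L w := by rw [F.chartMap_ι]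
  exact h1.symm.trans ((Scheme.Hom.comp_apply _ _ _).trans (congrArg (F.ι k I) hw))

/-- The chart of the orbit of a point is contained in all charts that contain the point. -/
lemma subset_of_openChart_eq {I J : Cone n} {y : PrimeSpectrum (F.CoordRing k I.1)}
    {z : PrimeSpectrum (F.CoordRing k J.1)}
    (hy : ∀ m : F.dualCone I.1, (m : Fin n → ℤ) ∉ F.perp I.1 →
      AddMonoidAlgebra.single m 1 ∈ y.asIdeal)
    (h : F.openChart k I y = F.openChart k J z) : I.1 ⊆ J.1 := by
  obtain ⟨L, w, hLI, hLJ, hw⟩ := F.exists_openChart_inter k h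
  refine Finset.Subset.trans (fun i hi => ?_) hLJ
  by_contra hiL
  obtain ⟨m, h0, hpos⟩ := F.exists_supporting hLI
  have h1 := hy m fun h => (hpos i hi hiL).ne' (h i hi)
  have hyw : F.chartMap k hLI w = y := (F.ι k I).isOpenEmbedding.injective (by
    have h1 : (F.chartMap k hLI ≫ F.ι k I) w = F.ι k L w := by rw [F.chartMap_ι]
    exact (Scheme.Hom.comp_apply _ _ _).symm.trans (h1.trans hw))
  have h2 : y ∈ Set.range (F.chartMap k hLI) := ⟨w, hyw⟩
  rw [F.range_chartMap k hLI m h0 hpos] at h2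
  exact h2 h1

end FakeWPSFan

/-! ### Prime divisors and the canonical divisor of the toric variety -/

section Lattice
variable {M : Type*} [AddCommGroup M]

/-- A nonzero integral functional is a positive multiple of a surjective one. -/
lemma exists_primitive_functional (φ : M →+ ℤ) (hφ : φ ≠ 0) :
    ∃ (d : ℤ) (ψ : M →+ ℤ), 0 < d ∧ (∀ m, φ m = d * ψ m) ∧ ∃ m, ψ m = 1 := by
  let S : Submodule ℤ ℤ := LinearMap.range φ.toIntLinearMap
  let d : ℤ := |Submodule.IsPrincipal.generator S|
  have hdvd : ∀ m, d ∣ φ m := fun m => by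
    rw [abs_dvd]
    exact (Submodule.IsPrincipal.mem_iff_generator_dvd S).1 ⟨m, rfl⟩
  have hatt : ∃ m, φ m = d := by
    obtain ⟨m, hm⟩ := Submodule.IsPrincipal.generator_mem S
    have hm : φ m = Submodule.IsPrincipal.generator S := hm
    rcases abs_choice (Submodule.IsPrincipal.generator S) with h | h
    · exact ⟨m, hm.trans h.symm⟩
    · exact ⟨-m, by rw [map_neg, hm]; exact h.symm⟩
  have hd : d ≠ 0 := fun h => hφ (AddMonoidHom.ext fun m => by
    have := hdvd m
    rwa [h, zero_dvd_iff] at this)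
  refine ⟨d, AddMonoidHom.mk' (fun m => φ m / d) (fun a b => ?_),
    lt_of_le_of_ne (abs_nonneg _) hd.symm, fun m => ?_, ?_⟩
  · change φ (a + b) / d = φ a / d + φ b / d
    rw [map_add, Int.add_ediv_of_dvd_left (hdvd a)]
  · exact (Int.mul_ediv_cancel' (hdvd m)).symm
  · obtain ⟨m, hm⟩ := hatt
    exact ⟨m, by change φ m / d = 1; rw [hm, Int.ediv_self hd]⟩

/-- The functional on `ℤⁿ` given by the pairing with a vector. -/
def cochar {n : ℕ} (w : Fin n → ℤ) : (Fin n → ℤ) →+ ℤ where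
  toFun m := m ⬝ᵥ w
  map_zero' := zero_dotProduct w
  map_add' a b := add_dotProduct a b w

@[simp] lemma cochar_apply {n : ℕ} (w m : Fin n → ℤ) : cochar w m = m ⬝ᵥ w := rfl

lemma cochar_ne_zero {n : ℕ} {w : Fin n → ℤ} (hw : w ≠ 0) : cochar w ≠ 0 := fun h => hw (by
  ext j
  have := DFunLike.congr_fun h (Pi.single j 1)
  simpa using this)

lemma exists_eq_cochar {n : ℕ} (ψ : (Fin n → ℤ) →+ ℤ) : ∃ w, ψ = cochar w := by
  refine ⟨fun j => ψ (Pi.single j 1), ?_⟩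
  ext j
  simp

end Lattice

section InitialForm
variable {k : Type*} [Field k] {M : Type*} [AddCommGroup M] {S : AddSubmonoid M} {u : M →+ ℤ}
  (h : S ≤ halfSpace u)

variable (k) in
/-- The initial form of an element of `k[S]`, for a monoid `S` of lattice points of nonnegative
weight. -/
noncomputable def initialFormOn : AddMonoidAlgebra k S →ₐ[k] AddMonoidAlgebra k M :=
  (initialForm u).comp (AddMonoidAlgebra.mapDomainAlgHom k k (AddSubmonoid.inclusion h))

lemma monoidEmb_mapDomain_inclusion (f : AddMonoidAlgebra k S) :
    monoidEmb k (halfSpace u) (AddMonoidAlgebra.mapDomainAlgHom k k (AddSubmonoid.inclusion h) f) =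
      monoidEmb k S f := by
  induction f using AddMonoidAlgebra.induction_linear with
  | zero => simp
  | add f g hf hg => simp only [map_add, hf, hg]
  | single m c => simp

lemma coeff_initialFormOn (f : AddMonoidAlgebra k S) (m : M) :
    (initialFormOn k h f).coeff m = if u m = 0 then (monoidEmb k _ f).coeff m else 0 := by
  rw [initialFormOn, AlgHom.comp_apply, coeff_initialForm, monoidEmb_mapDomain_inclusion]

lemma initialFormOn_single (m : S) (c : k) : initialFormOn k h (AddMonoidAlgebra.single m c) =
    if u m = 0 then AddMonoidAlgebra.single (m : M) c else 0 := by
  rw [initialFormOn, AlgHom.comp_apply, AddMonoidAlgebra.mapDomainAlgHom_apply,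
    AddMonoidAlgebra.mapDomain_single, initialForm_single]
  rfl

variable {K : Type*} [Field K] [Algebra k K] {Φ : AddMonoidAlgebra k M →ₐ[k] K}
  {A : Type*} [CommRing A] [Algebra k A] {α : A →ₐ[k] AddMonoidAlgebra k (halfSpace u)}
  {β : A →ₐ[k] AddMonoidAlgebra k M} (hα : ∀ f, monoidEmb k _ (α f) = β f)
include hα

/-- Fractions, the denominators of which have nonzero initial form, belong to the toric valuation
ring. -/
lemma fracSubalgebra_le_toricRing (hΦ : IsFractionMap Φ) {T : Submonoid A}
    (hT : ∀ s ∈ T, initialForm u (α s) ≠ 0) : fracSubalgebra (Φ.comp β) T ≤ toricRing Φ u := by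
  rintro x ⟨a, s, hs, hx⟩
  refine (mem_toricRing_iff hΦ u).2 ⟨α a, α s, hT s hs, ?_⟩
  rw [hα, hα]
  exact hx

/-- The toric valuation ring dominates the localization at the ideal of the functions with vanishing
initial form. -/
lemma inv_mem_fracSubalgebra_of_inv_mem_toricRing (hΦ : IsFractionMap Φ) {T : Submonoid A}
    (hT : ∀ s, s ∈ T ↔ initialForm u (α s) ≠ 0) {x : K}
    (hx : x ∈ fracSubalgebra (Φ.comp β) T) (hxi : x⁻¹ ∈ toricRing Φ u) :
    x⁻¹ ∈ fracSubalgebra (Φ.comp β) T := by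
  have := hΦ.isDomain
  by_cases hx0 : x = 0
  · rw [hx0, inv_zero]; exact Subalgebra.zero_mem _
  obtain ⟨a, s, hs, hxa⟩ := hx
  obtain ⟨p, r, hr, hp⟩ := (mem_toricRing_iff hΦ u).1 hxi
  have ha : initialForm u (α a) ≠ 0 := by
    intro ha
    have h1 : Φ (β a) * Φ (monoidEmb k _ p) = Φ (β s) * Φ (monoidEmb k _ r) := by
      have hxa : x * Φ (β s) = Φ (β a) := hxa
      rw [← hxa, ← hp]
      field_simp
    rw [← hα, ← hα, ← map_mul, ← map_mul, ← map_mul, ← map_mul] at h1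
    have h2 := congrArg (initialForm u) (monoidEmb_injective _ (hΦ.injective h1))
    rw [map_mul, map_mul, ha, zero_mul] at h2
    exact mul_ne_zero ((hT s).1 hs) hr h2.symm
  refine ⟨s, a, (hT a).2 ha, ?_⟩
  rw [← hxa]
  field_simp

end InitialForm

namespace FakeWPSFan
variable {n : ℕ} (F : FakeWPSFan n) (k : Type u) [Field k]

lemma v_ne_zero (i : Fin (n + 1)) : F.v i ≠ 0 := fun h => by
  have := F.primitive i 0 0 (by rw [h, smul_zero])
  simp at this

lemma exists_dotProduct_v_eq_one (i : Fin (n + 1)) : ∃ m, cochar (F.v i) m = 1 := by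
  obtain ⟨d, ψ, hd, hψ, m, hm⟩ := exists_primitive_functional _ (cochar_ne_zero (F.v_ne_zero i))
  obtain ⟨w, rfl⟩ := exists_eq_cochar ψ
  have hv : F.v i = d • w := by
    ext j
    have := hψ (Pi.single j 1)
    simpa using this
  have h1 : d = 1 := (Int.isUnit_iff.1 (F.primitive i d w hv)).resolve_right (by omega)
  refine ⟨m, ?_⟩
  rw [hψ, hm, h1, one_mul]

variable {k} in
/-- If the functions of positive weight vanish at a point of the chart, then the toric valuation is
nonnegative on the local ring of the point. -/
lemma localRing_le_toricRing {I : Cone n} {y : PrimeSpectrum (F.CoordRing k I.1)}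
    {u : (Fin n → ℤ) →+ ℤ} (hu : F.dualCone I.1 ≤ halfSpace u)
    (hy : ∀ m : F.dualCone I.1, 0 < u m → AddMonoidAlgebra.single m 1 ∈ y.asIdeal) :
    localRing k (F.openChart k I y) ≤ toricRing (F.laurent k) u := by
  rw [localRing_openChart, ← laurent_comp_monoidEmb]
  refine fracSubalgebra_le_toricRing (monoidEmb_mapDomain_inclusion hu)
    (F.isFractionMap_laurent k) fun s hs h0 => hs ?_
  rw [← AddMonoidAlgebra.sum_coeff_single s]
  refine Ideal.sum_mem _ fun m _ => ?_
  have h1 : s.coeff m = 0 ∨ 0 < u m := by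
    by_cases hm : u m = 0
    · left
      have : (initialFormOn k hu s).coeff m = 0 :=
        congrArg (fun f : AddMonoidAlgebra k (Fin n → ℤ) => f.coeff m) h0
      simpa [coeff_initialFormOn, hm, coeff_monoidEmb] using this
    · exact Or.inr (lt_of_le_of_ne (hu m.2) (Ne.symm hm))
  rcases h1 with h1 | h1
  · rw [h1]; simp
  · have h2 : AddMonoidAlgebra.single m (s.coeff m) =
        AddMonoidAlgebra.single (0 : F.dualCone I.1) (s.coeff m) * AddMonoidAlgebra.single m 1 := by
      rw [AddMonoidAlgebra.single_mul_single, zero_add, mul_one]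
    rw [h2]
    exact Ideal.mul_mem_left _ _ (hy m h1)

/-- The toric valuation given by `u` has a center on `W` in the chart of every cone that
contains `u`. -/
lemma exists_isCenter_toricRing {I : Cone n} {u : (Fin n → ℤ) →+ ℤ}
    (hu : F.dualCone I.1 ≤ halfSpace u) :
    ∃ y : PrimeSpectrum (F.CoordRing k I.1),
      IsCenter k (toricRing (F.laurent k) u) (F.openChart k I y) := by
  have hdom := (F.isFractionMap_laurent k).isDomain
  let y : PrimeSpectrum (F.CoordRing k I.1) :=
    ⟨RingHom.ker (initialFormOn k hu).toRingHom, RingHom.ker_isPrime _⟩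
  refine ⟨y, F.localRing_le_toricRing hu fun m hm => ?_, fun a ha hai => ?_⟩
  · change initialFormOn k hu _ = 0
    rw [initialFormOn_single, if_neg hm.ne']
  · rw [localRing_openChart, ← laurent_comp_monoidEmb] at ha ⊢
    exact inv_mem_fracSubalgebra_of_inv_mem_toricRing (monoidEmb_mapDomain_inclusion hu)
      (F.isFractionMap_laurent k)
      (fun s => Iff.rfl) ha hai

variable {k} in
lemma isFractionRing_localRing (x : F.toricVariety k) :
    IsFractionRing (localRing k x) (F.toricVariety k).functionField := by
  have hsurj : Function.Surjective (fun c : (F.toricVariety k).presheaf.stalk x =>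
      (⟨algebraMap _ (F.toricVariety k).functionField c, c, rfl⟩ : localRing k x)) := by
    rintro ⟨_, c, rfl⟩
    exact ⟨c, rfl⟩
  refine ⟨fun y => ?_, fun z => ?_, fun {x y} h => ⟨1, by simpa using h⟩⟩
  · have : ((y : localRing k x) : (F.toricVariety k).functionField) ≠ 0 :=
      fun h => nonZeroDivisors.ne_zero y.2 (Subtype.ext h)
    exact isUnit_iff_ne_zero.2 this
  · obtain ⟨a, b, hb, hz⟩ := IsFractionRing.div_surjective
      (A := (F.toricVariety k).presheaf.stalk x) z
    have hb0 : algebraMap _ (F.toricVariety k).functionField b ≠ 0 := fun h =>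
      nonZeroDivisors.ne_zero hb (IsFractionRing.injective _ (F.toricVariety k).functionField
        (h.trans (map_zero _).symm))
    refine ⟨⟨⟨_, a, rfl⟩, ⟨⟨_, b, rfl⟩, mem_nonZeroDivisors_of_ne_zero fun h =>
      hb0 (congrArg Subtype.val h)⟩⟩, ?_⟩
    change z * algebraMap _ (F.toricVariety k).functionField b =
      algebraMap _ (F.toricVariety k).functionField a
    rw [← hz, div_mul_cancel₀ _ hb0]

variable {k} in
lemma IsPrimeDivisorPoint.localRing_eq_toricRing {x : F.toricVariety k}
    (hx : IsPrimeDivisorPoint k x) {u : (Fin n → ℤ) →+ ℤ} {m₀ : Fin n → ℤ} (h₀ : u m₀ = 1)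
    (h : localRing k x ≤ toricRing (F.laurent k) u) :
    localRing k x = toricRing (F.laurent k) u := by
  have : IsDiscreteValuationRing (localRing k x) := hx
  have := F.isFractionRing_localRing x
  exact eq_of_le_of_isDiscreteValuationRing h
    (toricRing_ne_top (F.isFractionMap_laurent k) (m := m₀) (by omega))

variable {k} in
lemma localRing_eq_toricRing_of_mem {I : Cone n} {y : PrimeSpectrum (F.CoordRing k I.1)}
    (hy : ∀ m : F.dualCone I.1, (m : Fin n → ℤ) ∉ F.perp I.1 →
      AddMonoidAlgebra.single m 1 ∈ y.asIdeal)
    (hx : IsPrimeDivisorPoint k (F.openChart k I y)) {i : Fin (n + 1)} (hi : i ∈ I.1) :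
    localRing k (F.openChart k I y) = toricRing (F.laurent k) (cochar (F.v i)) := by
  obtain ⟨m₀, h₀⟩ := F.exists_dotProduct_v_eq_one i
  exact IsPrimeDivisorPoint.localRing_eq_toricRing F hx h₀
    (F.localRing_le_toricRing (fun m hm => hm i hi) fun m hm =>
      hy m fun hp => hm.ne' (hp i hi))

open Classical in
/-- The toric canonical divisor: minus the sum of the torus invariant prime divisors. -/
noncomputable def canonicalDivisor (x : F.toricVariety k) : ℤ :=
  if x ∈ Set.range (F.openChart k (zeroCone n)) then 0 else -1

lemma canonicalDivisor_eq_neg_one {I : Cone n} {y : PrimeSpectrum (F.CoordRing k I.1)}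
    (hy : ∀ m : F.dualCone I.1, (m : Fin n → ℤ) ∉ F.perp I.1 →
      AddMonoidAlgebra.single m 1 ∈ y.asIdeal) {i : Fin (n + 1)} (hi : i ∈ I.1) :
    F.canonicalDivisor k (F.openChart k I y) = -1 := by
  refine if_neg ?_
  rintro ⟨z, hz⟩
  have := F.subset_of_openChart_eq k (J := zeroCone n) (z := z) hy hz.symm hi
  simp [zeroCone] at this

lemma canonicalDivisor_eq_zero {I : Cone n} {y : PrimeSpectrum (F.CoordRing k I.1)}
    (hI : I.1 = ∅) : F.canonicalDivisor k (F.openChart k I y) = 0 := by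
  obtain rfl : I = zeroCone n := Subtype.ext hI
  exact if_pos ⟨y, rfl⟩

lemma exists_monoidEmb_zeroCone (f : AddMonoidAlgebra k (Fin n → ℤ)) :
    ∃ g, monoidEmb k (F.dualCone (zeroCone n).1) g = f :=
  exists_monoidEmb_eq _ f fun m _ => by simp [zeroCone, dualCone]

lemma laurent_mem_localRing {y : PrimeSpectrum (F.CoordRing k (zeroCone n).1)}
    (f : AddMonoidAlgebra k (Fin n → ℤ)) :
    F.laurent k f ∈ localRing k (F.openChart k (zeroCone n) y) := by
  obtain ⟨g, rfl⟩ := F.exists_monoidEmb_zeroCone k f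
  rw [laurent_monoidEmb]
  exact F.chartFun_mem_localRing y g

/-- The rational form `dx₁/x₁ ∧ … ∧ dxₙ/xₙ` on `W`. -/
noncomputable abbrev toricForm :
    ⋀[(F.toricVariety k).functionField]^n (Ω[(F.toricVariety k).functionField⁄k]) :=
  logForm (F.laurent k) (Pi.basisFun ℤ (Fin n))

lemma hasFormOrd_toricForm {u : (Fin n → ℤ) →+ ℤ} {m₀ : Fin n → ℤ} (h₀ : u m₀ = 1) :
    HasFormOrd (toricRing (F.laurent k) u) (F.toricForm k) (-1) := by
  obtain ⟨_, _, _, b', i₀, h1, h2⟩ := exists_adapted_basis (Pi.basisFun ℤ (Fin n)) u h₀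
  exact hasFormOrd_logForm_toricRing (F.isFractionMap_laurent k) b' _ i₀ h1 h2

/-- The divisor of `dx₁/x₁ ∧ … ∧ dxₙ/xₙ` is minus the boundary of the torus: the form has neither
zeros nor poles on the torus, and the local ring of a boundary divisor is the toric valuation ring
of a ray, along which the form has a simple pole. -/
lemma isDivisorOfForm_canonicalDivisor :
    IsDivisorOfForm k (F.toricForm k) (F.canonicalDivisor k) := by
  intro x hx
  obtain ⟨I, y, rfl, hy⟩ := F.exists_minimal_openChart k x
  rcases I.1.eq_empty_or_nonempty with hI | ⟨i, hi⟩
  · obtain rfl : I = zeroCone n := Subtype.ext hI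
    rw [F.canonicalDivisor_eq_zero k rfl]
    have : IsDiscreteValuationRing (localRing k (F.openChart k (zeroCone n) y)) := hx
    refine hasFormOrd_logForm_zero (F.isFractionMap_laurent k) _
      (F.laurent_mem_localRing k) fun z hz => ?_
    rw [localRing_openChart] at hz
    obtain ⟨a, b, hb, hab⟩ := hz
    refine ⟨monoidEmb k _ a, monoidEmb k _ b, ?_, ?_, ?_⟩
    · rw [Ne, map_eq_zero_iff _ (monoidEmb_injective _)]
      rintro rfl
      exact hb (Ideal.zero_mem _)
    · rw [laurent_monoidEmb]
      exact F.chartFun_inv_mem_localRing hb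
    · rw [laurent_monoidEmb, laurent_monoidEmb]
      exact hab
  · rw [F.canonicalDivisor_eq_neg_one k hy hi, F.localRing_eq_toricRing_of_mem hy hx hi]
    exact F.hasFormOrd_toricForm k (F.exists_dotProduct_v_eq_one i).choose_spec

lemma toricForm_ne_zero : F.toricForm k ≠ 0 := logForm_ne_zero (F.isFractionMap_laurent k) _

lemma isCanonicalDivisor_canonicalDivisor : IsCanonicalDivisor k n (F.canonicalDivisor k) :=
  ⟨_, F.toricForm_ne_zero k, F.isDivisorOfForm_canonicalDivisor k⟩

/-- A monomial which has the same weight on all rays of a cone is an equation of a multiple of the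
canonical divisor on the chart of the cone. -/
lemma isLocalEquation_laurent_single {I : Cone n} (y : PrimeSpectrum (F.CoordRing k I.1)) {c : ℤ}
    {m : Fin n → ℤ} (hm : ∀ i ∈ I.1, m ⬝ᵥ F.v i = -c) {D : F.toricVariety k → ℤ}
    (hD : ∀ x, D x = c * F.canonicalDivisor k x) :
    IsLocalEquation k D (F.openChart k I y) (F.laurent k (AddMonoidAlgebra.single m 1)) := by
  refine ⟨map_single_ne_zero _ m, (F.openChart k I).opensRange, ⟨y, rfl⟩, ?_⟩
  rintro x ⟨z', hz'⟩ hx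
  obtain ⟨L, z, rfl, hz⟩ := F.exists_minimal_openChart k x
  rw [hD]
  rcases L.1.eq_empty_or_nonempty with hL | ⟨i, hi⟩
  · obtain rfl : L = zeroCone n := Subtype.ext hL
    rw [F.canonicalDivisor_eq_zero k rfl, mul_zero]
    have : IsDiscreteValuationRing (localRing k (F.openChart k (zeroCone n) z)) := hx
    obtain ⟨p, hp⟩ := IsDiscreteValuationRing.exists_irreducible
      (localRing k (F.openChart k (zeroCone n) z))
    refine ⟨p, ⟨_, F.laurent_mem_localRing k _⟩, hp,
      (isUnit_subalgebra_iff _ (map_single_ne_zero _ m)).2 ?_, by simp⟩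
    rw [← map_single_neg]
    exact F.laurent_mem_localRing k _
  · rw [F.canonicalDivisor_eq_neg_one k hz hi, F.localRing_eq_toricRing_of_mem hz hx hi,
      mul_neg_one, ← hm i (F.subset_of_openChart_eq k hz hz'.symm hi)]
    exact hasOrd_toricRing (F.isFractionMap_laurent k) (F.exists_dotProduct_v_eq_one i).choose_spec
      m 1 one_ne_zero

/-- On each cone, a linear functional with value `1` on the rays is rational. With a common
denominator `N` of these functionals, `N K_W` is a Cartier divisor. -/
lemma exists_uniform_weight : ∃ N : ℤ, 0 < N ∧ ∀ I : Cone n, ∃ m : Fin n → ℤ,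
    ∀ i ∈ I.1, m ⬝ᵥ F.v i = N := by
  classical
  have key : ∀ I : Cone n, ∃ N : ℤ, 0 < N ∧ ∃ m : Fin n → ℤ, ∀ i ∈ I.1, m ⬝ᵥ F.v i = N := by
    intro I
    have : ∀ j, ∃ m : Fin n → ℤ, j ∈ I.1 →
        ((∀ i ∈ I.1, i ≠ j → m ⬝ᵥ F.v i = 0) ∧ 0 < m ⬝ᵥ F.v j) := fun j => by
      by_cases hj : j ∈ I.1
      · obtain ⟨m, hm⟩ := F.exists_dual I.1 I.2 j hj
        exact ⟨m, fun _ => hm⟩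
      · exact ⟨0, fun h => absurd h hj⟩
    choose m hm using this
    refine ⟨∏ j ∈ I.1, m j ⬝ᵥ F.v j, Finset.prod_pos fun j hj => (hm j hj).2,
      ∑ j ∈ I.1, (∏ l ∈ I.1.erase j, m l ⬝ᵥ F.v l) • m j, fun i hi => ?_⟩
    rw [sum_dotProduct, Finset.sum_eq_single_of_mem i hi, smul_dotProduct, smul_eq_mul,
      Finset.prod_erase_mul _ _ hi]
    intro j hj hji
    rw [smul_dotProduct, (hm j hj).1 i hi hji.symm, smul_zero]
  choose N hN m hm using key
  refine ⟨∏ I, N I, Finset.prod_pos fun I _ => hN I, fun I =>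
    ⟨(∏ L ∈ Finset.univ.erase I, N L) • m I, fun i hi => ?_⟩⟩
  rw [smul_dotProduct, hm I i hi, smul_eq_mul, Finset.prod_erase_mul _ _ (Finset.mem_univ I)]

/-- If `W` is terminal, then no nonzero lattice vector `w = ∑ qᵢ vᵢ` in a cone has `∑ qᵢ < 1`:
the toric valuation of the primitive vector on its ray would be an exceptional divisor with
discrepancy at most `0`. -/
lemma eq_zero_of_isTerminal (hT : IsTerminal k (F.toricVariety k) n) (I : Cone n)
    (w : Fin n → ℤ) (q : Fin (n + 1) → ℚ) (hq : ∀ i ∈ I.1, 0 ≤ q i)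
    (hw : ∀ m : Fin n → ℤ, ((m ⬝ᵥ w : ℤ) : ℚ) = ∑ i ∈ I.1, q i * (m ⬝ᵥ F.v i : ℤ))
    (hsum : ∑ i ∈ I.1, q i < 1) : w = 0 := by
  by_contra hw0
  obtain ⟨d, u, hd, hu, m₀, h₀⟩ := exists_primitive_functional _ (cochar_ne_zero hw0)
  have hdq : (0 : ℚ) < d := by exact_mod_cast hd
  have huq : ∀ m, (d : ℚ) * (u m : ℚ) = ∑ i ∈ I.1, q i * (m ⬝ᵥ F.v i : ℤ) := fun m => by
    rw [← hw, ← cochar_apply, hu]; push_cast; rfl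
  have hle : F.dualCone I.1 ≤ halfSpace u := fun m hm => by
    have h1 : (0 : ℚ) ≤ d * u m := by
      rw [huq]
      exact Finset.sum_nonneg fun i hi => mul_nonneg (hq i hi) (by exact_mod_cast hm i hi)
    have h2 : (0 : ℚ) ≤ u m := nonneg_of_mul_nonneg_right h1 hdq
    change 0 ≤ u m
    exact_mod_cast h2
  have hΦ := F.isFractionMap_laurent k
  obtain ⟨y, hy⟩ := F.exists_isCenter_toricRing k hle
  have hdvr := isDiscreteValuationRing_toricRing hΦ h₀
  have hfr := isFractionRing_toricRing hΦ h₀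
  obtain ⟨N, hN, hm⟩ := F.exists_uniform_weight
  obtain ⟨m, hm⟩ := hm I
  have hNq : (0 : ℚ) < N := by exact_mod_cast hN
  have hum : (d : ℚ) * (u m : ℚ) = N * ∑ i ∈ I.1, q i := by
    rw [huq, Finset.mul_sum]
    exact Finset.sum_congr rfl fun i hi => by rw [hm i hi, mul_comm]
  have hum1 : u m < N := by
    have h1 : (d : ℚ) * (u m : ℚ) < d * N := by
      have hd1 : (1 : ℚ) ≤ d := by exact_mod_cast hd
      rw [hum]
      nlinarith
    exact_mod_cast lt_of_mul_lt_mul_left h1 hdq.le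
  have hS : 0 < ∑ i ∈ I.1, q i := by
    rcases (Finset.sum_nonneg hq).lt_or_eq with h | h
    · exact h
    · exfalso
      have h1 : ∀ i ∈ I.1, q i = 0 := (Finset.sum_eq_zero_iff_of_nonneg hq).1 h.symm
      have h2 := huq m₀
      rw [h₀, Finset.sum_eq_zero fun i hi => by rw [h1 i hi, zero_mul]] at h2
      rw [Int.cast_one, mul_one] at h2
      exact hdq.ne' h2
  have hum0 : 0 < u m := by
    have h1 : (0 : ℚ) < d * u m := by rw [hum]; positivity
    exact_mod_cast pos_of_mul_pos_right h1 hdq.le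
  lift N to ℕ using hN.le
  have hloc : IsLocalEquation k (fun z => (N : ℤ) * F.canonicalDivisor k z) (F.openChart k I y)
      (F.laurent k (AddMonoidAlgebra.single (-m) 1)) :=
    F.isLocalEquation_laurent_single k y (fun i hi => by rw [neg_dotProduct, hm i hi]) fun _ => rfl
  have hord := hasOrd_toricRing hΦ h₀ (-m) (1 : k) one_ne_zero
  have hnp : ¬ IsPrimeDivisorPoint k (F.openChart k I y) := by
    intro hp
    have heq := IsPrimeDivisorPoint.localRing_eq_toricRing F hp h₀ hy.1
    obtain ⟨-, U, hxU, hU⟩ := hloc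
    have h1 := hU _ hxU hp
    rw [heq] at h1
    have h2 := hord.unique h1
    rw [map_neg] at h2
    have h2 : -u m = N * F.canonicalDivisor k (F.openChart k I y) := h2
    generalize F.openChart k I y = x at h2
    have h3 : F.canonicalDivisor k x = 0 ∨ F.canonicalDivisor k x = -1 := by
      unfold canonicalDivisor; split_ifs <;> simp
    rcases h3 with h3 | h3 <;> rw [h3] at h2 <;> omega
  obtain ⟨r, c, hr, -⟩ := exists_adapted_basis (Pi.basisFun ℤ (Fin n)) u h₀
  have h := hT.2.2 (F.toricForm k) (F.canonicalDivisor k) (F.toricForm_ne_zero k)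
    (F.isDivisorOfForm_canonicalDivisor k) ⟨toricRing (F.laurent k) u, hdvr, hfr⟩ _
    (by
      change Algebra.trdeg k (IsLocalRing.ResidueField (toricRing (F.laurent k) u)) + 1 = _
      rw [trdeg_residueField_toricRing hΦ c, ← hr]; simp) hy hnp N _ (by omega) hloc _ _
    (F.hasFormOrd_toricForm k h₀) hord
  rw [map_neg] at h
  omega

end FakeWPSFan

/-! ### Valuation rings of the function field of a toric curve -/

section LocalClosure
variable {k K O : Type*} [Field k] [Field K] [Algebra k K] [CommRing O] [Algebra O K]

/-- A valuation ring is local. -/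
lemma isLocalRing_of_forall_mem_or_inv_mem (B : Subalgebra O K) (h : ∀ z : K, z ∈ B ∨ z⁻¹ ∈ B) :
    IsLocalRing B := by
  refine .of_isUnit_or_isUnit_one_sub_self fun a => ?_
  by_cases ha : (a : K) = 0
  · right
    rw [show a = 0 from Subtype.ext ha, sub_zero]
    exact isUnit_one
  by_cases ha1 : 1 - (a : K) = 0
  · left
    rw [show a = 1 from Subtype.ext (sub_eq_zero.1 ha1).symm]
    exact isUnit_one
  rcases h ((a : K) / (1 - a)) with h | h
  · right
    refine IsUnit.of_mul_eq_one ⟨(a : K) / (1 - a) + 1, B.add_mem h B.one_mem⟩ (Subtype.ext ?_)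
    change (1 - (a : K)) * ((a : K) / (1 - a) + 1) = 1
    field_simp
    ring
  · left
    refine IsUnit.of_mul_eq_one ⟨((a : K) / (1 - a))⁻¹ + 1, B.add_mem h B.one_mem⟩ (Subtype.ext ?_)
    change (a : K) * (((a : K) / (1 - a))⁻¹ + 1) = 1
    field_simp
    ring

/-- Elements of `k(s)` in lowest terms. -/
lemma exists_coprime_fraction {s : K} (hs : IsFractionMap (Polynomial.aeval (R := k) s)) (z : K) :
    ∃ p q : Polynomial k, IsCoprime p q ∧ z * Polynomial.aeval s q = Polynomial.aeval s p := by
  obtain ⟨a, b, hb, h⟩ := hs.exists_frac z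
  obtain ⟨g, p, q, hcop, rfl, rfl⟩ : ∃ g p q : Polynomial k, IsCoprime p q ∧
      a = g * p ∧ b = g * q := by
    classical
    let _ := EuclideanDomain.gcdMonoid (Polynomial k)
    obtain ⟨p, q, ha, hb, hcop⟩ := extract_gcd a b
    exact ⟨_, p, q, (gcd_isUnit_iff p q).1 hcop, ha, hb⟩
  refine ⟨p, q, hcop, ?_⟩
  have hg : Polynomial.aeval s g ≠ 0 := fun h0 => hb (by
    rw [hs.injective (h0.trans (map_zero _).symm), zero_mul])
  rw [map_mul, map_mul, mul_left_comm] at h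
  exact mul_left_cancel₀ hg h

/-- Let `K = k(s)`. A local subring which contains `k` and two consecutive powers of `s` is
unibranch: either it contains `s`, and then it is a valuation ring, or `s` lies in all maximal
ideals of its integral closure, which then contains the local ring of the affine line at `0`. -/
lemma isLocalRing_integralClosure [IsLocalRing O] (hO : Function.Injective (algebraMap O K))
    (hk : ∀ c : k, algebraMap k K c ∈ (algebraMap O K).range)
    {s : K} (hs : IsFractionMap (Polynomial.aeval (R := k) s)) {c : ℕ}
    (hc : s ^ c ∈ (algebraMap O K).range) (hc' : s ^ (c + 1) ∈ (algebraMap O K).range) :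
    IsLocalRing (integralClosure O K) := by
  have hle : ∀ z ∈ (algebraMap O K).range, z ∈ integralClosure O K := by
    rintro _ ⟨a, rfl⟩
    exact (integralClosure O K).algebraMap_mem a
  have hpoly : ∀ {S : Subring K}, (∀ c : k, algebraMap k K c ∈ S) → s ∈ S →
      ∀ p : Polynomial k, Polynomial.aeval s p ∈ S := by
    intro S h1 h2 p
    rw [Polynomial.aeval_eq_sum_range]
    exact S.sum_mem fun i _ => by
      rw [Algebra.smul_def]
      exact S.mul_mem (h1 _) (S.pow_mem h2 i)
  refine isLocalRing_of_forall_mem_or_inv_mem _ fun z => ?_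
  by_cases hz0 : z = 0
  · exact Or.inl (hz0 ▸ (integralClosure O K).zero_mem)
  obtain ⟨p, q, hcop, hz⟩ := exists_coprime_fraction hs z
  have hp0 : ∀ {p : Polynomial k}, p ≠ 0 → Polynomial.aeval s p ≠ 0 := fun hp h0 =>
    hp (hs.injective (h0.trans (map_zero _).symm))
  have hq : q ≠ 0 := by
    rintro rfl
    rw [map_zero, mul_zero] at hz
    have := hs.injective ((map_zero _).trans hz)
    rw [← this] at hcop
    exact not_isUnit_zero (isCoprime_self.1 hcop)
  have hp : p ≠ 0 := by
    rintro rfl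
    rw [map_zero] at hz
    exact mul_ne_zero hz0 (hp0 hq) hz
  have hz1 : z = Polynomial.aeval s p * (Polynomial.aeval s q)⁻¹ := by
    rw [← hz, mul_inv_cancel_right₀ (hp0 hq)]
  -- It suffices that the values at `s` of `p` and `q` are integral and one of them is a unit.
  suffices h : ∃ S : Subring K, (∀ x ∈ S, x ∈ integralClosure O K) ∧ Polynomial.aeval s p ∈ S ∧
      Polynomial.aeval s q ∈ S ∧ ((Polynomial.aeval s p)⁻¹ ∈ S ∨ (Polynomial.aeval s q)⁻¹ ∈ S) by
    obtain ⟨S, hS, hpS, hqS, h | h⟩ := h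
    · right
      rw [hz1, mul_inv, inv_inv, mul_comm]
      exact hS _ (S.mul_mem hqS h)
    · left
      rw [hz1]
      exact hS _ (S.mul_mem hpS h)
  have hinv : ∀ a : O, IsUnit a → (algebraMap O K a)⁻¹ ∈ (algebraMap O K).range := by
    rintro _ ⟨v, rfl⟩
    refine ⟨(v⁻¹ : Oˣ), ?_⟩
    refine eq_inv_of_mul_eq_one_left ?_
    rw [← map_mul, Units.inv_mul, map_one]
  obtain ⟨a, ha⟩ := hc
  by_cases hau : IsUnit a
  -- If `s ^ c` is a unit, then `s` lies in `O`, and a Bézout identity for `p` and `q` shows that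
  -- one of their values is a unit of the local ring `O`.
  · have hs0 : s ^ c ≠ 0 := by
      rw [← ha]
      exact fun h => hau.ne_zero (hO (h.trans (map_zero _).symm))
    have hsO : s ∈ (algebraMap O K).range := by
      have h1 := (algebraMap O K).range.mul_mem hc' (hinv a hau)
      rwa [ha, pow_succ', mul_inv_cancel_right₀ hs0] at h1
    refine ⟨(algebraMap O K).range, hle, hpoly hk hsO p, hpoly hk hsO q, ?_⟩
    obtain ⟨e, f, hef⟩ := hcop
    obtain ⟨p', hp'⟩ := hpoly hk hsO p
    obtain ⟨q', hq'⟩ := hpoly hk hsO q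
    obtain ⟨e', he'⟩ := hpoly hk hsO e
    obtain ⟨f', hf'⟩ := hpoly hk hsO f
    have h1 : e' * p' + f' * q' = 1 := by
      apply hO
      rw [map_add, map_mul, map_mul, he', hp', hf', hq', ← map_mul, ← map_mul, ← map_add, hef,
        map_one, map_one]
    rw [← hp', ← hq']
    rcases IsLocalRing.isUnit_or_isUnit_of_add_one h1 with h | h
    · exact Or.inl (hinv _ (isUnit_of_mul_isUnit_right h))
    · exact Or.inr (hinv _ (isUnit_of_mul_isUnit_right h))
  -- Otherwise `s` lies in every maximal ideal of the integral closure, since these lie over the one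
  -- of `O`. So the value of a polynomial with nonzero constant term is a unit of the integral
  -- closure.
  · have hc0 : 0 < c := by
      rw [Nat.pos_iff_ne_zero]
      rintro rfl
      rw [pow_zero, ← map_one (algebraMap O K)] at ha
      exact hau (hO ha ▸ isUnit_one)
    have hsB : s ∈ integralClosure O K := by
      refine IsIntegral.of_pow hc0 ?_
      rw [← ha]
      exact isIntegral_algebraMap
    have hB : ∀ p : Polynomial k, Polynomial.aeval s p ∈ (integralClosure O K).toSubring :=
      hpoly (fun c => hle _ (hk c)) hsB
    have hunit : ∀ p : Polynomial k, p.coeff 0 ≠ 0 →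
        (Polynomial.aeval s p)⁻¹ ∈ (integralClosure O K).toSubring := by
      intro p hp
      let x : integralClosure O K := ⟨_, hB p⟩
      have hx : IsUnit x := by
        by_contra hx
        obtain ⟨M, hM, hxM⟩ := exists_max_ideal_of_mem_nonunits hx
        have hMc := Ideal.isMaximal_comap_of_isIntegral_of_isMaximal (R := O) M
        have haM : a ∈ M.comap (algebraMap O (integralClosure O K)) := by
          rw [IsLocalRing.eq_maximalIdeal hMc]
          exact hau
        have hsM : (⟨s, hsB⟩ : integralClosure O K) ∈ M := by
          refine hM.isPrime.mem_of_pow_mem c ?_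
          convert Ideal.mem_comap.1 haM using 1
          exact Subtype.ext ha.symm
        let y : integralClosure O K := ⟨_, hB p.divX⟩
        let d : integralClosure O K := ⟨_, hle _ (hk (p.coeff 0))⟩
        have hd : d ∈ M := by
          have : x = ⟨s, hsB⟩ * y + d := Subtype.ext (by
            change Polynomial.aeval s p = s * Polynomial.aeval s p.divX + algebraMap k K (p.coeff 0)
            conv_lhs => rw [← Polynomial.X_mul_divX_add p]
            rw [map_add, map_mul, Polynomial.aeval_X, Polynomial.aeval_C])
          rw [this] at hxM
          exact (M.add_mem_iff_right (M.mul_mem_right _ hsM)).1 hxM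
        refine hM.ne_top (Ideal.eq_top_of_isUnit_mem _ hd (IsUnit.of_mul_eq_one
          ⟨_, hle _ (hk (p.coeff 0)⁻¹)⟩ (Subtype.ext ?_)))
        change algebraMap k K _ * algebraMap k K _ = 1
        rw [← map_mul, mul_inv_cancel₀ hp, map_one]
      obtain ⟨v, hv⟩ := hx
      have : (Polynomial.aeval s p)⁻¹ = ((v⁻¹ : (integralClosure O K)ˣ) : integralClosure O K) := by
        refine (eq_inv_of_mul_eq_one_left ?_).symm
        have h1 : (((v : integralClosure O K)) : K) = Polynomial.aeval s p :=
          congrArg Subtype.val hv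
        rw [← h1, ← MulMemClass.coe_mul, Units.inv_mul]
        rfl
      rw [this]
      exact SetLike.coe_mem _
    refine ⟨(integralClosure O K).toSubring, fun _ h => h, hB p, hB q, ?_⟩
    by_contra! hcon
    have h1 : p.coeff 0 = 0 := by by_contra h; exact hcon.1 (hunit p h)
    have h2 : q.coeff 0 = 0 := by by_contra h; exact hcon.2 (hunit q h)
    have := hcop.isUnit_of_dvd' (Polynomial.X_dvd_iff.2 h1) (Polynomial.X_dvd_iff.2 h2)
    exact Polynomial.not_isUnit_X this

end LocalClosure

section ToricLine
open LaurentPolynomial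
variable {k K : Type*} [Field k] [Field K] [Algebra k K] {Φ : AddMonoidAlgebra k ℤ →ₐ[k] K}

/-- The field of fractions of `k[s, s⁻¹]` is also that of `k[s]`. -/
lemma IsFractionMap.aeval (hΦ : IsFractionMap Φ) :
    IsFractionMap (Polynomial.aeval (R := k) (Φ (AddMonoidAlgebra.single 1 1))) := by
  have h1 : ∀ p : Polynomial k, Polynomial.aeval (Φ (AddMonoidAlgebra.single 1 1)) p =
      Φ (Polynomial.toLaurent p) := by
    intro p
    have h : Polynomial.aeval (Φ (AddMonoidAlgebra.single 1 1)) =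
        Φ.comp (Polynomial.toLaurentAlg (R := k)) := by
      ext
      change _ = Φ (Polynomial.toLaurent Polynomial.X)
      rw [Polynomial.toLaurent_X, Polynomial.aeval_X]
      rfl
    exact DFunLike.congr_fun h p
  constructor
  · intro p q hpq
    rw [h1, h1] at hpq
    exact Polynomial.toLaurent_injective (hΦ.injective hpq)
  · intro z
    obtain ⟨a, b, hb, hab⟩ := hΦ.exists_frac z
    obtain ⟨m, p, hp⟩ := LaurentPolynomial.exists_T_pow a
    obtain ⟨l, q, hq⟩ := LaurentPolynomial.exists_T_pow b
    refine ⟨p * Polynomial.X ^ l, q * Polynomial.X ^ m, ?_, ?_⟩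
    · refine mul_ne_zero ?_ (pow_ne_zero _ Polynomial.X_ne_zero)
      rintro rfl
      rw [map_zero] at hq
      have := congrArg (· * (T (-l) : LaurentPolynomial k)) hq
      simp only [zero_mul, mul_assoc, ← T_add, add_neg_cancel, T_zero, mul_one] at this
      exact hb this.symm
    · rw [h1, h1]
      simp only [map_mul, hp, hq]
      rw [← hab, Polynomial.toLaurent_X_pow, Polynomial.toLaurent_X_pow]
      ring

/-- The inverse of the coordinate is also a coordinate of the function field of the torus. -/
lemma IsFractionMap.aeval_neg (hΦ : IsFractionMap Φ) :
    IsFractionMap (Polynomial.aeval (R := k) (Φ (AddMonoidAlgebra.single (-1) 1))) := by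
  have h : IsFractionMap (Φ.comp (LaurentPolynomial.invert (R := k)).toAlgHom) := by
    constructor
    · exact hΦ.injective.comp (LaurentPolynomial.invert (R := k)).injective
    · intro z
      obtain ⟨a, b, hb, hab⟩ := hΦ.exists_frac z
      refine ⟨LaurentPolynomial.invert a, LaurentPolynomial.invert b, ?_, ?_⟩
      · simpa using hb
      · have h2 : ∀ f : LaurentPolynomial k,
            LaurentPolynomial.invert (LaurentPolynomial.invert f) = f :=
          fun f => LaurentPolynomial.involutive_invert f
        change z * Φ (LaurentPolynomial.invert (LaurentPolynomial.invert b)) =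
          Φ (LaurentPolynomial.invert (LaurentPolynomial.invert a))
        rw [h2, h2, hab]
  have h1 : (Φ.comp (LaurentPolynomial.invert (R := k)).toAlgHom) (AddMonoidAlgebra.single 1 1) =
      Φ (AddMonoidAlgebra.single (-1) 1) := by
    change Φ (LaurentPolynomial.invert (T 1)) = _
    rw [LaurentPolynomial.invert_T]
    rfl
  rw [← h1]
  exact h.aeval

end ToricLine

section Domination
variable {k K M : Type*} [Field k] [Field K] [Algebra k K] [AddCommGroup M]
  {Φ : AddMonoidAlgebra k M →ₐ[k] K}

/-- If the functions of positive weight are nonunits of a local ring, and only the constants have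
weight zero, then the local ring contains the toric valuation ring. -/
lemma toricRing_le (hΦ : IsFractionMap Φ) {u : M →+ ℤ} (hu : Function.Injective u)
    {R : Subalgebra k K} [IsLocalRing R]
    (hR : ∀ m, 0 < u m → Φ (AddMonoidAlgebra.single m 1) ∈ R ∧
      (Φ (AddMonoidAlgebra.single m 1))⁻¹ ∉ R) : toricRing Φ u ≤ R := by
  have key : ∀ f : AddMonoidAlgebra k (halfSpace u), ∃ h : Φ (monoidEmb k _ f) ∈ R,
      (⟨_, h⟩ : R) - algebraMap k R (f.coeff 0) ∈ IsLocalRing.maximalIdeal R := by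
    intro f
    induction f using AddMonoidAlgebra.induction_linear with
    | zero =>
      refine ⟨by simp, ?_⟩
      simp only [map_zero, AddMonoidAlgebra.coeff_zero, Finsupp.coe_zero, Pi.zero_apply]
      convert Ideal.zero_mem _
      simp
      rfl
    | add f g hf hg =>
      obtain ⟨hf, hf'⟩ := hf
      obtain ⟨hg, hg'⟩ := hg
      refine ⟨by rw [map_add, map_add]; exact R.add_mem hf hg, ?_⟩
      convert Ideal.add_mem _ hf' hg' using 1
      apply Subtype.ext
      change Φ (monoidEmb k _ (f + g)) - algebraMap k K ((f + g).coeff 0) =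
        (Φ (monoidEmb k _ f) - algebraMap k K (f.coeff 0)) +
          (Φ (monoidEmb k _ g) - algebraMap k K (g.coeff 0))
      rw [AddMonoidAlgebra.coeff_add, Finsupp.add_apply, map_add, map_add, map_add]
      ring
    | single m c =>
      rcases (show 0 ≤ u m from m.2).eq_or_lt with hm | hm
      · obtain rfl : m = 0 := Subtype.ext (hu (hm.symm.trans (map_zero u).symm))
        have h1 : Φ (monoidEmb k (halfSpace u) (AddMonoidAlgebra.single 0 c)) =
            algebraMap k K c := by
          rw [← AlgHom.commutes (Φ.comp (monoidEmb k (halfSpace u)))]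
          rfl
        refine ⟨by rw [h1]; exact R.algebraMap_mem c, ?_⟩
        convert Ideal.zero_mem _
        apply Subtype.ext
        change Φ (monoidEmb k (halfSpace u) (AddMonoidAlgebra.single 0 c)) -
          algebraMap k K ((AddMonoidAlgebra.single (0 : halfSpace u) c).coeff 0) = 0
        rw [h1]
        simp
      · have h1 : Φ (monoidEmb k (halfSpace u) (AddMonoidAlgebra.single m c)) =
            algebraMap k K c * Φ (AddMonoidAlgebra.single (m : M) 1) := by
          rw [← Algebra.smul_def, ← map_smul, monoidEmb_single]
          simp
        have h2 := hR _ hm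
        have h3 : (⟨_, h2.1⟩ : R) ∈ IsLocalRing.maximalIdeal R := fun hun =>
          h2.2 ((isUnit_subalgebra_iff _ (map_single_ne_zero Φ _)).1 hun)
        refine ⟨by rw [h1]; exact R.mul_mem (R.algebraMap_mem c) h2.1, ?_⟩
        have hm0 : m ≠ 0 := by
          rintro rfl
          exact hm.ne' (map_zero u)
        convert Ideal.mul_mem_left _ (algebraMap k R c) h3 using 1
        apply Subtype.ext
        change Φ (monoidEmb k (halfSpace u) (AddMonoidAlgebra.single m c)) -
          algebraMap k K ((AddMonoidAlgebra.single m c).coeff 0) = _ * _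
        rw [h1]
        simp [hm0]
  have hunit : ∀ f : AddMonoidAlgebra k (halfSpace u), initialForm u f ≠ 0 →
      (Φ (monoidEmb k _ f))⁻¹ ∈ R := by
    intro f hf
    obtain ⟨h, h'⟩ := key f
    refine (isUnit_subalgebra_iff (⟨_, h⟩ : R) (map_emb_ne_zero hΦ hf)).1 ?_
    by_contra hn
    have h1 : algebraMap k R (f.coeff 0) ∈ IsLocalRing.maximalIdeal R := by
      have := Ideal.sub_mem _ (show (⟨_, h⟩ : R) ∈ IsLocalRing.maximalIdeal R from hn) h'
      rwa [sub_sub_cancel] at this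
    obtain ⟨m, hm, hm'⟩ := (initialForm_ne_zero_iff u f).1 hf
    obtain rfl : m = 0 := hu (hm.trans (map_zero u).symm)
    have h0 : f.coeff 0 ≠ 0 := by
      rw [← coeff_monoidEmb]
      exact hm'
    exact h1 ((isUnit_iff_ne_zero.2 h0).map (algebraMap k R))
  intro x hx
  obtain ⟨a, b, hb, h⟩ := (mem_toricRing_iff hΦ u).1 hx
  have : x = Φ (monoidEmb k _ a) * (Φ (monoidEmb k _ b))⁻¹ := by
    rw [← h, mul_inv_cancel_right₀ (map_emb_ne_zero hΦ hb)]
  rw [this]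
  exact R.mul_mem (key a).1 (hunit b hb)

end Domination

/-! ### Closures of translates of one-parameter subgroups -/

section Image

/-- The scheme-theoretic image of an integral scheme is integral. -/
lemma isIntegral_image {X Y : Scheme.{u}} (f : X ⟶ Y) [QuasiCompact f] [IsIntegral X] :
    IsIntegral f.image := by
  have hred : IsReduced f.image := by
    refine @isReduced_of_isReduced_stalk _ fun x => ?_
    obtain ⟨U, hU, hxU, -⟩ := exists_isAffineOpen_mem_and_subset (x := f.imageι x)
      (U := ⊤) trivial
    have hV : IsAffineOpen (f.imageι ⁻¹ᵁ U) := hU.preimage f.imageι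
    have := isReduced_of_injective (f.toImage.app (f.imageι ⁻¹ᵁ U)).hom
      (f.toImage_app_injective ⟨U, hU⟩)
    have hx : x ∈ f.imageι ⁻¹ᵁ U := hxU
    let _ := (f.image.presheaf.algebra_section_stalk ⟨x, hx⟩)
    have := hV.isLocalization_stalk ⟨x, hx⟩
    exact isReduced_localizationPreserves (hV.primeIdealOf ⟨x, hx⟩).asIdeal.primeCompl _ ‹_›
  have hirr : IrreducibleSpace f.image := by
    have h1 : IsPreirreducible (Set.univ : Set f.image) := by
      have h2 := (IrreducibleSpace.isIrreducible_univ X).image f.toImage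
        f.toImage.continuous.continuousOn
      rw [Set.image_univ] at h2
      rw [← f.toImage.denseRange.closure_range]
      exact h2.isPreirreducible.closure
    exact { isPreirreducible_univ := h1, toNonempty := ⟨f.toImage (genericPoint X)⟩ }
  exact isIntegral_of_irreducibleSpace_of_isReduced _

end Image

section Rational
variable (k : Type u) [Field k]

instance isNoetherianRing_laurent : IsNoetherianRing (AddMonoidAlgebra k ℤ) :=
  have : Algebra.FiniteType k (AddMonoidAlgebra k ℤ) := inferInstance
  Algebra.FiniteType.isNoetherianRing k _

/-- The punctured affine line is rational. -/
lemma birationalOver_specLaurent :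
    Scheme.BirationalOver (Spec.map (CommRingCat.ofHom (algebraMap k (AddMonoidAlgebra k ℤ))))
      (𝔸(PUnit.{u + 1}; Spec (.of k)) ↘ Spec (.of k)) := by
  let e : MvPolynomial PUnit.{u + 1} k ≃ₐ[k] Polynomial k := MvPolynomial.uniqueAlgEquiv k PUnit
  let f₁ : Spec (.of (AddMonoidAlgebra k ℤ)) ⟶ Spec (.of (Polynomial k)) :=
    Spec.map (CommRingCat.ofHom (Polynomial.toLaurent (R := k)))
  have hf₁ : IsOpenImmersion f₁ := by
    let _ : Algebra (Polynomial k) (AddMonoidAlgebra k ℤ) :=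
      (Polynomial.toLaurent (R := k)).toAlgebra
    have : IsLocalization.Away (Polynomial.X : Polynomial k) (AddMonoidAlgebra k ℤ) :=
      LaurentPolynomial.isLocalization
    exact IsOpenImmersion.of_isLocalization (Polynomial.X : Polynomial k)
  let f₂ : Spec (.of (Polynomial k)) ⟶ Spec (.of (MvPolynomial PUnit.{u + 1} k)) :=
    Spec.map (e.toRingEquiv.toCommRingCatIso.hom)
  have hf₂ : IsIso f₂ := inferInstance
  let f := f₁ ≫ f₂ ≫ (AffineSpace.SpecIso PUnit.{u + 1} (.of k)).inv
  have hirr : IrreducibleSpace 𝔸(PUnit.{u + 1}; Spec (.of k)) :=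
    have : IsIntegral (Spec (.of (MvPolynomial PUnit.{u + 1} k))) := inferInstance
    (AffineSpace.SpecIso PUnit.{u + 1} (.of k)).inv.homeomorph.irreducibleSpace_iff.1 inferInstance
  have hdom : IsDominant f :=
    ⟨(f.isOpenEmbedding.isOpen_range.dense ⟨_, genericPoint _, rfl⟩)⟩
  refine Scheme.Hom.birationalOver f _ _ ?_
  rw [Category.assoc, Category.assoc]
  erw [AffineSpace.SpecIso_inv_over]
  rw [← Spec.map_comp, ← Spec.map_comp]
  congr 1
  refine CommRingCat.hom_ext (RingHom.ext fun c => ?_)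
  change Polynomial.toLaurent (e (MvPolynomial.C c)) = algebraMap k _ c
  have h1 : e (MvPolynomial.C c) = Polynomial.C c := e.commutes c
  rw [h1, Polynomial.toLaurent_C]
  rfl

end Rational

namespace FakeWPSFan
variable {n : ℕ} (F : FakeWPSFan n) (k : Type u) [Field k] {J : Cone n} (l : F.perp J.1 →+ ℤ)
  (t : Multiplicative (F.perp J.1) →* kˣ)

/-- The translate by `t` of the one-parameter subgroup `l` of the torus of `V(σ_J)`. -/
noncomputable def translate : Spec (.of (AddMonoidAlgebra k ℤ)) ⟶ F.toricVariety k :=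
  F.onePS k J l ≫ F.translation k J t ≫ F.orbitι k J

/-- The restriction of functions from the chart of a cone with face `σ_J` to the translate of a
one-parameter subgroup: `χ^m ↦ t(m) s^{l m}` if `m ∈ σ_J^⊥`, and `χ^m ↦ 0` otherwise. -/
noncomputable def restrictTranslate {I : Cone n} (h : J.1 ⊆ I.1) :
    F.CoordRing k I.1 →ₐ[k] AddMonoidAlgebra k ℤ :=
  (AddMonoidAlgebra.mapDomainAlgHom k k l).comp
    ((AddMonoidAlgebra.lift k (AddMonoidAlgebra k (F.perp J.1)) (F.perp J.1)
      { toFun := fun m => AddMonoidAlgebra.single m.toAdd (t m : k)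
        map_one' := by
          rw [t.map_one]
          rfl
        map_mul' := fun a b => by
          rw [AddMonoidAlgebra.single_mul_single, t.map_mul]
          rfl }).comp
    ((AddMonoidAlgebra.lift k (AddMonoidAlgebra k (F.perp J.1)) (F.dualCone J.1)
      (F.orbitChar k J.1)).comp (F.restrictCoord k h)))

lemma specMap_restrictTranslate {I : Cone n} (h : J.1 ⊆ I.1) :
    Spec.map (CommRingCat.ofHom
      (F.restrictTranslate k l t h : F.CoordRing k I.1 →+* AddMonoidAlgebra k ℤ)) ≫
        F.openChart k I = F.translate k l t := by
  let a : AddMonoidAlgebra k (F.perp J.1) →+* AddMonoidAlgebra k ℤ :=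
    (AddMonoidAlgebra.mapDomainAlgHom k k l).toRingHom
  let b : AddMonoidAlgebra k (F.perp J.1) →+* AddMonoidAlgebra k (F.perp J.1) :=
    (AddMonoidAlgebra.lift k (AddMonoidAlgebra k (F.perp J.1)) (F.perp J.1)
      { toFun := fun m => AddMonoidAlgebra.single m.toAdd (t m : k)
        map_one' := by
          rw [t.map_one]
          rfl
        map_mul' := fun a b => by
          rw [AddMonoidAlgebra.single_mul_single, t.map_mul]
          rfl }).toRingHom
  let c : F.CoordRing k J.1 →+* AddMonoidAlgebra k (F.perp J.1) :=
    (AddMonoidAlgebra.lift k (AddMonoidAlgebra k (F.perp J.1)) (F.dualCone J.1)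
      (F.orbitChar k J.1)).toRingHom
  have h1 : F.translate k l t = Spec.map (CommRingCat.ofHom a) ≫ Spec.map (CommRingCat.ofHom b) ≫
    Spec.map (CommRingCat.ofHom c) ≫ F.openChart k J := rfl
  rw [h1, ← F.specMap_restrictCoord k h]
  simp only [← Category.assoc, ← Spec.map_comp, ← CommRingCat.ofHom_comp]
  rfl

lemma restrictTranslate_single_of_mem {I : Cone n} (h : J.1 ⊆ I.1) (m : F.dualCone I.1)
    (hm : (m : Fin n → ℤ) ∈ F.perp J.1) (c : k) :
    F.restrictTranslate k l t h (AddMonoidAlgebra.single m c) =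
      AddMonoidAlgebra.single (l ⟨m, hm⟩) (c * t (Multiplicative.ofAdd ⟨m, hm⟩)) := by
  have hm' : ((Multiplicative.ofAdd (AddSubmonoid.inclusion (F.dualCone_mono h) m)).toAdd :
      Fin n → ℤ) ∈ F.perp J.1 := hm
  simp only [restrictTranslate, AlgHom.comp_apply, restrictCoord_single,
    AddMonoidAlgebra.lift_single, map_smul]
  have h1 : F.orbitChar k J.1
      (Multiplicative.ofAdd (AddSubmonoid.inclusion (F.dualCone_mono h) m)) =
      AddMonoidAlgebra.single ⟨m, hm⟩ 1 := dif_pos hm'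
  rw [h1, AddMonoidAlgebra.lift_single, one_smul, AddMonoidAlgebra.mapDomainAlgHom_apply]
  refine (congrArg (c • ·) AddMonoidAlgebra.mapDomain_single).trans ?_
  exact AddMonoidAlgebra.smul_single _ _ _

lemma restrictTranslate_single_of_not_mem {I : Cone n} (h : J.1 ⊆ I.1) (m : F.dualCone I.1)
    (hm : (m : Fin n → ℤ) ∉ F.perp J.1) (c : k) :
    F.restrictTranslate k l t h (AddMonoidAlgebra.single m c) = 0 := by
  have hm' : ((Multiplicative.ofAdd (AddSubmonoid.inclusion (F.dualCone_mono h) m)).toAdd :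
      Fin n → ℤ) ∉ F.perp J.1 := hm
  simp only [restrictTranslate, AlgHom.comp_apply, restrictCoord_single,
    AddMonoidAlgebra.lift_single, map_smul]
  have h1 : F.orbitChar k J.1
      (Multiplicative.ofAdd (AddSubmonoid.inclusion (F.dualCone_mono h) m)) = 0 := dif_neg hm'
  rw [h1]
  simp

lemma perp_le_dualCone {m : Fin n → ℤ} (hm : m ∈ F.perp J.1) : m ∈ F.dualCone J.1 :=
  fun i hi => (hm i hi).ge

lemma restrictTranslate_surjective {m₁ : F.perp J.1} (hl : l m₁ = 1) :
    Function.Surjective (F.restrictTranslate k l t (Finset.Subset.refl J.1)) := by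
  intro f
  induction f using AddMonoidAlgebra.induction_linear with
  | zero => exact ⟨0, map_zero _⟩
  | add f g hf hg =>
    obtain ⟨a, rfl⟩ := hf
    obtain ⟨b, rfl⟩ := hg
    exact ⟨a + b, map_add _ _ _⟩
  | single e c =>
    have hlm : l (e • m₁) = e := by rw [map_zsmul, hl, smul_eq_mul, mul_one]
    refine ⟨AddMonoidAlgebra.single ⟨_, F.perp_le_dualCone (e • m₁).2⟩
      (c * ((t (Multiplicative.ofAdd (e • m₁)))⁻¹ : kˣ)), ?_⟩
    rw [F.restrictTranslate_single_of_mem k l t _ _ (e • m₁).2]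
    change AddMonoidAlgebra.single (l (e • m₁)) (c * ((t (Multiplicative.ofAdd (e • m₁)))⁻¹ : kˣ) *
      (t (Multiplicative.ofAdd (e • m₁)) : k)) = _
    rw [hlm, mul_assoc, Units.inv_mul, mul_one]

lemma isImmersion_translate {m₁ : F.perp J.1} (hl : l m₁ = 1) :
    IsImmersion (F.translate k l t) := by
  rw [← F.specMap_restrictTranslate k l t (Finset.Subset.refl J.1)]
  have : IsClosedImmersion (Spec.map (CommRingCat.ofHom
      (F.restrictTranslate k l t (Finset.Subset.refl J.1) :
        F.CoordRing k J.1 →+* AddMonoidAlgebra k ℤ))) :=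
    IsClosedImmersion.spec_of_surjective _ (F.restrictTranslate_surjective k l t hl)
  infer_instance

instance : QuasiCompact (F.translate k l t) :=
  have : IsLocallyNoetherian (Spec (.of (AddMonoidAlgebra k ℤ))) := inferInstance
  have : CompactSpace (Spec (.of (AddMonoidAlgebra k ℤ))) := inferInstance
  have : IsNoetherian (Spec (.of (AddMonoidAlgebra k ℤ))) := ⟨⟩
  inferInstance

/-- The closure of the translate of a one-parameter subgroup. -/
noncomputable abbrev curve : Scheme.{u} := (F.translate k l t).image

instance : IsIntegral (F.curve k l t) := isIntegral_image _

noncomputable instance : (F.curve k l t).Over (Spec (.of k)) where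
  hom := (F.translate k l t).imageι ≫ (F.toricVariety k ↘ Spec (.of k))

instance : (F.translate k l t).imageι.IsOver (Spec (.of k)) where
  comp_over := rfl

/-- The dense torus of the curve. -/
noncomputable def curveTorus : Spec (.of (AddMonoidAlgebra k ℤ)) ⟶ F.curve k l t :=
  (F.translate k l t).toImage

lemma curveTorus_imageι : F.curveTorus k l t ≫ (F.translate k l t).imageι = F.translate k l t :=
  Scheme.Hom.toImage_imageι _

lemma curveTorus_over : F.curveTorus k l t ≫ (F.curve k l t ↘ Spec (.of k)) =
    Spec.map (CommRingCat.ofHom (algebraMap k (AddMonoidAlgebra k ℤ))) := by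
  change F.curveTorus k l t ≫ (F.translate k l t).imageι ≫ _ = _
  rw [← Category.assoc, curveTorus_imageι,
    ← F.specMap_restrictTranslate k l t (Finset.Subset.refl J.1),
    Category.assoc, openChart_over, ← Spec.map_comp, ← CommRingCat.ofHom_comp]
  congr 2
  exact (F.restrictTranslate k l t (Finset.Subset.refl J.1)).comp_algebraMap

instance : IsDominant (F.curveTorus k l t) :=
  inferInstanceAs (IsDominant (F.translate k l t).toImage)

lemma isOpenImmersion_curveTorus {m₁ : F.perp J.1} (hl : l m₁ = 1) :
    IsOpenImmersion (F.curveTorus k l t) :=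
  have := F.isImmersion_translate k l t hl
  inferInstanceAs (IsOpenImmersion (F.translate k l t).toImage)

lemma isRationalCurve_curve {m₁ : F.perp J.1} (hl : l m₁ = 1) :
    IsRationalCurve k (F.curve k l t) :=
  have := F.isOpenImmersion_curveTorus k l t hl
  (Scheme.Hom.birationalOver (F.curveTorus k l t) _ _ (F.curveTorus_over k l t)).symm.trans
    (birationalOver_specLaurent k)

lemma range_imageι : Set.range (F.translate k l t).imageι =
    closure (Set.range (F.translate k l t)) := by
  rw [Scheme.IdealSheafData.range_subschemeι, Scheme.Hom.support_ker]

lemma range_imageι_subset : Set.range (F.translate k l t).imageι ⊆ F.orbitClosure k J := by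
  rw [range_imageι]
  refine closure_mono ?_
  rintro _ ⟨x, rfl⟩
  refine ⟨(F.onePS k J l ≫ F.translation k J t) x, ?_⟩
  rw [← Scheme.Hom.comp_apply, Category.assoc]
  rfl

lemma imageι_genericPoint {m₁ : F.perp J.1} (hl : l m₁ = 1) :
    (F.translate k l t).imageι (genericPoint (F.curve k l t)) =
      F.translate k l t (⊥ : PrimeSpectrum (AddMonoidAlgebra k ℤ)) := by
  have := F.isOpenImmersion_curveTorus k l t hl
  have h1 : genericPoint (F.curve k l t) =
      F.curveTorus k l t (⊥ : PrimeSpectrum (AddMonoidAlgebra k ℤ)) :=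
    genericPoint_eq_chart (F.curveTorus k l t)
  rw [h1]
  refine (Scheme.Hom.comp_apply _ _ _).symm.trans ?_
  rw [curveTorus_imageι]

/-- A point of a chart at which all functions vanish that vanish on the translate of the
one-parameter subgroup belongs to the curve. -/
lemma openChart_mem_range_imageι {I : Cone n} (h : J.1 ⊆ I.1)
    {y : PrimeSpectrum (F.CoordRing k I.1)}
    (hy : ∀ f, F.restrictTranslate k l t h f = 0 → f ∈ y.asIdeal) :
    F.openChart k I y ∈ Set.range (F.translate k l t).imageι := by
  have hdom : IsDomain (AddMonoidAlgebra k ℤ) := inferInstance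
  let g : Spec (.of (AddMonoidAlgebra k ℤ)) ⟶ Spec (.of (F.CoordRing k I.1)) :=
    Spec.map (CommRingCat.ofHom
      (F.restrictTranslate k l t h : F.CoordRing k I.1 →+* AddMonoidAlgebra k ℤ))
  let z : Spec (.of (AddMonoidAlgebra k ℤ)) := (⊥ : PrimeSpectrum (AddMonoidAlgebra k ℤ))
  have h1 : g z ⤳ y := by
    refine (PrimeSpectrum.le_iff_specializes _ _).1 ?_
    intro f hf
    exact hy f hf
  have h2 : F.translate k l t z ⤳ F.openChart k I y := by
    have := h1.map (F.openChart k I).continuous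
    rw [← F.specMap_restrictTranslate k l t h]
    exact this
  rw [range_imageι]
  exact h2.mem_closed isClosed_closure (subset_closure ⟨z, rfl⟩)

end FakeWPSFan

section Center
variable {k K A : Type*} [Field k] [Field K] [Algebra k K] [CommRing A] [Algebra k A]

/-- A local ring of `K` that contains the image of `A` dominates a localization of `A`. -/
lemma exists_prime_dominated (φ : A →ₐ[k] K) (R : Subalgebra k K) [IsLocalRing R]
    (hR : ∀ f, φ f ∈ R) : ∃ p : PrimeSpectrum A,
      fracSubalgebra φ p.asIdeal.primeCompl ≤ R ∧
      ∀ a ∈ fracSubalgebra φ p.asIdeal.primeCompl, a⁻¹ ∈ R →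
        a⁻¹ ∈ fracSubalgebra φ p.asIdeal.primeCompl := by
  let ψ : A →ₐ[k] R := φ.codRestrict R hR
  let p : PrimeSpectrum A := PrimeSpectrum.comap ψ.toRingHom (IsLocalRing.closedPoint R)
  have hp : ∀ s, s ∉ p.asIdeal ↔ IsUnit (ψ s) := fun s => by
    change ¬ (ψ s ∈ IsLocalRing.maximalIdeal R) ↔ _
    rw [IsLocalRing.mem_maximalIdeal, mem_nonunits_iff, not_not]
  have hne : ∀ s, s ∉ p.asIdeal → φ s ≠ 0 := fun s hs h0 => ((hp s).1 hs).ne_zero (Subtype.ext h0)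
  have hinv : ∀ s, s ∉ p.asIdeal → (φ s)⁻¹ ∈ R := fun s hs =>
    (isUnit_subalgebra_iff (ψ s) (hne s hs)).1 ((hp s).1 hs)
  have heq : ∀ {x a s}, s ∉ p.asIdeal → x * φ s = φ a → x = φ a * (φ s)⁻¹ := fun hs h => by
    rw [← h, mul_inv_cancel_right₀ (hne _ hs)]
  refine ⟨p, ?_, ?_⟩
  · rintro x ⟨a, s, hs, h⟩
    rw [heq hs h]
    exact R.mul_mem (hR a) (hinv s hs)
  · rintro x ⟨a, s, hs, h⟩ hx
    by_cases hx0 : x = 0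
    · rw [hx0, inv_zero]; exact Subalgebra.zero_mem _
    have ha0 : φ a ≠ 0 := by rw [← h]; exact mul_ne_zero hx0 (hne s hs)
    refine ⟨s, a, ?_, ?_⟩
    · refine (hp a).2 ((isUnit_subalgebra_iff (ψ a) ha0).2 ?_)
      change (φ a)⁻¹ ∈ R
      rw [← h, mul_inv]
      exact R.mul_mem hx (hinv s hs)
    · rw [← h, inv_mul_cancel_left₀ hx0]

/-- A homomorphism to `k[M]` with image in `k[u ≥ 0]` factors through `k[u ≥ 0]`. -/
lemma exists_lift_halfSpace {M : Type*} [AddCommGroup M] {u : M →+ ℤ}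
    (β : A →ₐ[k] AddMonoidAlgebra k M) (h : ∀ f, ∃ g, monoidEmb k (halfSpace u) g = β f) :
    ∃ α : A →ₐ[k] AddMonoidAlgebra k (halfSpace u), ∀ f, monoidEmb k _ (α f) = β f := by
  refine ⟨(AlgEquiv.ofInjective (monoidEmb k (halfSpace u))
    (monoidEmb_injective _)).symm.toAlgHom.comp
    (β.codRestrict (monoidEmb k (halfSpace u)).range h), fun f => ?_⟩
  exact congrArg Subtype.val ((AlgEquiv.ofInjective (monoidEmb k (halfSpace u))
    (monoidEmb_injective _)).apply_symm_apply (β.codRestrict (monoidEmb k (halfSpace u)).range h f))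

end Center

section ToricLine
variable {k K : Type*} [Field k] [Field K] [Algebra k K] {Φ : AddMonoidAlgebra k ℤ →ₐ[k] K}

lemma DVRSubalgebra.ext {R S : DVRSubalgebra k K} (h : R.ring = S.ring) : R = S := by
  cases R; cases S; cases h; rfl

/-- A discrete valuation ring of the function field of the punctured affine line in which the
coordinate, or its inverse, is a nonunit is the toric valuation ring at that end: it
contains the latter by `toricRing_le`, and a discrete valuation ring is a maximal proper subring. -/
lemma eq_toricRing_of_inv_not_mem (hΦ : IsFractionMap Φ) {u : ℤ →+ ℤ} (hu : Function.Injective u)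
    {e : ℤ} (he : u e = 1) (R : DVRSubalgebra k K)
    (h1 : Φ (AddMonoidAlgebra.single e 1) ∈ R.ring)
    (h2 : (Φ (AddMonoidAlgebra.single e 1))⁻¹ ∉ R.ring) : R.ring = toricRing Φ u := by
  have := isDiscreteValuationRing_toricRing hΦ he
  have := isFractionRing_toricRing hΦ he
  refine (eq_of_le_of_isDiscreteValuationRing (toricRing_le hΦ hu fun m hm => ?_) ?_).symm
  · have hme : m = u m • e := hu (by rw [map_zsmul, he, smul_eq_mul, mul_one])
    obtain ⟨d, hd⟩ : ∃ d : ℕ, u m = d + 1 := ⟨(u m - 1).toNat, by omega⟩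
    rw [hme, hd, map_single_zsmul]
    norm_cast
    refine ⟨R.ring.pow_mem h1 _, fun h => h2 ?_⟩
    have h3 : (Φ (AddMonoidAlgebra.single e 1))⁻¹ = (Φ (AddMonoidAlgebra.single e 1) ^ (d + 1))⁻¹ *
        Φ (AddMonoidAlgebra.single e 1) ^ d := by
      have := map_single_ne_zero Φ e
      field_simp
      exact pow_succ' _ _
    rw [h3]
    exact R.ring.mul_mem h (R.ring.pow_mem h1 _)
  · intro h
    exact h2 (h ▸ Algebra.mem_top)

/-- The discrete valuation rings of the function field of the punctured affine line: those of the
two ends, and those with a center on the punctured line. -/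
lemma DVRSubalgebra.toricLine_cases (hΦ : IsFractionMap Φ) (R : DVRSubalgebra k K) :
    R.ring = toricRing Φ (AddMonoidHom.id ℤ) ∨ R.ring = toricRing Φ (-AddMonoidHom.id ℤ) ∨
      ∀ f, Φ f ∈ R.ring := by
  have hinv : (Φ (AddMonoidAlgebra.single 1 1))⁻¹ = Φ (AddMonoidAlgebra.single (-1) 1) :=
    (map_single_neg Φ 1).symm
  have hinv' : (Φ (AddMonoidAlgebra.single (-1) 1))⁻¹ = Φ (AddMonoidAlgebra.single 1 1) := by
    rw [← hinv, inv_inv]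
  by_cases h1 : Φ (AddMonoidAlgebra.single 1 1) ∈ R.ring
  · by_cases h2 : Φ (AddMonoidAlgebra.single (-1) 1) ∈ R.ring
    · right; right
      intro f
      induction f using AddMonoidAlgebra.induction_linear with
      | zero => rw [map_zero]; exact R.ring.zero_mem
      | add f g hf hg => rw [map_add]; exact R.ring.add_mem hf hg
      | single m c =>
        have h3 : AddMonoidAlgebra.single m c =
            c • AddMonoidAlgebra.single (m • (1 : ℤ)) (1 : k) := by
          rw [smul_eq_mul, mul_one, AddMonoidAlgebra.smul_single, smul_eq_mul, mul_one]
        rw [h3, map_smul]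
        refine R.ring.smul_mem ?_ c
        rcases le_total 0 m with hm | hm
        · lift m to ℕ using hm
          rw [map_single_zsmul, zpow_natCast]
          exact R.ring.pow_mem h1 _
        · obtain ⟨d, rfl⟩ : ∃ d : ℕ, m = -d := ⟨(-m).toNat, by omega⟩
          rw [map_single_zsmul, zpow_neg, zpow_natCast, ← inv_pow, hinv]
          exact R.ring.pow_mem h2 _
    · left
      exact eq_toricRing_of_inv_not_mem hΦ (fun a b h => h) (e := 1) rfl R h1 (by rwa [hinv])
  · right; left
    refine eq_toricRing_of_inv_not_mem hΦ (fun a b h => neg_injective h) (e := -1) rfl R ?_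
      (by rwa [hinv'])
    obtain ⟨p, hp⟩ := IsDiscreteValuationRing.exists_irreducible R.ring
    obtain ⟨v, c, hv⟩ := exists_eq_unit_mul_zpow hp _ (map_single_ne_zero Φ (1 : ℤ))
    have hv0 : ((v : R.ring) : K) ≠ 0 := fun h => v.ne_zero (Subtype.ext h)
    have hc : c ≤ 0 := by
      by_contra! hc
      apply h1
      rw [hv]
      lift c to ℕ using hc.le
      rw [zpow_natCast]
      exact R.ring.mul_mem (SetLike.coe_mem _) (R.ring.pow_mem p.2 c)
    obtain ⟨d, rfl⟩ : ∃ d : ℕ, c = -d := ⟨(-c).toNat, by omega⟩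
    rw [← hinv, hv, mul_inv, zpow_neg, inv_inv, zpow_natCast]
    exact R.ring.mul_mem ((isUnit_subalgebra_iff (v : R.ring) hv0).1 v.isUnit)
      (R.ring.pow_mem p.2 d)

end ToricLine

namespace FakeWPSFan
variable {n : ℕ} (F : FakeWPSFan n) (k : Type u) [Field k] {J : Cone n} (l : F.perp J.1 →+ ℤ)
  (t : Multiplicative (F.perp J.1) →* kˣ)

variable {k l t} in
/-- The charts that meet the curve are those of the cones with face `σ_J`. -/
lemma subset_of_imageι_eq [IsOpenImmersion (F.curveTorus k l t)] {x : F.curve k l t} {I : Cone n}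
    (hx : (F.translate k l t).imageι x ∈ Set.range (F.openChart k I)) : J.1 ⊆ I.1 := by
  have h1 : (F.translate k l t).imageι (genericPoint (F.curve k l t)) ∈
      Set.range (F.openChart k I) := mem_range_genericPoint (F.translate k l t).imageι _ hx
  have h2 : genericPoint (F.curve k l t) =
      F.curveTorus k l t (⊥ : PrimeSpectrum (AddMonoidAlgebra k ℤ)) :=
    genericPoint_eq_chart (F.curveTorus k l t)
  obtain ⟨z, hz⟩ := h1
  let g : Spec (.of (AddMonoidAlgebra k ℤ)) ⟶ Spec (.of (F.CoordRing k J.1)) :=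
    Spec.map (CommRingCat.ofHom (F.restrictTranslate k l t (Finset.Subset.refl J.1) :
      F.CoordRing k J.1 →+* AddMonoidAlgebra k ℤ))
  have h3 : (F.translate k l t).imageι (genericPoint (F.curve k l t)) =
      F.openChart k J (g (⊥ : PrimeSpectrum (AddMonoidAlgebra k ℤ))) := by
    rw [h2]
    refine (Scheme.Hom.comp_apply _ _ _).symm.trans ?_
    rw [curveTorus_imageι, ← F.specMap_restrictTranslate k l t (Finset.Subset.refl J.1)]
    exact Scheme.Hom.comp_apply _ _ _
  refine F.subset_of_openChart_eq k
    (y := g (⊥ : PrimeSpectrum (AddMonoidAlgebra k ℤ))) (z := z) (fun m hm => ?_)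
    (h3.symm.trans hz.symm)
  change F.restrictTranslate k l t (Finset.Subset.refl J.1) (AddMonoidAlgebra.single m 1) = 0
  exact F.restrictTranslate_single_of_not_mem k l t _ m hm 1

lemma genericPoint_mem_curveTorus [IsOpenImmersion (F.curveTorus k l t)] :
    (𝟙 (F.curve k l t) : F.curve k l t ⟶ F.curve k l t) (genericPoint (F.curve k l t)) ∈
      Set.range (F.curveTorus k l t) :=
  ⟨_, (genericPoint_eq_chart (F.curveTorus k l t)).symm⟩

/-- The Laurent polynomials in the coordinate of the one-parameter subgroup, as rational functions
on the curve. -/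
noncomputable def curveLaurent [IsOpenImmersion (F.curveTorus k l t)] :
    AddMonoidAlgebra k ℤ →ₐ[k] (F.curve k l t).functionField :=
  chartAlgHom k (𝟙 (F.curve k l t)) (F.curveTorus k l t) (F.curveTorus_over k l t)
    (F.genericPoint_mem_curveTorus k l t)

variable [IsOpenImmersion (F.curveTorus k l t)]

lemma isFractionMap_curveLaurent : IsFractionMap (F.curveLaurent k l t) :=
  isFractionMap_chartAlgHom k (F.curveTorus k l t) (F.curveTorus_over k l t) _

lemma chartAlgHom_imageι {I : Cone n} (h : J.1 ⊆ I.1)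
    (hg : (F.translate k l t).imageι (genericPoint (F.curve k l t)) ∈
      Set.range (F.openChart k I)) :
    chartAlgHom k (F.translate k l t).imageι (F.openChart k I) (F.openChart_over k I) hg =
      (F.curveLaurent k l t).comp (F.restrictTranslate k l t h) :=
  AlgHom.ext fun f => (RingHom.congr_fun (chartHom_comp_of_hom (F.translate k l t).imageι
    (F.openChart k I) (F.curveTorus k l t)
    (F.restrictTranslate k l t h : F.CoordRing k I.1 →+* AddMonoidAlgebra k ℤ)
    ((F.specMap_restrictTranslate k l t h).trans (F.curveTorus_imageι k l t).symm) hg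
    (F.genericPoint_mem_curveTorus k l t)) f).symm

variable {k l t} in
lemma localRing_curve {I : Cone n} (h : J.1 ⊆ I.1) {x : F.curve k l t}
    {y : PrimeSpectrum (F.CoordRing k I.1)}
    (hx : (F.translate k l t).imageι x = F.openChart k I y) :
    localRing k x = fracSubalgebra ((F.curveLaurent k l t).comp (F.restrictTranslate k l t h))
      y.asIdeal.primeCompl := by
  have h1 : (F.translate k l t).imageι x ∈ Set.range (F.openChart k I) := ⟨y, hx.symm⟩
  rw [← F.chartAlgHom_imageι k l t h (mem_range_genericPoint _ _ h1)]
  exact localRing_eq_fracSubalgebra k (F.translate k l t).imageι (F.openChart k I)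
    (F.openChart_over k I) h1 hx

variable {k l t} in
lemma single_mem_localRing {I : Cone n} {x : F.curve k l t}
    (hx : (F.translate k l t).imageι x ∈ Set.range (F.openChart k I)) {m : F.perp J.1}
    (hm : (m : Fin n → ℤ) ∈ F.dualCone I.1) :
    F.curveLaurent k l t (AddMonoidAlgebra.single (l m) 1) ∈ localRing k x := by
  have h := F.subset_of_imageι_eq hx
  obtain ⟨(y : PrimeSpectrum (F.CoordRing k I.1)), hy⟩ := hx
  rw [F.localRing_curve h hy.symm]
  have h1 := map_mem_fracSubalgebra
    ((F.curveLaurent k l t).comp (F.restrictTranslate k l t h)) y.asIdeal.primeCompl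
    (AddMonoidAlgebra.single ⟨m, hm⟩ ((t (Multiplicative.ofAdd m))⁻¹ : kˣ))
  rw [AlgHom.comp_apply, F.restrictTranslate_single_of_mem k l t h _ m.2] at h1
  have h2 : (((t (Multiplicative.ofAdd m))⁻¹ : kˣ) : k) *
    (t (Multiplicative.ofAdd ⟨(m : Fin n → ℤ), m.2⟩) : k) = 1 := Units.inv_mul _
  rw [h2] at h1
  exact h1

variable {l} in
/-- Each chart that meets the curve has functions that restrict to two consecutive powers of the
coordinate: the cocharacter `l` is surjective on `σ_J^⊥`, and adding a large multiple of a
functional that is zero on `σ_J` and positive on the other rays of `σ_I` moves points of `σ_J^⊥` to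
`σ_I^∨`. -/
lemma exists_consecutive {m₁ : F.perp J.1} (hl : l m₁ = 1) {I : Cone n} (h : J.1 ⊆ I.1) :
    ∃ m m' : F.perp J.1, (m : Fin n → ℤ) ∈ F.dualCone I.1 ∧ (m' : Fin n → ℤ) ∈ F.dualCone I.1 ∧
      l m' = l m + 1 := by
  obtain ⟨a, ha0, hapos⟩ := F.exists_supporting h
  let a' : F.perp J.1 := ⟨a, ha0⟩
  let N : ℕ := ∑ i, ((m₁ : Fin n → ℤ) ⬝ᵥ F.v i).natAbs
  refine ⟨N • a', m₁ + N • a', nsmul_mem a.2 N, fun i hi => ?_, ?_⟩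
  · change 0 ≤ ((m₁ : Fin n → ℤ) + N • (a : Fin n → ℤ)) ⬝ᵥ F.v i
    rw [add_dotProduct, smul_dotProduct]
    by_cases hiJ : i ∈ J.1
    · rw [ha0 i hiJ, m₁.2 i hiJ]; simp
    · have h1 := hapos i hi hiJ
      have h2 : ((m₁ : Fin n → ℤ) ⬝ᵥ F.v i).natAbs ≤ N :=
        Finset.single_le_sum (f := fun i => ((m₁ : Fin n → ℤ) ⬝ᵥ F.v i).natAbs)
          (fun _ _ => Nat.zero_le _) (Finset.mem_univ i)
      rw [nsmul_eq_mul]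
      have h3 : (N : ℤ) * 1 ≤ (N : ℤ) * ((a : Fin n → ℤ) ⬝ᵥ F.v i) :=
        mul_le_mul_of_nonneg_left (by omega) (by positivity)
      omega
  · rw [map_add, hl, add_comm]

/-- The curve is unibranch: in the chart of a cone the coordinate ring of the curve contains two
consecutive powers of the coordinate. -/
lemma isUnibranch_curve {m₁ : F.perp J.1} (hl : l m₁ = 1) : IsUnibranch (F.curve k l t) := by
  intro x
  obtain ⟨I, y, hy⟩ := F.exists_openChart_eq k ((F.translate k l t).imageι x)
  have hx : (F.translate k l t).imageι x ∈ Set.range (F.openChart k I) := ⟨y, hy.symm⟩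
  obtain ⟨m, m', hm, hm', hmm'⟩ := F.exists_consecutive hl (F.subset_of_imageι_eq hx)
  have h1 : ∀ c : ℤ, F.curveLaurent k l t (AddMonoidAlgebra.single c 1) =
      F.curveLaurent k l t (AddMonoidAlgebra.single 1 1) ^ c := fun c => by
    rw [← map_single_zsmul, smul_eq_mul, mul_one]
  have h1' : ∀ c : ℤ, F.curveLaurent k l t (AddMonoidAlgebra.single c 1) =
      F.curveLaurent k l t (AddMonoidAlgebra.single (-1) 1) ^ (-c) := fun c => by
    rw [← map_single_zsmul]; simp
  have hk : ∀ c : k, algebraMap k (F.curve k l t).functionField c ∈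
      (algebraMap ((F.curve k l t).presheaf.stalk x) (F.curve k l t).functionField).range :=
    (localRing k x).algebraMap_mem
  have e1 := F.single_mem_localRing hx hm
  have e2 := F.single_mem_localRing hx hm'
  rcases le_or_gt 0 (l m) with h0 | h0
  · obtain ⟨c, hc⟩ := Int.eq_ofNat_of_zero_le h0
    rw [h1, hc, zpow_natCast] at e1
    rw [h1, hmm', hc] at e2
    norm_cast at e2
    exact isLocalRing_integralClosure (IsFractionRing.injective _ _) hk
      (F.isFractionMap_curveLaurent k l t).aeval e1 e2
  · obtain ⟨c, hc⟩ : ∃ c : ℕ, l m = -(c + 1 : ℤ) := ⟨(-(l m) - 1).toNat, by omega⟩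
    rw [h1', hc, neg_neg] at e1
    rw [h1', hmm', hc] at e2
    norm_cast at e1
    rw [show -(-((c : ℤ) + 1) + 1) = c by ring, zpow_natCast] at e2
    exact isLocalRing_integralClosure (IsFractionRing.injective _ _) hk
      (F.isFractionMap_curveLaurent k l t).aeval_neg e2 e1

end FakeWPSFan

/-! ### The intersection number of the curve with the anticanonical divisor -/

namespace FakeWPSFan
variable {n : ℕ} (F : FakeWPSFan n) (k : Type u) [Field k] {J : Cone n} (l : F.perp J.1 →+ ℤ)
  (t : Multiplicative (F.perp J.1) →* kˣ)

lemma restrictTranslate_mem_halfSpace {I : Cone n} (h : J.1 ⊆ I.1) {u : ℤ →+ ℤ}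
    (hu : ∀ m : F.perp J.1, (m : Fin n → ℤ) ∈ F.dualCone I.1 → 0 ≤ u (l m))
    (f : F.CoordRing k I.1) :
    ∃ g, monoidEmb k (halfSpace u) g = F.restrictTranslate k l t h f := by
  induction f using AddMonoidAlgebra.induction_linear with
  | zero => exact ⟨0, by rw [map_zero, map_zero]⟩
  | add f g hf hg =>
    obtain ⟨a, ha⟩ := hf
    obtain ⟨b, hb⟩ := hg
    exact ⟨a + b, by rw [map_add, map_add, ha, hb]⟩
  | single m c =>
    by_cases hm : (m : Fin n → ℤ) ∈ F.perp J.1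
    · exact ⟨AddMonoidAlgebra.single ⟨l ⟨m, hm⟩, hu ⟨m, hm⟩ m.2⟩ _, by
        rw [monoidEmb_single, F.restrictTranslate_single_of_mem k l t h m hm]⟩
    · exact ⟨0, by rw [map_zero, F.restrictTranslate_single_of_not_mem k l t h m hm]⟩

/-- If the one-parameter subgroup has a limit in the chart of the cone `σ_I`, then this limit is the
center of the corresponding end of the curve. -/
lemma exists_isCenter_curve [IsOpenImmersion (F.curveTorus k l t)] {I : Cone n} (h : J.1 ⊆ I.1)
    {u : ℤ →+ ℤ} (hu : ∀ m : F.perp J.1, (m : Fin n → ℤ) ∈ F.dualCone I.1 → 0 ≤ u (l m)) :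
    ∃ x : F.curve k l t, (F.translate k l t).imageι x ∈ Set.range (F.openChart k I) ∧
      IsCenter k (toricRing (F.curveLaurent k l t) u) x := by
  have hΦ := F.isFractionMap_curveLaurent k l t
  have hdom := hΦ.isDomain
  obtain ⟨α, hα⟩ := exists_lift_halfSpace (F.restrictTranslate k l t h)
    (F.restrictTranslate_mem_halfSpace k l t h hu)
  let y : PrimeSpectrum (F.CoordRing k I.1) :=
    ⟨RingHom.ker ((initialForm (k := k) u).comp α).toRingHom, RingHom.ker_isPrime _⟩
  have hy : ∀ f, f ∈ y.asIdeal ↔ initialForm u (α f) = 0 := fun f => Iff.rfl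
  obtain ⟨x, hx⟩ := F.openChart_mem_range_imageι k l t h (y := y) fun f hf => by
    rw [hy,
      (monoidEmb_injective (k := k) (halfSpace u)) ((hα f).trans (hf.trans (map_zero _).symm)),
      map_zero]
  refine ⟨x, ⟨y, hx.symm⟩, ?_⟩
  have := y.isPrime
  have hT : ∀ s, s ∈ y.asIdeal.primeCompl ↔ initialForm u (α s) ≠ 0 := fun s => (hy s).not
  unfold IsCenter
  rw [F.localRing_curve h hx]
  exact ⟨fracSubalgebra_le_toricRing hα hΦ fun s hs => (hT s).1 hs, fun a ha hai =>
    inv_mem_fracSubalgebra_of_inv_mem_toricRing hα hΦ hT ha hai⟩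

lemma sub_mem_perp {N : ℤ} {m : Cone n → Fin n → ℤ} (hm : ∀ I : Cone n, ∀ i ∈ I.1, m I ⬝ᵥ F.v i = N)
    {I I' : Cone n} (h : J.1 ⊆ I.1) (h' : J.1 ⊆ I'.1) : m I - m I' ∈ F.perp J.1 := fun i hi => by
  rw [sub_dotProduct, hm I i (h hi), hm I' i (h' hi), sub_self]

/-- The intersection number of `-K_W` with the curve: a multiple `-N K_W` has equation `χ^{m_I}` on
the chart of `σ_I`, and the degree of its restriction is the difference of the orders of these
monomials at the two ends of the curve. -/
lemma isIntersectionNumber_curve [IsOpenImmersion (F.curveTorus k l t)] {m₁ : F.perp J.1}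
    (hl : l m₁ = 1) {I₀ I₁ : Cone n} (h₀ : J.1 ⊆ I₀.1) (h₁ : J.1 ⊆ I₁.1)
    (hu₀ : ∀ m : F.perp J.1, (m : Fin n → ℤ) ∈ F.dualCone I₀.1 → 0 ≤ l m)
    (hu₁ : ∀ m : F.perp J.1, (m : Fin n → ℤ) ∈ F.dualCone I₁.1 → l m ≤ 0)
    {N : ℕ} (hN : 0 < N) {m : Cone n → Fin n → ℤ}
    (hm : ∀ I : Cone n, ∀ i ∈ I.1, m I ⬝ᵥ F.v i = N) :
    IsIntersectionNumber k (fun x => -F.canonicalDivisor k x) (F.translate k l t).imageι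
      ((l ⟨m I₀ - m I₁, F.sub_mem_perp hm h₀ h₁⟩ : ℚ) / N) := by
  classical
  have hΦ := F.isFractionMap_curveLaurent k l t
  let Ψ := F.curveLaurent k l t
  let i := (F.translate k l t).imageι
  obtain ⟨x₀, hx₀, hc₀⟩ := F.exists_isCenter_curve k l t h₀ (u := AddMonoidHom.id ℤ) hu₀
  obtain ⟨x₁, hx₁, hc₁⟩ := F.exists_isCenter_curve k l t h₁ (u := -AddMonoidHom.id ℤ)
    (fun m hm => neg_nonneg.2 (hu₁ m hm))
  -- The two ends of the curve have different centers.
  have hne : x₀ ≠ x₁ := by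
    rintro rfl
    obtain ⟨a, a', ha, ha', haa⟩ := F.exists_consecutive hl h₀
    have h1 := hu₀ a ha
    exact single_not_mem_toricRing hΦ (-AddMonoidHom.id ℤ) (m := l a') (by
      change -(l a') < 0
      omega) (hc₁.1 (F.single_mem_localRing hx₀ ha'))
  -- Each point of the curve is given a chart; at the two ends it is the one of `I₀` and of `I₁`.
  have hex : ∀ x, ∃ I : Cone n, i x ∈ Set.range (F.openChart k I) ∧ (x = x₀ → I = I₀) ∧
      (x = x₁ → I = I₁) := by
    intro x
    by_cases e0 : x = x₀
    · exact ⟨I₀, e0 ▸ hx₀, fun _ => rfl, fun e1 => absurd (e0.symm.trans e1) hne⟩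
    by_cases e1 : x = x₁
    · exact ⟨I₁, e1 ▸ hx₁, fun e => absurd e e0, fun _ => rfl⟩
    obtain ⟨I, y, hy⟩ := F.exists_openChart_eq k (i x)
    exact ⟨I, ⟨y, hy.symm⟩, fun e => absurd e e0, fun e => absurd e e1⟩
  choose I hI hI₀ hI₁ using hex
  have hJI : ∀ x, J.1 ⊆ (I x).1 := fun x => F.subset_of_imageι_eq (hI x)
  let δ : ∀ {I : Cone n}, J.1 ⊆ I.1 → F.perp J.1 := fun {I} h =>
    ⟨m I - m J, F.sub_mem_perp hm h (Finset.Subset.refl _)⟩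
  have hgen : i (genericPoint (F.curve k l t)) ∈ Set.range (F.openChart k J) :=
    ⟨_, ((F.imageι_genericPoint k l t hl).trans (by
      rw [← F.specMap_restrictTranslate k l t (Finset.Subset.refl J.1)]
      exact Scheme.Hom.comp_apply _ _ _)).symm⟩
  -- On the curve, the local equation at `x` divided by the one at the generic point of the curve is
  -- the unit `g x`, a monomial with exponent in `σ_J^⊥`.
  let mon : F.perp J.1 → F.CoordRing k J.1 := fun a =>
    AddMonoidAlgebra.single ⟨a, F.perp_le_dualCone a.2⟩ 1
  have hmon : ∀ a, IsUnit (mon a) := fun a => IsUnit.of_mul_eq_one (mon (-a)) (by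
    change AddMonoidAlgebra.single _ _ * AddMonoidAlgebra.single _ _ = _
    rw [AddMonoidAlgebra.single_mul_single, AddMonoidAlgebra.one_def, mul_one]
    congr 1
    exact Subtype.ext (add_neg_cancel (a : Fin n → ℤ)))
  let W := F.toricVariety k
  let g : F.curve k l t → W.presheaf.stalk (i (genericPoint (F.curve k l t))) := fun x =>
    chartHom (𝟙 W) (F.openChart k J) (i (genericPoint (F.curve k l t))) hgen (mon (δ (hJI x)))
  have hgK : ∀ x, F.laurent k (AddMonoidAlgebra.single (m J) 1) *
      algebraMap (W.presheaf.stalk (i (genericPoint (F.curve k l t)))) W.functionField (g x) =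
      F.laurent k (AddMonoidAlgebra.single (m (I x)) 1) := by
    intro x
    have e1 : algebraMap (W.presheaf.stalk (i (genericPoint (F.curve k l t)))) W.functionField
        (g x) = F.chartFun k J (mon (δ (hJI x))) :=
      algebraMap_chartHom k (𝟙 W) (F.openChart k J) (F.openChart_over k J) hgen _
    rw [e1]
    refine (congrArg _ (F.chartFun_single k J _ _)).trans ?_
    rw [← map_mul, AddMonoidAlgebra.single_mul_single, mul_one]
    congr 2
    exact add_sub_cancel _ _
  have hgC : ∀ x, i.stalkMap (genericPoint (F.curve k l t)) (g x) =
      Ψ (AddMonoidAlgebra.single (l (δ (hJI x))) (t (Multiplicative.ofAdd (δ (hJI x))) : k)) := by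
    intro x
    have e1 : i.stalkMap (genericPoint (F.curve k l t)) (g x) =
        chartAlgHom k i (F.openChart k J) (F.openChart_over k J) hgen (mon (δ (hJI x))) :=
      RingHom.congr_fun (stalkMap_chartHom i (F.openChart k J) hgen hgen) _
    rw [e1, F.chartAlgHom_imageι k l t (Finset.Subset.refl J.1), AlgHom.comp_apply,
      F.restrictTranslate_single_of_mem k l t _ _ (δ (hJI x)).2, one_mul]
  have hord : ∀ {u : ℤ →+ ℤ} {e : ℤ}, u e = 1 → ∀ x, HasOrd (toricRing Ψ u)
      (i.stalkMap (genericPoint (F.curve k l t)) (g x)) (u (l (δ (hJI x)))) := by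
    intro u e he x
    rw [hgC]
    exact hasOrd_toricRing hΦ he _ _ (Units.ne_zero _)
  have hδ : ∀ {x : F.curve k l t} {I' : Cone n} (e : I x = I') (h : J.1 ⊆ I'.1),
      δ (hJI x) = δ h := by
    rintro x _ rfl _
    rfl
  let R₀ : DVRSubalgebra k (F.curve k l t).functionField := ⟨toricRing Ψ (AddMonoidHom.id ℤ),
    isDiscreteValuationRing_toricRing hΦ (m₀ := 1) rfl, isFractionRing_toricRing hΦ (m₀ := 1) rfl⟩
  let R₁ : DVRSubalgebra k (F.curve k l t).functionField := ⟨toricRing Ψ (-AddMonoidHom.id ℤ),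
    isDiscreteValuationRing_toricRing hΦ (m₀ := -1) rfl, isFractionRing_toricRing hΦ (m₀ := -1) rfl⟩
  have hR : R₀ ≠ R₁ := by
    intro h
    have h1 : toricRing Ψ (AddMonoidHom.id ℤ) = toricRing Ψ (-AddMonoidHom.id ℤ) :=
      congrArg DVRSubalgebra.ring h
    refine single_not_mem_toricRing hΦ (-AddMonoidHom.id ℤ) (m := 1) (by simp) ?_
    rw [show F.curveLaurent k l t = Ψ from rfl, ← h1]
    exact single_mem_toricRing _ Ψ (by simp) 1
  let e : DVRSubalgebra k (F.curve k l t).functionField → ℤ := fun R =>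
    if R = R₀ then l (δ h₀) else if R = R₁ then -l (δ h₁) else 0
  have hsupp : e.support ⊆ ({R₀, R₁} : Finset _) := by
    intro R hR
    rw [Function.mem_support] at hR
    by_contra hn
    rw [Finset.mem_coe, Finset.mem_insert, Finset.mem_singleton, not_or] at hn
    exact hR (by simp only [e]; rw [if_neg hn.1, if_neg hn.2])
  have he₀ : e R₀ = l (δ h₀) := if_pos rfl
  have he₁ : e R₁ = -l (δ h₁) := (if_neg hR.symm).trans (if_pos rfl)
  refine ⟨N, F.laurent k (AddMonoidAlgebra.single (m J) 1), g, e, hN, map_single_ne_zero _ _,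
    fun x => (hmon _).map _, fun x => ?_, fun R => ?_, (Finset.finite_toSet _).subset hsupp, ?_⟩
  · rw [hgK]
    obtain ⟨y, hy⟩ := hI x
    have h1 := F.isLocalEquation_laurent_single k (I := I x) y (c := -N) (m := m (I x))
      (fun j hj => by rw [hm _ _ hj, neg_neg]) (D := fun z => (N : ℤ) * -F.canonicalDivisor k z)
      (fun z => by ring)
    have hy' : F.openChart k (I x) y = (F.translate k l t).imageι x := hy
    rw [hy'] at h1
    exact h1
  · by_cases hR0 : R = R₀
    · subst hR0
      refine ⟨x₀, hc₀, ?_⟩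
      rw [he₀, ← hδ (hI₀ x₀ rfl) h₀]
      exact hord (u := AddMonoidHom.id ℤ) (e := 1) rfl x₀
    by_cases hR1 : R = R₁
    · subst hR1
      refine ⟨x₁, hc₁, ?_⟩
      rw [he₁, ← hδ (hI₁ x₁ rfl) h₁]
      exact hord (u := -AddMonoidHom.id ℤ) (e := -1) rfl x₁
    -- All other valuation rings have their center on the torus, where the monomials are units.
    have hall : ∀ f, Ψ f ∈ R.ring := by
      rcases R.toricLine_cases hΦ with h | h | h
      · exact absurd (DVRSubalgebra.ext h) hR0
      · exact absurd (DVRSubalgebra.ext h) hR1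
      · exact h
    obtain ⟨p, hp⟩ := exists_prime_dominated Ψ R.ring hall
    refine ⟨F.curveTorus k l t p, ?_, ?_⟩
    · have h1 : localRing k (F.curveTorus k l t p) = fracSubalgebra Ψ p.asIdeal.primeCompl :=
        localRing_eq_fracSubalgebra k (𝟙 (F.curve k l t)) (F.curveTorus k l t)
          (F.curveTorus_over k l t) (x := F.curveTorus k l t p) ⟨p, rfl⟩ rfl
      unfold IsCenter
      rw [h1]
      exact hp
    · have he : e R = 0 := (if_neg hR0).trans (if_neg hR1)
      rw [he, hgC]
      obtain ⟨ϖ, hϖ⟩ := IsDiscreteValuationRing.exists_irreducible R.ring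
      have hu : ∀ a : ℤ, ∀ c : kˣ, Ψ (AddMonoidAlgebra.single a (c : k)) *
          Ψ (AddMonoidAlgebra.single (-a) ((c⁻¹ : kˣ) : k)) = 1 := fun a c => by
        rw [← map_mul, AddMonoidAlgebra.single_mul_single, add_neg_cancel, Units.mul_inv,
          ← AddMonoidAlgebra.one_def, map_one]
      exact ⟨ϖ, ⟨_, hall _⟩, hϖ, IsUnit.of_mul_eq_one ⟨_, hall _⟩ (Subtype.ext (hu _ _)),
        by rw [zpow_zero, mul_one]⟩
  · rw [finsum_eq_sum_of_support_subset _ (s := {R₀, R₁}), Finset.sum_pair hR, he₀, he₁]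
    · have := R₀.isDVR.toIsLocalRing
      have := R₁.isDVR.toIsLocalRing
      have : IsLocalRing (toricRing (F.curveLaurent k l t) (AddMonoidHom.id ℤ)) :=
        R₀.isDVR.toIsLocalRing
      have : IsLocalRing (toricRing (F.curveLaurent k l t) (-AddMonoidHom.id ℤ)) :=
        R₁.isDVR.toIsLocalRing
      have f₀ : Module.finrank k (IsLocalRing.ResidueField R₀.ring) = 1 :=
        finrank_residueField_toricRing hΦ (u := AddMonoidHom.id ℤ) fun a b h => h
      have f₁ : Module.finrank k (IsLocalRing.ResidueField R₁.ring) = 1 :=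
        finrank_residueField_toricRing hΦ (u := -AddMonoidHom.id ℤ) fun a b h => neg_injective h
      have hN0 : (N : ℚ) ≠ 0 := by exact_mod_cast hN.ne'
      rw [f₀, f₁, mul_div_cancel₀ _ hN0]
      have h1 : (⟨m I₀ - m I₁, F.sub_mem_perp hm h₀ h₁⟩ : F.perp J.1) = δ h₀ - δ h₁ :=
        Subtype.ext (sub_sub_sub_cancel_right _ _ _).symm
      rw [h1, map_sub]
      push_cast
      ring
    · intro R hR
      apply hsupp
      rw [Function.mem_support] at hR ⊢
      intro h0
      exact hR (by rw [h0]; simp)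

/-! ### Rational points on the curve -/

/-- A rational point in the support of a closed subscheme factors through this subscheme. -/
lemma _root_.exists_lift_of_mem_range {C X : Scheme.{u}} (i : C ⟶ X) [IsClosedImmersion i]
    (P : Spec (.of k) ⟶ X) (h : P (IsLocalRing.closedPoint k) ∈ Set.range i) :
    ∃ P' : Spec (.of k) ⟶ C, P' ≫ i = P := by
  have hsurj : Surjective (Limits.pullback.snd i P) := by
    constructor
    intro x
    obtain ⟨c, hc⟩ := h
    obtain rfl : x = IsLocalRing.closedPoint k := Subsingleton.elim (α := PrimeSpectrum k) _ _
    obtain ⟨z, -, hz⟩ := Scheme.Pullback.exists_preimage_pullback c _ hc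
    exact ⟨z, hz⟩
  have := isIso_of_isClosedImmersion_of_surjective (Limits.pullback.snd i P)
  refine ⟨inv (Limits.pullback.snd i P) ≫ Limits.pullback.fst i P, ?_⟩
  rw [Category.assoc, Limits.pullback.condition, IsIso.inv_hom_id_assoc]

/-- A rational point of `W` in its torus orbit: there is a character `τ` of `σ_I^⊥` such that
`χ^m` has at the point the value `τ(m)` if `m ∈ σ_I^⊥`, and `0` otherwise. -/
lemma exists_character (P : Spec (.of k) ⟶ F.toricVariety k)
    (hP : P ≫ (F.toricVariety k ↘ Spec (.of k)) = 𝟙 (Spec (.of k))) :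
    ∃ (I : Cone n) (ev : F.CoordRing k I.1 →ₐ[k] k) (τ : Multiplicative (F.perp I.1) →* kˣ)
      (y : PrimeSpectrum (F.CoordRing k I.1)),
      P (IsLocalRing.closedPoint k) = F.openChart k I y ∧ (∀ f, f ∈ y.asIdeal ↔ ev f = 0) ∧
      (∀ m : F.dualCone I.1, ∀ hm : (m : Fin n → ℤ) ∈ F.perp I.1,
        ev (AddMonoidAlgebra.single m 1) = τ (Multiplicative.ofAdd ⟨m, hm⟩)) ∧
      ∀ m : F.dualCone I.1, (m : Fin n → ℤ) ∉ F.perp I.1 →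
        ev (AddMonoidAlgebra.single m 1) = 0 := by
  obtain ⟨I, y, hy, hmin⟩ := F.exists_minimal_openChart k (P (IsLocalRing.closedPoint k))
  have hrange : Set.range P ⊆ Set.range (F.openChart k I) := by
    rintro _ ⟨x, rfl⟩
    obtain rfl : x = IsLocalRing.closedPoint k := Subsingleton.elim (α := PrimeSpectrum k) _ _
    exact ⟨y, hy.symm⟩
  let P₀ : Spec (.of k) ⟶ Spec (.of (F.CoordRing k I.1)) :=
    IsOpenImmersion.lift (F.openChart k I) P hrange
  have hP₀ : P₀ ≫ F.openChart k I = P := IsOpenImmersion.lift_fac _ _ _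
  let ψ : F.CoordRing k I.1 →+* k := (Spec.preimage P₀).hom
  have hψ : Spec.map (CommRingCat.ofHom ψ) = P₀ := Spec.map_preimage P₀
  have hψk : ψ.comp (algebraMap k (F.CoordRing k I.1)) = RingHom.id k := by
    have h1 : Spec.map (CommRingCat.ofHom (ψ.comp (algebraMap k (F.CoordRing k I.1)))) =
        Spec.map (CommRingCat.ofHom (RingHom.id k)) := by
      rw [CommRingCat.ofHom_comp, Spec.map_comp, hψ, ← F.openChart_over, ← Category.assoc, hP₀, hP]
      exact (Spec.map_id _).symm
    exact congrArg CommRingCat.Hom.hom (Spec.map_injective h1)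
  let ev : F.CoordRing k I.1 →ₐ[k] k := { ψ with commutes' := fun c => RingHom.congr_fun hψk c }
  have hyev : ∀ f, f ∈ y.asIdeal ↔ ev f = 0 := by
    have h1 : P₀ (IsLocalRing.closedPoint k) = y := by
      apply (F.openChart k I).isOpenEmbedding.injective
      refine (Scheme.Hom.comp_apply _ _ _).symm.trans (Eq.trans ?_ hy)
      rw [hP₀]
    intro f
    rw [← h1, ← hψ]
    change ψ f ∈ IsLocalRing.maximalIdeal k ↔ ψ f = 0
    rw [IsLocalRing.maximalIdeal_eq_bot, Ideal.mem_bot]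
  let mon : Multiplicative (F.perp I.1) →* F.CoordRing k I.1 :=
    { toFun := fun a => AddMonoidAlgebra.single ⟨a.toAdd, F.perp_le_dualCone a.toAdd.2⟩ 1
      map_one' := rfl
      map_mul' := fun a b => by
        rw [AddMonoidAlgebra.single_mul_single, one_mul]
        rfl }
  let τ : Multiplicative (F.perp I.1) →* kˣ :=
    MonoidHom.toHomUnits ((ev : F.CoordRing k I.1 →* k).comp mon)
  exact ⟨I, ev, τ, y, hy, hyev, fun m hm => rfl, fun m hm => (hyev _).1 (hmin m hm)⟩

end FakeWPSFan

/-! ### Fans generated by a lattice basis and minus its sum: projective space -/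

section HomogeneousLocalization
attribute [local instance] MvPolynomial.gradedAlgebra
open HomogeneousLocalization
variable (k : Type u) [Field k] (σ : Type) [Fintype σ] [DecidableEq σ]

/-- The inclusion of the polynomial ring into the ring of Laurent polynomials. -/
noncomputable def toLaurent : MvPolynomial σ k →ₐ[k] AddMonoidAlgebra k (σ → ℤ) :=
  MvPolynomial.aeval fun i => AddMonoidAlgebra.single (Pi.single i 1) 1

variable {σ}

lemma prod_single_one {ι M : Type*} [AddCommMonoid M] (s : Finset ι) (g : ι → M) :
    ∏ i ∈ s, (AddMonoidAlgebra.single (g i) 1 : AddMonoidAlgebra k M) =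
      AddMonoidAlgebra.single (∑ i ∈ s, g i) 1 := by
  classical
  induction s using Finset.induction_on with
  | empty => rfl
  | insert i s hi ih =>
    rw [Finset.prod_insert hi, Finset.sum_insert hi, ih, AddMonoidAlgebra.single_mul_single,
      one_mul]

lemma toLaurent_monomial (s : σ →₀ ℕ) (c : k) : toLaurent k σ (MvPolynomial.monomial s c) =
    AddMonoidAlgebra.single (fun i => (s i : ℤ)) c := by
  rw [toLaurent, MvPolynomial.aeval_monomial, Finsupp.prod_fintype _ _ (fun i => pow_zero _)]
  simp only [AddMonoidAlgebra.single_pow, one_pow]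
  rw [prod_single_one, Algebra.algebraMap_eq_smul_one, smul_mul_assoc, one_mul,
    AddMonoidAlgebra.smul_single, smul_eq_mul, mul_one]
  congr 1
  ext i
  simp [Finset.sum_apply, Pi.single_apply]

lemma toLaurent_coeff (p : MvPolynomial σ k) (s : σ →₀ ℕ) :
    (toLaurent k σ p).coeff (fun i => (s i : ℤ)) = p.coeff s := by
  induction p using MvPolynomial.induction_on' with
  | monomial t c =>
    rw [toLaurent_monomial, AddMonoidAlgebra.coeff_single, MvPolynomial.coeff_monomial,
      Finsupp.single_apply]
    congr 1
    rw [eq_iff_iff, funext_iff, Finsupp.ext_iff]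
    simp
  | add p q hp hq => rw [map_add, MvPolynomial.coeff_add, ← hp, ← hq]; rfl

lemma toLaurent_injective : Function.Injective (toLaurent k σ) := fun p q h => by
  ext s
  rw [← toLaurent_coeff, ← toLaurent_coeff, h]

/-- The product of the variables with index outside of `I`. -/
noncomputable def prodVars (I : Finset σ) : MvPolynomial σ k := ∏ i ∈ Iᶜ, MvPolynomial.X i

/-- The exponent vector of `prodVars`. -/
def indexVector (I : Finset σ) : σ → ℤ := fun i => if i ∈ I then 0 else 1

lemma toLaurent_prodVars (I : Finset σ) :
    toLaurent k σ (prodVars k I) = AddMonoidAlgebra.single (indexVector I) 1 := by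
  rw [prodVars, map_prod]
  simp only [toLaurent, MvPolynomial.aeval_X]
  rw [prod_single_one]
  congr 1
  ext i
  simp [Finset.sum_apply, Pi.single_apply, indexVector]

lemma prodVars_mem (I : Finset σ) :
    prodVars k I ∈ MvPolynomial.homogeneousSubmodule σ k (Iᶜ.card) := by
  have := MvPolynomial.IsHomogeneous.prod Iᶜ (fun i => (MvPolynomial.X i : MvPolynomial σ k))
    (fun _ => 1) (fun i _ => MvPolynomial.isHomogeneous_X k i)
  simpa [prodVars] using this

lemma isUnit_single_one {M : Type*} [AddCommGroup M] (m : M) :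
    IsUnit (AddMonoidAlgebra.single m 1 : AddMonoidAlgebra k M) :=
  IsUnit.of_mul_eq_one (AddMonoidAlgebra.single (-m) 1) (by
    rw [AddMonoidAlgebra.single_mul_single, add_neg_cancel, one_mul, AddMonoidAlgebra.one_def])

/-- The functions on the open subset `x_i ≠ 0` (for `i ∉ I`) of projective space, as Laurent
polynomials. -/
noncomputable def awayLaurent (I : Finset σ) :
    Away (MvPolynomial.homogeneousSubmodule σ k) (prodVars k I) →+* AddMonoidAlgebra k (σ → ℤ) :=
  (Localization.awayLift (toLaurent k σ).toRingHom (prodVars k I)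
    ((congrArg IsUnit (toLaurent_prodVars k I)).mpr (isUnit_single_one k _))).comp
  (algebraMap _ (Localization.Away (prodVars k I)))

lemma awayLaurent_mk (I : Finset σ) {d : ℕ}
    (hf : prodVars k I ∈ MvPolynomial.homogeneousSubmodule σ k d) (N : ℕ) (a : MvPolynomial σ k)
    (ha : a ∈ MvPolynomial.homogeneousSubmodule σ k (N • d)) :
    awayLaurent k I (Away.mk _ hf N a ha) =
      toLaurent k σ a * AddMonoidAlgebra.single (-(N • indexVector I)) 1 := by
  have h1 : awayLaurent k I (Away.mk _ hf N a ha) * toLaurent k σ (prodVars k I) ^ N =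
      toLaurent k σ a := by
    rw [awayLaurent, RingHom.comp_apply, HomogeneousLocalization.algebraMap_apply, Away.val_mk,
      Localization.mk_eq_mk']
    refine (mul_comm _ _).trans ((congrArg (· * _) ?_).trans
      ((IsLocalization.lift_mk'_spec _ _ _ _).1 rfl).symm)
    exact (map_pow _ _ _).symm
  rw [← h1, toLaurent_prodVars, AddMonoidAlgebra.single_pow, one_pow, mul_assoc,
    AddMonoidAlgebra.single_mul_single, add_neg_cancel, one_mul, ← AddMonoidAlgebra.one_def,
    mul_one]

lemma awayLaurent_injective (I : Finset σ) : Function.Injective (awayLaurent k I) := by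
  intro x y hxy
  obtain ⟨N, a, ha, rfl⟩ := Away.mk_surjective _ (prodVars_mem k I) x
  obtain ⟨N', b, hb, rfl⟩ := Away.mk_surjective _ (prodVars_mem k I) y
  rw [awayLaurent_mk, awayLaurent_mk] at hxy
  have h : a * prodVars k I ^ N' = b * prodVars k I ^ N := by
    apply toLaurent_injective k
    rw [map_mul, map_mul, map_pow, map_pow, toLaurent_prodVars, AddMonoidAlgebra.single_pow,
      AddMonoidAlgebra.single_pow, one_pow, one_pow]
    have := congrArg (· * (AddMonoidAlgebra.single ((N + N') • indexVector I) 1 :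
      AddMonoidAlgebra k (σ → ℤ))) hxy
    simp only [mul_assoc, AddMonoidAlgebra.single_mul_single, one_mul] at this
    convert this using 4 <;> rw [add_smul] <;> abel
  apply val_injective
  rw [Away.val_mk, Away.val_mk, Localization.mk_eq_mk_iff, Localization.r_iff_exists]
  refine ⟨1, ?_⟩
  simp only [OneMemClass.coe_one, one_mul]
  rw [mul_comm, h, mul_comm]

lemma awayLaurent_awayMap {I J : Finset σ} {g : MvPolynomial σ k} {e : ℕ}
    (hg : g ∈ MvPolynomial.homogeneousSubmodule σ k e) (hx : prodVars k I = prodVars k J * g)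
    (x : Away (MvPolynomial.homogeneousSubmodule σ k) (prodVars k J)) :
    awayLaurent k I (awayMap _ hg hx x) = awayLaurent k J x := by
  obtain ⟨N, a, ha, rfl⟩ := Away.mk_surjective _ (prodVars_mem k J) x
  rw [awayMap_mk, awayLaurent_mk, awayLaurent_mk]
  have hu : IsUnit (toLaurent k σ (prodVars k I) ^ N) :=
    (congrArg IsUnit (toLaurent_prodVars k I)).mpr (isUnit_single_one k _) |>.pow N
  apply hu.mul_left_injective
  have h1 (I : Finset σ) : toLaurent k σ (prodVars k I) ^ N *
      AddMonoidAlgebra.single (-(N • indexVector I)) 1 = 1 := by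
    rw [toLaurent_prodVars, AddMonoidAlgebra.single_pow, one_pow,
      AddMonoidAlgebra.single_mul_single, add_neg_cancel, one_mul, ← AddMonoidAlgebra.one_def]
  simp only
  have h2 := h1 I
  have h3 := h1 J
  rw [mul_assoc, mul_comm (AddMonoidAlgebra.single _ _), h1, hx, map_mul, map_mul, map_pow, mul_pow]
  calc _ = toLaurent k σ a * toLaurent k σ g ^ N * 1 := rfl
    _ = _ := by rw [← h3]; ring

lemma awayLaurent_fromZero (I : Finset σ) (c : k) :
    awayLaurent k I (fromZeroRingHom _ _ (algebraMap k
      (MvPolynomial.homogeneousSubmodule σ k 0) c)) = algebraMap k _ c := by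
  have h0 : fromZeroRingHom (MvPolynomial.homogeneousSubmodule σ k)
      (Submonoid.powers (prodVars k I)) (algebraMap k
      (MvPolynomial.homogeneousSubmodule σ k 0) c) =
      Away.mk _ (prodVars_mem k I) 0 (MvPolynomial.C c) (by
        rw [zero_smul]; exact MvPolynomial.isHomogeneous_C _ _) := by
    apply val_injective
    rw [Away.val_mk]
    exact congrArg (Localization.mk _) (Subtype.ext (pow_zero _).symm)
  rw [h0, awayLaurent_mk, zero_smul, neg_zero, ← AddMonoidAlgebra.one_def, mul_one,
    ← MvPolynomial.algebraMap_eq, AlgHom.commutes]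

end HomogeneousLocalization

namespace FakeWPSFan
variable {n : ℕ} (F : FakeWPSFan n)

/-- The rays satisfy only one relation, up to multiples. -/
lemma relation_unique {a : Fin (n + 1) → ℤ} (ha : ∑ i, a i • F.v i = 0)
    {x : Fin (n + 1) → ℚ} (hx : ∀ m : Fin n → ℤ, ∑ i, x i * ((m ⬝ᵥ F.v i : ℤ) : ℚ) = 0)
    (i j : Fin (n + 1)) : x i * a j = x j * a i := by
  rcases eq_or_ne i j with rfl | hij
  · rfl
  obtain ⟨m, hm, hpos⟩ := F.exists_dual (Finset.univ.erase i)
    (fun h => Finset.notMem_erase i Finset.univ (h.symm.subset (Finset.mem_univ i))) j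
    (by simp [hij.symm])
  have key : ∀ y : Fin (n + 1) → ℚ, ∑ l, y l * ((m ⬝ᵥ F.v l : ℤ) : ℚ) = 0 →
      y i * ((m ⬝ᵥ F.v i : ℤ) : ℚ) + y j * ((m ⬝ᵥ F.v j : ℤ) : ℚ) = 0 := by
    intro y hy
    rw [← hy]
    refine (Finset.sum_eq_add_of_mem (f := fun l => y l * ((m ⬝ᵥ F.v l : ℤ) : ℚ)) i j
      (Finset.mem_univ _) (Finset.mem_univ _) hij
      fun l _ hl => ?_).symm
    rw [hm l (by simp [hl.1]) hl.2, Int.cast_zero, mul_zero]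
  have h1 := key x (hx m)
  have h2 := key (fun l => a l) (by
    have := congrArg (m ⬝ᵥ ·) ha
    simp only [dotProduct_sum, dotProduct_smul, dotProduct_zero, smul_eq_mul] at this
    exact_mod_cast this)
  have hne : ((m ⬝ᵥ F.v j : ℤ) : ℚ) ≠ 0 := by exact_mod_cast hpos.ne'
  apply mul_right_cancel₀ hne
  linear_combination (a i : ℚ) * (-h1) + x i * h2

/-- If the rays generate the lattice and their sum is zero, then a lattice functional can take any
values with sum zero on the rays. -/
lemma exists_dotProduct_eq (hs : Submodule.span ℤ (Set.range F.v) = ⊤) (h0 : ∑ i, F.v i = 0)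
    {ε : Fin (n + 1) → ℤ} (hε : ∑ i, ε i = 0) : ∃ m : Fin n → ℤ, ∀ i, m ⬝ᵥ F.v i = ε i := by
  have hex : ∀ j : Fin n, ∃ c : Fin (n + 1) → ℤ, ∑ i, c i • F.v i = Pi.single j 1 := fun j =>
    (Submodule.mem_span_range_iff_exists_fun ℤ).1 (hs ▸ Submodule.mem_top)
  choose c hc using hex
  refine ⟨fun j => ∑ l, c j l * ε l, fun i => ?_⟩
  let x : Fin (n + 1) → ℤ := fun l => (∑ j, F.v i j * c j l) - if l = i then 1 else 0
  have hx0 : ∑ l, x l • F.v l = 0 := by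
    simp only [x, sub_smul, Finset.sum_sub_distrib, ite_smul, one_smul, zero_smul,
      Finset.sum_ite_eq', Finset.mem_univ, if_true, Finset.sum_smul, mul_smul]
    rw [Finset.sum_comm]
    simp only [← Finset.smul_sum, hc]
    ext j
    simp [Finset.sum_apply, Pi.single_apply]
  have hx : ∀ l, x l = x i := fun l => by
    have := F.relation_unique (a := 1) (by simpa using h0) (x := fun l => x l) (fun m => by
      have := congrArg (m ⬝ᵥ ·) hx0
      simp only [dotProduct_sum, dotProduct_smul, dotProduct_zero, smul_eq_mul] at this
      exact_mod_cast this) l i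
    simpa using this
  have h1 : ∑ l, x l * ε l = 0 := by
    simp only [fun l => hx l]
    rw [← Finset.mul_sum, hε, mul_zero]
  simp only [x, sub_mul, Finset.sum_sub_distrib, ite_mul, one_mul, zero_mul, Finset.sum_ite_eq',
    Finset.mem_univ, if_true, sub_eq_zero, Finset.sum_mul] at h1
  rw [← h1, Finset.sum_comm, dotProduct]
  refine Finset.sum_congr rfl fun j _ => ?_
  rw [Finset.sum_mul]
  exact Finset.sum_congr rfl fun l _ => by ring

/-- The values of a lattice functional on the rays. -/
def rayValues : (Fin n → ℤ) →+ (Fin (n + 1) → ℤ) where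
  toFun m i := m ⬝ᵥ F.v i
  map_zero' := funext fun _ => zero_dotProduct _
  map_add' a b := funext fun _ => add_dotProduct a b _

lemma rayValues_apply (m : Fin n → ℤ) (i) : F.rayValues m i = m ⬝ᵥ F.v i := rfl

lemma rayValues_injective (hs : Submodule.span ℤ (Set.range F.v) = ⊤) :
    Function.Injective F.rayValues := by
  rw [injective_iff_map_eq_zero]
  intro m hm
  ext j
  obtain ⟨c, hc⟩ := (Submodule.mem_span_range_iff_exists_fun ℤ (v := F.v)).1
    (show Pi.single j 1 ∈ _ from hs ▸ Submodule.mem_top)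
  have : m ⬝ᵥ Pi.single j 1 = 0 := by
    rw [← hc, dotProduct_sum]
    refine Finset.sum_eq_zero fun i _ => ?_
    rw [dotProduct_smul, show m ⬝ᵥ F.v i = 0 from congrFun hm i, smul_zero]
  simpa using this

variable (k : Type u) [Field k]

/-- The functions on a chart, as Laurent polynomials in homogeneous coordinates. -/
noncomputable def homogeneousCoord (I : Finset (Fin (n + 1))) :
    F.CoordRing k I →ₐ[k] AddMonoidAlgebra k (Fin (n + 1) → ℤ) :=
  AddMonoidAlgebra.mapDomainAlgHom k k (F.rayValues.comp (F.dualCone I).subtype)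

lemma homogeneousCoord_single (I : Finset (Fin (n + 1))) (m : F.dualCone I) (c : k) :
    F.homogeneousCoord k I (AddMonoidAlgebra.single m c) =
      AddMonoidAlgebra.single (F.rayValues m) c := by
  simp [homogeneousCoord]

lemma homogeneousCoord_injective (hs : Submodule.span ℤ (Set.range F.v) = ⊤)
    (I : Finset (Fin (n + 1))) : Function.Injective (F.homogeneousCoord k I) :=
  AddMonoidAlgebra.mapDomain_injective ((F.rayValues_injective hs).comp Subtype.val_injective)

lemma homogeneousCoord_restrictCoord {I J : Finset (Fin (n + 1))} (h : I ⊆ J)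
    (f : F.CoordRing k J) :
    F.homogeneousCoord k I (F.restrictCoord k h f) = F.homogeneousCoord k J f := by
  induction f using AddMonoidAlgebra.induction_linear with
  | zero => simp
  | add f g hf hg => simp only [map_add, hf, hg]
  | single m c => rw [restrictCoord_single, homogeneousCoord_single, homogeneousCoord_single]; rfl

section
attribute [local instance] MvPolynomial.gradedAlgebra
open HomogeneousLocalization

lemma sum_rayValues (h0 : ∑ i, F.v i = 0) (m : Fin n → ℤ) : ∑ i, F.rayValues m i = 0 := by
  simp only [rayValues_apply]
  rw [← dotProduct_sum, h0, dotProduct_zero]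

/-- The functions on the chart of `σ_I` are homogeneous fractions of degree zero, the denominators
of which are powers of the product of the variables off `I`. -/
lemma range_homogeneousCoord_le (h0 : ∑ i, F.v i = 0) (I : Cone n) :
    (F.homogeneousCoord k I.1 : F.CoordRing k I.1 →+* AddMonoidAlgebra k (Fin (n + 1) → ℤ)).range ≤
      (awayLaurent k I.1).range := by
  rintro _ ⟨f, rfl⟩
  induction f using AddMonoidAlgebra.induction_linear with
  | zero => rw [map_zero]; exact zero_mem _
  | add f g hf hg => rw [map_add]; exact add_mem hf hg
  | single m c =>
    let N : ℕ := ∑ i, (F.rayValues m i).natAbs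
    let s : Fin (n + 1) →₀ ℕ := Finsupp.equivFunOnFinite.symm
      fun i => (F.rayValues m i + N * indexVector I.1 i).toNat
    have hs : ∀ i, (s i : ℤ) = F.rayValues m i + N * indexVector I.1 i := by
      intro i
      refine Int.toNat_of_nonneg ?_
      by_cases hi : i ∈ I.1
      · rw [indexVector, if_pos hi, mul_zero, add_zero]
        exact m.2 i hi
      · rw [indexVector, if_neg hi, mul_one]
        have h2 : (F.rayValues m i).natAbs ≤ N :=
          Finset.single_le_sum (f := fun i => (F.rayValues m i).natAbs)
            (fun _ _ => Nat.zero_le _) (Finset.mem_univ i)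
        omega
    have hdeg : s.degree = N • I.1ᶜ.card := by
      zify
      rw [Finsupp.degree_eq_sum]
      push_cast
      simp only [hs]
      rw [Finset.sum_add_distrib, F.sum_rayValues h0, zero_add, ← Finset.mul_sum]
      simp [indexVector, Finset.sum_ite, Finset.filter_not, Finset.compl_eq_univ_sdiff]
    refine ⟨Away.mk _ (prodVars_mem k I.1) N (MvPolynomial.monomial s c)
      ((MvPolynomial.mem_homogeneousSubmodule _ _).2
        (MvPolynomial.isHomogeneous_monomial c hdeg)), ?_⟩
    rw [awayLaurent_mk, toLaurent_monomial, AddMonoidAlgebra.single_mul_single, mul_one]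
    refine Eq.trans ?_ (F.homogeneousCoord_single k I.1 m c).symm
    congr 1
    ext i
    simp [hs]

/-- Conversely, all homogeneous fractions of degree zero with such denominators are functions on the
chart, as the exponent vectors with sum zero are the values of lattice functionals on the rays. -/
lemma range_awayLaurent_le (hs : Submodule.span ℤ (Set.range F.v) = ⊤) (h0 : ∑ i, F.v i = 0)
    (I : Cone n) : (awayLaurent k I.1).range ≤
      (F.homogeneousCoord k I.1 :
        F.CoordRing k I.1 →+* AddMonoidAlgebra k (Fin (n + 1) → ℤ)).range := by
  rintro _ ⟨x, rfl⟩
  obtain ⟨N, a, ha, rfl⟩ := Away.mk_surjective _ (prodVars_mem k I.1) x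
  rw [awayLaurent_mk, MvPolynomial.as_sum a, map_sum, Finset.sum_mul]
  refine sum_mem fun s hsa => ?_
  rw [toLaurent_monomial, AddMonoidAlgebra.single_mul_single, mul_one]
  have hdeg : s.degree = N • I.1ᶜ.card := by
    have := ha (MvPolynomial.mem_support_iff.1 hsa)
    exact (DFunLike.congr_fun
      (Finsupp.degree_eq_weight_one (σ := Fin (n + 1)) (R := ℕ)) s).trans this
  obtain ⟨m, hm⟩ := F.exists_dotProduct_eq hs h0
    (ε := (fun i => (s i : ℤ)) + -(N • indexVector I.1)) (by
      zify at hdeg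
      rw [Finsupp.degree_eq_sum] at hdeg
      push_cast at hdeg
      simp only [Pi.add_apply, Pi.neg_apply, Finset.sum_add_distrib, Finset.sum_neg_distrib, hdeg,
        nsmul_eq_mul]
      simp [indexVector, Finset.sum_ite, Finset.filter_not, Finset.compl_eq_univ_sdiff, mul_comm])
  have hmem : m ∈ F.dualCone I.1 := fun i hi => by
    rw [hm]
    simp [indexVector, hi]
  refine ⟨AddMonoidAlgebra.single ⟨m, hmem⟩ (a.coeff s), ?_⟩
  refine (F.homogeneousCoord_single k I.1 _ _).trans ?_
  congr 1
  ext i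
  exact hm i

/-- The identification of the coordinate rings of the charts of projective space and of `W`. -/
lemma exists_awayEquiv (hs : Submodule.span ℤ (Set.range F.v) = ⊤) (h0 : ∑ i, F.v i = 0)
    (I : Cone n) : ∃ e : Away (MvPolynomial.homogeneousSubmodule (Fin (n + 1)) k)
      (prodVars k I.1) ≃+* F.CoordRing k I.1,
      ∀ x, F.homogeneousCoord k I.1 (e x) = awayLaurent k I.1 x := by
  let e₁ := RingEquiv.ofBijective (awayLaurent k I.1).rangeRestrict
    ⟨fun x y h => awayLaurent_injective k I.1 (congrArg Subtype.val h),
      (awayLaurent k I.1).rangeRestrict_surjective⟩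
  let φ : F.CoordRing k I.1 →+* AddMonoidAlgebra k (Fin (n + 1) → ℤ) := F.homogeneousCoord k I.1
  let e₂ := RingEquiv.ofBijective φ.rangeRestrict
    ⟨fun x y h => F.homogeneousCoord_injective k hs I.1 (congrArg Subtype.val h),
      φ.rangeRestrict_surjective⟩
  let e₃ := RingEquiv.subringCongr
    (le_antisymm (F.range_awayLaurent_le k hs h0 I) (F.range_homogeneousCoord_le k h0 I))
  exact ⟨(e₁.trans e₃).trans e₂.symm, fun x =>
    congrArg Subtype.val (e₂.apply_symm_apply (e₃ (e₁ x)))⟩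

end
end FakeWPSFan

namespace FakeWPSFan
variable {n : ℕ} (F : FakeWPSFan n) (k : Type u) [Field k]

section
attribute [local instance] MvPolynomial.gradedAlgebra
open HomogeneousLocalization

/-- The coordinate rings of the charts of projective space and of `W`, identified. -/
noncomputable def awayEquiv (hs : Submodule.span ℤ (Set.range F.v) = ⊤) (h0 : ∑ i, F.v i = 0)
    (I : Cone n) : Away (MvPolynomial.homogeneousSubmodule (Fin (n + 1)) k)
      (prodVars k I.1) ≃+* F.CoordRing k I.1 :=
  (F.exists_awayEquiv k hs h0 I).choose

variable (hs : Submodule.span ℤ (Set.range F.v) = ⊤) (h0 : ∑ i, F.v i = 0)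

lemma homogeneousCoord_awayEquiv (I : Cone n)
    (x : Away (MvPolynomial.homogeneousSubmodule (Fin (n + 1)) k) (prodVars k I.1)) :
    F.homogeneousCoord k I.1 (F.awayEquiv k hs h0 I x) = awayLaurent k I.1 x :=
  (F.exists_awayEquiv k hs h0 I).choose_spec x

lemma card_compl_pos (I : Cone n) : 0 < I.1ᶜ.card :=
  Finset.card_pos.2 (Finset.nonempty_iff_ne_empty.2 fun h =>
    I.2 (Finset.compl_eq_empty_iff _ |>.1 h))

/-- The identification of coordinate rings, as a ring homomorphism. -/
noncomputable abbrev awayHom (I : Cone n) :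
    Away (MvPolynomial.homogeneousSubmodule (Fin (n + 1)) k) (prodVars k I.1) →+*
      F.CoordRing k I.1 :=
  (F.awayEquiv k hs h0 I).toRingHom

lemma isIso_awayHom (I : Cone n) : IsIso (CommRingCat.ofHom (F.awayHom k hs h0 I)) :=
  (F.awayEquiv k hs h0 I).toCommRingCatIso.isIso_hom

/-- The open subset of projective space where `x_i ≠ 0` for all `i ∉ I`. -/
noncomputable def projChart (I : Cone n) :
    Spec (.of (Away (MvPolynomial.homogeneousSubmodule (Fin (n + 1)) k) (prodVars k I.1))) ⟶
      projSpace k n :=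
  Proj.awayι _ (prodVars k I.1) (prodVars_mem k I.1) (card_compl_pos I)

instance (I : Cone n) : IsOpenImmersion (projChart k I) :=
  inferInstanceAs (IsOpenImmersion (Proj.awayι _ _ _ _))

/-- The inclusion of a chart of `W` in projective space. -/
noncomputable def chartToProj (I : Cone n) : Spec (.of (F.CoordRing k I.1)) ⟶ projSpace k n :=
  Spec.map (CommRingCat.ofHom (F.awayHom k hs h0 I)) ≫ projChart k I

instance (I : Cone n) : IsOpenImmersion (F.chartToProj k hs h0 I) := by
  have := F.isIso_awayHom k hs h0 I
  unfold chartToProj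
  infer_instance

lemma opensRange_chartToProj (I : Cone n) : (F.chartToProj k hs h0 I).opensRange =
    Proj.basicOpen (MvPolynomial.homogeneousSubmodule (Fin (n + 1)) k) (prodVars k I.1) := by
  have := F.isIso_awayHom k hs h0 I
  exact (Scheme.Hom.opensRange_comp_of_isIso _ (projChart k I)).trans
    (Proj.opensRange_awayι _ _ _ _)

/-- The inclusions of the charts in projective space are compatible with the inclusions among the
charts, so that they glue. -/
lemma chartToProj_restrict {I J : Cone n} (h : I.1 ⊆ J.1) :
    Spec.map (CommRingCat.ofHom (F.restrictCoord k h : F.CoordRing k J.1 →+* F.CoordRing k I.1)) ≫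
      F.chartToProj k hs h0 J = F.chartToProj k hs h0 I := by
  let g : MvPolynomial (Fin (n + 1)) k := ∏ i ∈ J.1 \ I.1, MvPolynomial.X i
  have hg : g ∈ MvPolynomial.homogeneousSubmodule (Fin (n + 1)) k ((J.1 \ I.1).card) := by
    have := MvPolynomial.IsHomogeneous.prod (J.1 \ I.1)
      (fun i => (MvPolynomial.X i : MvPolynomial (Fin (n + 1)) k))
      (fun _ => 1) (fun i _ => MvPolynomial.isHomogeneous_X k i)
    simpa [g] using this
  have hx : prodVars k I.1 = prodVars k J.1 * g := by
    rw [prodVars, prodVars, ← Finset.prod_union]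
    · congr 1
      ext i
      have := @h i
      simp only [Finset.mem_compl, Finset.mem_union, Finset.mem_sdiff]
      tauto
    · rw [Finset.disjoint_left]
      simp only [Finset.mem_compl, Finset.mem_sdiff]
      tauto
  have key : (F.restrictCoord k h : F.CoordRing k J.1 →+* F.CoordRing k I.1).comp
      (F.awayHom k hs h0 J) =
      (F.awayHom k hs h0 I).comp (awayMap _ hg hx) := by
    refine RingHom.ext fun x => F.homogeneousCoord_injective k hs I.1 ?_
    refine (F.homogeneousCoord_restrictCoord k h _).trans ?_
    refine (F.homogeneousCoord_awayEquiv k hs h0 J x).trans ?_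
    refine Eq.trans ?_ (F.homogeneousCoord_awayEquiv k hs h0 I _).symm
    exact (awayLaurent_awayMap k hg hx x).symm
  have h1 : Spec.map (CommRingCat.ofHom (awayMap _ hg hx)) ≫ projChart k J = projChart k I :=
    Proj.SpecMap_awayMap_awayι (MvPolynomial.homogeneousSubmodule (Fin (n + 1)) k)
      (prodVars_mem k J.1) (card_compl_pos J) hg hx
  unfold chartToProj
  rw [← Category.assoc, ← Spec.map_comp, ← CommRingCat.ofHom_comp, key, CommRingCat.ofHom_comp,
    Spec.map_comp, Category.assoc, h1]

lemma chartToProj_over (I : Cone n) : F.chartToProj k hs h0 I ≫ (projSpace k n ↘ Spec (.of k)) =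
    Spec.map (CommRingCat.ofHom (algebraMap k (F.CoordRing k I.1))) := by
  have key : (F.awayHom k hs h0 I).comp ((fromZeroRingHom _
      (Submonoid.powers (prodVars k I.1))).comp
      (algebraMap k (MvPolynomial.homogeneousSubmodule (Fin (n + 1)) k 0))) =
      algebraMap k (F.CoordRing k I.1) := by
    refine RingHom.ext fun c => F.homogeneousCoord_injective k hs I.1 ?_
    refine (F.homogeneousCoord_awayEquiv k hs h0 I _).trans ?_
    exact (awayLaurent_fromZero k I.1 c).trans (AlgHom.commutes _ c).symm
  have h1 : projChart k I ≫ (projSpace k n ↘ Spec (.of k)) =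
      Spec.map (CommRingCat.ofHom ((fromZeroRingHom _ (Submonoid.powers (prodVars k I.1))).comp
        (algebraMap k (MvPolynomial.homogeneousSubmodule (Fin (n + 1)) k 0)))) := by
    rw [CommRingCat.ofHom_comp, Spec.map_comp,
      ← Proj.awayι_toSpecZero _ _ (prodVars_mem k I.1) (card_compl_pos I), Category.assoc]
    rfl
  rw [← key, CommRingCat.ofHom_comp, Spec.map_comp, ← h1, chartToProj, Category.assoc]

/-- The morphism from `W` to projective space given by homogeneous coordinates. -/
noncomputable def toProjSpace : F.toricVariety k ⟶ projSpace k n :=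
  Limits.colimit.desc (F.diagram k)
    { pt := projSpace k n
      ι := { app := fun I => F.chartToProj k hs h0 I
             naturality := fun _ _ f =>
              (F.chartToProj_restrict k hs h0 (leOfHom f)).trans (Category.comp_id _).symm } }

lemma openChart_toProjSpace (I : Cone n) :
    F.openChart k I ≫ F.toProjSpace k hs h0 = F.chartToProj k hs h0 I :=
  Limits.colimit.ι_desc _ _

lemma toProjSpace_openChart (I : Cone n) (y) :
    F.toProjSpace k hs h0 (F.openChart k I y) = F.chartToProj k hs h0 I y := by
  rw [← openChart_toProjSpace]
  rfl

lemma toProjSpace_over : F.toProjSpace k hs h0 ≫ (projSpace k n ↘ Spec (.of k)) =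
    F.toricVariety k ↘ Spec (.of k) := by
  refine Limits.colimit.hom_ext fun I => ?_
  refine Eq.trans ?_ (F.openChart_over k I).symm
  rw [← F.chartToProj_over k hs h0 I, ← openChart_toProjSpace, Category.assoc]
  rfl

/-- Points of two charts with the same image come from the chart of the intersection of the two
cones, as the images of the charts intersect in the image of this chart. -/
lemma toProjSpace_injective : Function.Injective (F.toProjSpace k hs h0) := by
  intro x x' hxx
  obtain ⟨I, y, rfl⟩ := F.exists_openChart_eq k x
  obtain ⟨I', y', rfl⟩ := F.exists_openChart_eq k x'
  let L : Cone n := ⟨I.1 ∩ I'.1, fun h => I.2 (Finset.eq_univ_of_forall fun i =>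
    (Finset.mem_inter.1 (h.symm.subset (Finset.mem_univ i))).1)⟩
  have h1 : F.toProjSpace k hs h0 (F.openChart k I y) ∈
      (F.chartToProj k hs h0 I).opensRange := ⟨y, (F.toProjSpace_openChart k hs h0 I y).symm⟩
  have h2 : F.toProjSpace k hs h0 (F.openChart k I y) ∈
      (F.chartToProj k hs h0 I').opensRange :=
    ⟨y', (F.toProjSpace_openChart k hs h0 I' y').symm.trans hxx.symm⟩
  have h3 : F.toProjSpace k hs h0 (F.openChart k I y) ∈
      (F.chartToProj k hs h0 L).opensRange := by
    rw [opensRange_chartToProj] at h1 h2 ⊢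
    have h12 := Proj.basicOpen_mul (MvPolynomial.homogeneousSubmodule (Fin (n + 1)) k)
      (prodVars k I.1) (prodVars k I'.1)
    have hdvd : prodVars k L.1 ∣ prodVars k I.1 * prodVars k I'.1 := by
      refine ⟨∏ i ∈ I.1ᶜ ∩ I'.1ᶜ, MvPolynomial.X i, ?_⟩
      rw [prodVars, prodVars, prodVars, ← Finset.prod_union_inter]
      congr 2
      ext i
      simp only [L, Finset.mem_union, Finset.mem_compl, Finset.mem_inter]
      tauto
    exact Proj.basicOpen_mono _ _ _ hdvd (h12.ge ⟨h1, h2⟩)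
  obtain ⟨z, hz⟩ := h3
  have claim : ∀ (I : Cone n) (hI : L.1 ⊆ I.1) (y : PrimeSpectrum (F.CoordRing k I.1)),
      F.chartToProj k hs h0 L z = F.chartToProj k hs h0 I y →
      F.openChart k L z = F.openChart k I y := by
    intro I hI y hy
    rw [← F.chartToProj_restrict k hs h0 hI] at hy
    have hy' := (F.chartToProj k hs h0 I).isOpenEmbedding.injective hy
    rw [← F.specMap_restrictCoord k hI]
    exact congrArg (F.openChart k I) hy'
  rw [← claim I Finset.inter_subset_left y (hz.trans (F.toProjSpace_openChart k hs h0 I y)),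
    ← claim I' Finset.inter_subset_right y'
      (hz.trans (hxx.trans (F.toProjSpace_openChart k hs h0 I' y')))]

lemma toProjSpace_surjective : Function.Surjective (F.toProjSpace k hs h0) := by
  intro x
  have htop := Proj.iSup_basicOpen_eq_top' (MvPolynomial.homogeneousSubmodule (Fin (n + 1)) k)
    (fun i : Fin (n + 1) => (MvPolynomial.X i : MvPolynomial (Fin (n + 1)) k))
    (fun i => ⟨1, MvPolynomial.isHomogeneous_X k i⟩) (by
      rw [eq_top_iff]
      rintro p -
      have hp : p ∈ Algebra.adjoin k (Set.range (MvPolynomial.X : Fin (n + 1) → _)) := by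
        rw [MvPolynomial.adjoin_range_X]; trivial
      induction hp using Algebra.adjoin_induction with
      | mem x hx => exact Algebra.subset_adjoin hx
      | algebraMap r =>
        exact Subalgebra.algebraMap_mem (Algebra.adjoin
          (MvPolynomial.homogeneousSubmodule (Fin (n + 1)) k 0) _)
          (algebraMap k (MvPolynomial.homogeneousSubmodule (Fin (n + 1)) k 0) r)
      | add x y _ _ hx hy => exact add_mem hx hy
      | mul x y _ _ hx hy => exact mul_mem hx hy)
  obtain ⟨i, hi⟩ := TopologicalSpace.Opens.mem_iSup.1 (htop.ge (show x ∈ ⊤ from trivial))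
  let I : Cone n := ⟨{i}ᶜ, fun h => by simpa using h.symm.subset (Finset.mem_univ i)⟩
  have hI : prodVars k I.1 = MvPolynomial.X i := by simp [prodVars, I]
  have hx : x ∈ (F.chartToProj k hs h0 I).opensRange := by
    rw [opensRange_chartToProj, hI]
    exact hi
  obtain ⟨y, hy⟩ := hx
  exact ⟨F.openChart k I y, (F.toProjSpace_openChart k hs h0 I y).trans hy⟩

/-- If the rays generate the lattice and have sum zero, then `W` is projective space. -/
theorem exists_iso_projSpace (hs : Submodule.span ℤ (Set.range F.v) = ⊤)
    (h0 : ∑ i, F.v i = 0) :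
    ∃ e : F.toricVariety k ≅ projSpace k n, e.hom.IsOver (Spec (.of k)) := by
  have hopen : IsOpenImmersion (F.toProjSpace k hs h0) := by
    refine IsOpenImmersion.of_forall_source_exists _ (F.toProjSpace_injective k hs h0) fun x => ?_
    obtain ⟨I, y, rfl⟩ := F.exists_openChart_eq k x
    refine ⟨_, F.openChart k I, inferInstance, ⟨y, rfl⟩, ?_⟩
    rw [openChart_toProjSpace]
    infer_instance
  have : IsIso (F.toProjSpace k hs h0) := isIso_of_isOpenImmersion_of_opensRange_eq_top _
    (TopologicalSpace.Opens.ext (Set.range_eq_univ.2 (F.toProjSpace_surjective k hs h0)))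
  exact ⟨asIso (F.toProjSpace k hs h0), ⟨F.toProjSpace_over k hs h0⟩⟩

end
end FakeWPSFan

/-! ### Curves through a rational point -/

namespace FakeWPSFan
variable {n : ℕ} (F : FakeWPSFan n)

/-- The sublattice `σ_I^⊥` is saturated, hence a direct summand. -/
lemma exists_retraction (I : Finset (Fin (n + 1))) :
    ∃ r : (Fin n → ℤ) →+ F.perp I, ∀ m : F.perp I, r m = m := by
  let N : Submodule ℤ (Fin n → ℤ) := AddSubgroup.toIntSubmodule (F.perp I)
  have htf : Module.IsTorsionFree ℤ ((Fin n → ℤ) ⧸ N) := by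
    refine Module.isTorsionFree_iff_smul_eq_zero.2 fun d x => ?_
    obtain ⟨x, rfl⟩ := N.mkQ_surjective x
    rw [← map_smul, Submodule.mkQ_apply, Submodule.mkQ_apply, Submodule.Quotient.mk_eq_zero,
      Submodule.Quotient.mk_eq_zero]
    intro h
    by_cases hd : d = 0
    · exact Or.inl hd
    · refine Or.inr fun i hi => ?_
      have h1 : (d • x) ⬝ᵥ F.v i = 0 := h i hi
      rw [smul_dotProduct, smul_eq_mul] at h1
      exact (mul_eq_zero.1 h1).resolve_left hd
  obtain ⟨s, hs⟩ := Module.projective_lifting_property N.mkQ LinearMap.id N.mkQ_surjective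
  have hmem : ∀ x, x - s (N.mkQ x) ∈ N := fun x => by
    rw [← Submodule.Quotient.mk_eq_zero, ← Submodule.mkQ_apply, map_sub]
    exact sub_eq_zero.2 (LinearMap.congr_fun hs (N.mkQ x)).symm
  refine ⟨AddMonoidHom.mk' (fun x => ⟨x - s (N.mkQ x), hmem x⟩) fun x y => ?_, fun m => ?_⟩
  · ext1
    simp only [map_add, AddSubgroup.coe_add]
    abel
  · ext1
    have : N.mkQ (m : Fin n → ℤ) = 0 := (Submodule.Quotient.mk_eq_zero N).2 m.2
    change (m : Fin n → ℤ) - s (N.mkQ m) = m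
    rw [this, map_zero, sub_zero]

variable (k : Type u) [Field k]

variable {k} in
/-- A `k`-point in the torus of `σ_I` lies on any translate by itself of a one-parameter subgroup of
this torus. -/
lemma mem_range_curve_of_character {I : Cone n} {ev : F.CoordRing k I.1 →ₐ[k] k}
    {τ : Multiplicative (F.perp I.1) →* kˣ} {y : PrimeSpectrum (F.CoordRing k I.1)}
    (hy : ∀ f, f ∈ y.asIdeal ↔ ev f = 0)
    (h₁ : ∀ m : F.dualCone I.1, ∀ hm : (m : Fin n → ℤ) ∈ F.perp I.1,
        ev (AddMonoidAlgebra.single m 1) = τ (Multiplicative.ofAdd ⟨m, hm⟩))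
    (h₂ : ∀ m : F.dualCone I.1, (m : Fin n → ℤ) ∉ F.perp I.1 →
        ev (AddMonoidAlgebra.single m 1) = 0) (l : F.perp I.1 →+ ℤ) :
    F.openChart k I y ∈ Set.range (F.translate k l τ).imageι := by
  refine F.openChart_mem_range_imageι k l τ (Finset.Subset.refl I.1) fun f hf => ?_
  rw [hy]
  let aug : AddMonoidAlgebra k ℤ →ₗ[k] k := (AddMonoidAlgebra.lift k k ℤ 1).toLinearMap
  have key : ev f = aug (F.restrictTranslate k l τ (Finset.Subset.refl I.1) f) := by
    clear hf
    induction f using AddMonoidAlgebra.induction_linear with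
    | zero => simp only [map_zero]
    | add f g hf hg => simp only [map_add, hf, hg]
    | single m c =>
      have hs : (AddMonoidAlgebra.single m c : F.CoordRing k I.1) =
          c • AddMonoidAlgebra.single m 1 := by
        rw [AddMonoidAlgebra.smul_single, smul_eq_mul, mul_one]
      rw [hs, map_smul, map_smul, map_smul]
      congr 1
      by_cases hm : (m : Fin n → ℤ) ∈ F.perp I.1
      · rw [h₁ m hm, F.restrictTranslate_single_of_mem k l τ _ m hm]
        refine Eq.trans ?_ (AddMonoidAlgebra.lift_single _ _ _).symm
        simp
      · rw [h₂ m hm, F.restrictTranslate_single_of_not_mem k l τ _ m hm, map_zero]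
  rw [key, hf, map_zero]

variable {k} in
/-- A `k`-point in the torus of `σ_I` is the limit, for `s → 0`, of the translate of a one-parameter
subgroup of the torus of a face `σ_J` whose direction is in the relative interior of the image of
`σ_I`, provided that the translation extends the character of the point. -/
lemma mem_range_curve_of_limit {I J : Cone n} (hJ : J.1 ⊆ I.1) {ev : F.CoordRing k I.1 →ₐ[k] k}
    {τ : Multiplicative (F.perp I.1) →* kˣ} {y : PrimeSpectrum (F.CoordRing k I.1)}
    (hy : ∀ f, f ∈ y.asIdeal ↔ ev f = 0)
    (h₁ : ∀ m : F.dualCone I.1, ∀ hm : (m : Fin n → ℤ) ∈ F.perp I.1,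
        ev (AddMonoidAlgebra.single m 1) = τ (Multiplicative.ofAdd ⟨m, hm⟩))
    (h₂ : ∀ m : F.dualCone I.1, (m : Fin n → ℤ) ∉ F.perp I.1 →
        ev (AddMonoidAlgebra.single m 1) = 0) (l : F.perp J.1 →+ ℤ)
    (hl : ∀ m : F.perp J.1, (m : Fin n → ℤ) ∈ F.dualCone I.1 →
      (l m = 0 ↔ (m : Fin n → ℤ) ∈ F.perp I.1))
    {t : Multiplicative (F.perp J.1) →* kˣ}
    (ht : ∀ (m : Fin n → ℤ) (hm : m ∈ F.perp I.1) (hm' : m ∈ F.perp J.1),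
      t (Multiplicative.ofAdd ⟨m, hm'⟩) = τ (Multiplicative.ofAdd ⟨m, hm⟩)) :
    F.openChart k I y ∈ Set.range (F.translate k l t).imageι := by
  refine F.openChart_mem_range_imageι k l t hJ fun f hf => ?_
  rw [hy]
  have key : ev f = (F.restrictTranslate k l t hJ f).coeff 0 := by
    clear hf
    induction f using AddMonoidAlgebra.induction_linear with
    | zero => rw [map_zero ev, map_zero (F.restrictTranslate k l t hJ)]; rfl
    | add f g hf hg => rw [map_add, map_add, hf, hg]; rfl
    | single m c =>
      have hs : (AddMonoidAlgebra.single m c : F.CoordRing k I.1) =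
          c • AddMonoidAlgebra.single m 1 := by
        rw [AddMonoidAlgebra.smul_single, smul_eq_mul, mul_one]
      have hIJ : (m : Fin n → ℤ) ∈ F.perp I.1 → (m : Fin n → ℤ) ∈ F.perp J.1 :=
        fun h i hi => h i (hJ hi)
      by_cases hm : (m : Fin n → ℤ) ∈ F.perp J.1
      · rw [F.restrictTranslate_single_of_mem k l t hJ m hm, hs, map_smul,
          AddMonoidAlgebra.coeff_single, Finsupp.single_apply, smul_eq_mul]
        by_cases hmI : (m : Fin n → ℤ) ∈ F.perp I.1
        · rw [if_pos ((hl ⟨m, hm⟩ m.2).2 hmI), h₁ m hmI, ht _ hmI]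
        · rw [if_neg (fun h => hmI ((hl ⟨m, hm⟩ m.2).1 h)), h₂ m hmI, mul_zero]
      · rw [F.restrictTranslate_single_of_not_mem k l t hJ m hm, hs, map_smul,
          h₂ m fun h => hm (hIJ h), smul_zero]
        rfl
  rw [key, hf]
  rfl

/-- There is a unibranch rational curve through `P` which is the closure of a translate of a
one-parameter subgroup of the torus of an orbit closure, and `q` is its intersection number with
`-K_W`. -/
def HasToricCurve (P : Spec (.of k) ⟶ F.toricVariety k) (q : ℚ) : Prop :=
  ∃ (C : Scheme.{u}) (_ : C.Over (Spec (.of k))) (_ : IsIntegral C)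
    (i : C ⟶ F.toricVariety k),
    IsClosedImmersion i ∧ i.IsOver (Spec (.of k)) ∧
    IsRationalCurve k C ∧ IsUnibranch C ∧
    (∃ P' : Spec (.of k) ⟶ C, P' ≫ i = P) ∧
    (∃ (I : FakeWPSFan.Cone n) (l : F.perp I.1 →+ ℤ) (t : Multiplicative (F.perp I.1) →* kˣ),
      Set.range i ⊆ F.orbitClosure k I ∧
      Set.range i =
        closure (Set.range (F.onePS k I l ≫ F.translation k I t ≫ F.orbitι k I))) ∧
    IsIntersectionNumber k (fun x => -F.canonicalDivisor k x) i q

variable {k} in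
/-- The closure of the translate by `t` of the one-parameter subgroup `l` is such a curve, if it
contains the point. The charts of `σ_{I₀}` and `σ_{I₁}` contain its ends. -/
lemma hasToricCurve_translate {P : Spec (.of k) ⟶ F.toricVariety k} {J : Cone n}
    {l : F.perp J.1 →+ ℤ} {t : Multiplicative (F.perp J.1) →* kˣ}
    (hP : P (IsLocalRing.closedPoint k) ∈ Set.range (F.translate k l t).imageι)
    {m₁ : F.perp J.1} (hl : l m₁ = 1) {I₀ I₁ : Cone n} (h₀ : J.1 ⊆ I₀.1) (h₁ : J.1 ⊆ I₁.1)
    (hu₀ : ∀ m : F.perp J.1, (m : Fin n → ℤ) ∈ F.dualCone I₀.1 → 0 ≤ l m)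
    (hu₁ : ∀ m : F.perp J.1, (m : Fin n → ℤ) ∈ F.dualCone I₁.1 → l m ≤ 0)
    {N : ℕ} (hN : 0 < N) {m : Cone n → Fin n → ℤ}
    (hm : ∀ I : Cone n, ∀ i ∈ I.1, m I ⬝ᵥ F.v i = N) :
    F.HasToricCurve k P ((l ⟨m I₀ - m I₁, F.sub_mem_perp hm h₀ h₁⟩ : ℚ) / N) := by
  have := F.isOpenImmersion_curveTorus k l t hl
  exact ⟨F.curve k l t, inferInstance, inferInstance, (F.translate k l t).imageι, inferInstance,
    inferInstance, F.isRationalCurve_curve k l t hl, F.isUnibranch_curve k l t hl,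
    exists_lift_of_mem_range k _ P hP, ⟨J, l, t, F.range_imageι_subset k l t,
      F.range_imageι k l t⟩, F.isIntersectionNumber_curve k l t hl h₀ h₁ hu₀ hu₁ hN hm⟩

end FakeWPSFan

/-! ### Degrees of curves with given direction -/

namespace FakeWPSFan
variable {n : ℕ} (F : FakeWPSFan n)

lemma sum_relation_eq_zero {a : Fin (n + 1) → ℤ} (ha : ∑ i, a i • F.v i = 0) (m : Fin n → ℤ) :
    ∑ i, (a i : ℚ) * ((m ⬝ᵥ F.v i : ℤ) : ℚ) = 0 := by
  have := congrArg (m ⬝ᵥ ·) ha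
  simp only [dotProduct_sum, dotProduct_smul, dotProduct_zero, smul_eq_mul] at this
  exact_mod_cast this

/-- `w = ∑ cᵢ vᵢ` with rational coefficients, tested on all lattice functionals. -/
def IsCombination (w : Fin n → ℤ) (c : Fin (n + 1) → ℚ) : Prop :=
  ∀ m : Fin n → ℤ, ((m ⬝ᵥ w : ℤ) : ℚ) = ∑ i, c i * ((m ⬝ᵥ F.v i : ℤ) : ℚ)

variable {F}

lemma IsCombination.sub_relation {w : Fin n → ℤ} {c : Fin (n + 1) → ℚ} (hw : F.IsCombination w c)
    {a : Fin (n + 1) → ℤ} (ha : ∑ i, a i • F.v i = 0) (x : ℚ) :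
    F.IsCombination w fun i => c i - x * a i := fun m => by
  rw [hw m]
  simp only [sub_mul, Finset.sum_sub_distrib, mul_assoc]
  rw [← Finset.mul_sum, F.sum_relation_eq_zero ha, mul_zero, sub_zero]

/-- The coefficients off `I` vanish: the pairing of `∑ cᵢ vᵢ` with a functional that is
equal to `N` on the rays of `σ_I`. -/
lemma IsCombination.dotProduct_eq {w : Fin n → ℤ} {c : Fin (n + 1) → ℚ} (hw : F.IsCombination w c)
    {I : Finset (Fin (n + 1))} (hc : ∀ i, i ∉ I → c i = 0) {m : Fin n → ℤ} {N : ℤ}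
    (hm : ∀ i ∈ I, m ⬝ᵥ F.v i = N) : ((m ⬝ᵥ w : ℤ) : ℚ) = N * ∑ i, c i := by
  rw [hw m, Finset.mul_sum]
  refine Finset.sum_congr rfl fun i _ => ?_
  by_cases hi : i ∈ I
  · rw [hm i hi, mul_comm]
  · rw [hc i hi, zero_mul, mul_zero]

/-- The terms of the pairing of `∑ cᵢ vᵢ` with a functional of the dual cone of `σ_I` that is zero
on `σ_J` are nonnegative if the coefficients are nonnegative off `J` and zero off `I`. -/
lemma combination_term_nonneg {c : Fin (n + 1) → ℚ} {I J : Finset (Fin (n + 1))}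
    (h : ∀ i, i ∉ J → 0 ≤ c i) (h' : ∀ i, i ∉ I → c i = 0) {m : Fin n → ℤ}
    (hm : m ∈ F.dualCone I) (hmJ : m ∈ F.perp J) (i : Fin (n + 1)) :
    0 ≤ c i * ((m ⬝ᵥ F.v i : ℤ) : ℚ) := by
  by_cases hi : i ∈ J
  · rw [hmJ i hi, Int.cast_zero, mul_zero]
  · by_cases hiI : i ∈ I
    · exact mul_nonneg (h i hi) (by exact_mod_cast hm i hiI)
    · rw [h' i hiI, zero_mul]

lemma IsCombination.dotProduct_nonneg {w : Fin n → ℤ} {c : Fin (n + 1) → ℚ}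
    (hw : F.IsCombination w c) {I J : Finset (Fin (n + 1))} (h : ∀ i, i ∉ J → 0 ≤ c i)
    (h' : ∀ i, i ∉ I → c i = 0) {m : Fin n → ℤ}
    (hm : m ∈ F.dualCone I) (hmJ : m ∈ F.perp J) : 0 ≤ m ⬝ᵥ w := by
  have : (0 : ℚ) ≤ ((m ⬝ᵥ w : ℤ) : ℚ) := by
    rw [hw m]
    exact Finset.sum_nonneg fun i _ => combination_term_nonneg h h' hm hmJ i
  exact_mod_cast this

lemma IsCombination.dotProduct_eq_zero_iff {w : Fin n → ℤ} {c : Fin (n + 1) → ℚ}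
    (hw : F.IsCombination w c) {I J : Finset (Fin (n + 1))} (h : ∀ i, i ∉ J → 0 ≤ c i)
    (h' : ∀ i, i ∉ I → c i = 0) (hpos : ∀ i ∈ I, i ∉ J → 0 < c i) {m : Fin n → ℤ}
    (hm : m ∈ F.dualCone I) (hmJ : m ∈ F.perp J) : m ⬝ᵥ w = 0 ↔ m ∈ F.perp I := by
  have h0 : m ⬝ᵥ w = 0 ↔ ∑ i, c i * ((m ⬝ᵥ F.v i : ℤ) : ℚ) = 0 := by
    rw [← hw m, Int.cast_eq_zero]
  rw [h0, Finset.sum_eq_zero_iff_of_nonneg fun i _ => combination_term_nonneg h h' hm hmJ i]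
  constructor
  · intro hz i hi
    by_cases hiJ : i ∈ J
    · exact hmJ i hiJ
    · exact_mod_cast (mul_eq_zero.1 (hz i (Finset.mem_univ i))).resolve_left (hpos i hi hiJ).ne'
  · intro hmI i _
    by_cases hi : i ∈ I
    · rw [hmI i hi, Int.cast_zero, mul_zero]
    · rw [h' i hi, zero_mul]

variable (F) (k : Type u) [Field k]

/-- The curve in the orbit closure of `σ_J` with direction `w = ∑ cᵢ vᵢ`. Its ends lie in the orbits
of `σ_J` together with the rays where `cᵢ / aᵢ` is not minimal, respectively not maximal, off `J`.
The intersection number with `-K_W` is at most `(max - min) ∑ aᵢ`, with equality if the image of `w`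
in the cocharacter lattice of the torus of `σ_J` is primitive. -/
lemma exists_hasToricCurve {P : Spec (.of k) ⟶ F.toricVariety k} {a : Fin (n + 1) → ℤ}
    (hpos : ∀ i, 0 < a i) (ha : ∑ i, a i • F.v i = 0) {J : Cone n} {w : Fin n → ℤ}
    {c : Fin (n + 1) → ℚ} (hw : F.IsCombination w c) {lo hi : ℚ} (hlt : lo < hi)
    (hlo : ∀ i, i ∉ J.1 → lo * a i ≤ c i) (hhi : ∀ i, i ∉ J.1 → c i ≤ hi * a i)
    (hlo' : ∃ i, i ∉ J.1 ∧ c i = lo * a i) (hhi' : ∃ i, i ∉ J.1 ∧ c i = hi * a i)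
    {t : Multiplicative (F.perp J.1) →* kˣ}
    (hP : ∀ (l : F.perp J.1 →+ ℤ) (d : ℤ), 0 < d →
      (∀ m : F.perp J.1, (m : Fin n → ℤ) ⬝ᵥ w = d * l m) →
      P (IsLocalRing.closedPoint k) ∈ Set.range (F.translate k l t).imageι) :
    ∃ q ≤ (hi - lo) * ∑ i, (a i : ℚ), F.HasToricCurve k P q := by
  classical
  obtain ⟨i₀, hi₀, hci₀⟩ := hlo'
  obtain ⟨i₁, hi₁, hci₁⟩ := hhi'
  have haq : ∀ i, (0 : ℚ) < a i := fun i => by exact_mod_cast hpos i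
  let I₀ : Cone n := ⟨Finset.univ.filter fun i => i ∈ J.1 ∨ lo * a i < c i, fun h => by
    have := h.symm.subset (Finset.mem_univ i₀)
    simp [hi₀, hci₀] at this⟩
  let I₁ : Cone n := ⟨Finset.univ.filter fun i => i ∈ J.1 ∨ c i < hi * a i, fun h => by
    have := h.symm.subset (Finset.mem_univ i₁)
    simp [hi₁, hci₁] at this⟩
  have hJ₀ : J.1 ⊆ I₀.1 := fun i hi => by simp [I₀, hi]
  have hJ₁ : J.1 ⊆ I₁.1 := fun i hi => by simp [I₁, hi]
  have hw₀ := hw.sub_relation ha lo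
  have hw₁ := hw.sub_relation ha hi
  have hn₀ : ∀ i, i ∉ J.1 → 0 ≤ c i - lo * a i := fun i h => sub_nonneg.2 (hlo i h)
  have hz₀ : ∀ i, i ∉ I₀.1 → c i - lo * a i = 0 := fun i h => by
    simp only [I₀, Finset.mem_filter, Finset.mem_univ, true_and, not_or, not_lt] at h
    exact sub_eq_zero.2 (le_antisymm h.2 (hlo i h.1))
  have hz₁ : ∀ i, i ∉ I₁.1 → c i - hi * a i = 0 := fun i h => by
    simp only [I₁, Finset.mem_filter, Finset.mem_univ, true_and, not_or, not_lt] at h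
    exact sub_eq_zero.2 (le_antisymm (hhi i h.1) h.2)
  have hw₁' : F.IsCombination (-w) fun i => -(c i - hi * a i) := fun m => by
    simp only [dotProduct_neg, neg_mul, Finset.sum_neg_distrib, Int.cast_neg, hw₁ m]
  have hp₀ : ∀ i ∈ I₀.1, i ∉ J.1 → 0 < c i - lo * a i := fun i h h' => by
    simp only [I₀, Finset.mem_filter, Finset.mem_univ, true_and] at h
    exact sub_pos.2 (h.resolve_left h')
  have hφ : (cochar w).comp (F.perp J.1).subtype ≠ 0 := by
    intro h0
    obtain ⟨m, hm0, hmpos⟩ := F.exists_supporting hJ₀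
    have h1 : (m : Fin n → ℤ) ∈ F.perp J.1 := hm0
    have h2 : (m : Fin n → ℤ) ⬝ᵥ w = 0 := DFunLike.congr_fun h0 ⟨m, h1⟩
    have h3 := (hw₀.dotProduct_eq_zero_iff hn₀ hz₀ hp₀ m.2 h1).1 h2
    have h4 : i₁ ∈ I₀.1 := by
      simp only [I₀, Finset.mem_filter, Finset.mem_univ, true_and, hci₁]
      exact Or.inr (mul_lt_mul_of_pos_right hlt (haq i₁))
    exact (hmpos i₁ h4 hi₁).ne' (h3 i₁ h4)
  -- `w` is `d` times a primitive cocharacter `l` of the torus of `σ_J`, and `1 ≤ d` is the source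
  -- of the inequality.
  obtain ⟨d, l, hd, hl, m₁, hm₁⟩ := exists_primitive_functional _ hφ
  have hl : ∀ m : F.perp J.1, (m : Fin n → ℤ) ⬝ᵥ w = d * l m := hl
  obtain ⟨N, hN, hm⟩ := F.exists_uniform_weight
  lift N to ℕ using hN.le
  choose m hm using hm
  have hN : 0 < N := by exact_mod_cast hN
  have hNq : (0 : ℚ) < N := by exact_mod_cast hN
  refine ⟨_, ?_, F.hasToricCurve_translate (hP l d hd hl) hm₁ hJ₀ hJ₁ (fun m' hm' => ?_)
    (fun m' hm' => ?_) hN hm⟩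
  · have h1 : ((m I₀ ⬝ᵥ w : ℤ) : ℚ) = (N : ℤ) * ∑ i, (c i - lo * a i) :=
      hw₀.dotProduct_eq hz₀ (hm I₀)
    have h2 : ((m I₁ ⬝ᵥ w : ℤ) : ℚ) = (N : ℤ) * ∑ i, (c i - hi * a i) :=
      hw₁.dotProduct_eq hz₁ (hm I₁)
    have h3 := hl ⟨m I₀ - m I₁, F.sub_mem_perp hm hJ₀ hJ₁⟩
    have h3 : ((m I₀ - m I₁) ⬝ᵥ w : ℤ) = d * l ⟨m I₀ - m I₁, F.sub_mem_perp hm hJ₀ hJ₁⟩ := h3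
    rw [sub_dotProduct] at h3
    generalize l ⟨m I₀ - m I₁, F.sub_mem_perp hm hJ₀ hJ₁⟩ = e at h3 ⊢
    have h4 : (N : ℚ) * ((hi - lo) * ∑ i, (a i : ℚ)) = d * e := by
      have h5 : ((m I₀ ⬝ᵥ w - m I₁ ⬝ᵥ w : ℤ) : ℚ) = ((d * e : ℤ) : ℚ) := by rw [h3]
      push_cast at h5
      push_cast at h1 h2
      rw [← h5, h1, h2, Finset.sum_sub_distrib, Finset.sum_sub_distrib, ← Finset.mul_sum,
        ← Finset.mul_sum]
      ring
    have hS : 0 < ∑ i, (a i : ℚ) := Finset.sum_pos (fun i _ => haq i) Finset.univ_nonempty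
    have h6 : (0 : ℚ) < d * e := by
      rw [← h4]
      exact mul_pos hNq (mul_pos (sub_pos.2 hlt) hS)
    have hdq : (1 : ℚ) ≤ d := by exact_mod_cast hd
    have he : (0 : ℚ) < e := pos_of_mul_pos_right h6 (by linarith)
    rw [div_le_iff₀ hNq, mul_comm, h4]
    exact le_mul_of_one_le_left he.le hdq
  · refine nonneg_of_mul_nonneg_right ?_ hd
    rw [← hl m']
    exact hw₀.dotProduct_nonneg hn₀ hz₀ hm' m'.2
  · have h1 := hw₁'.dotProduct_nonneg (I := I₁.1) (J := J.1)
      (fun i h => by rw [neg_sub]; exact sub_nonneg.2 (hhi i h))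
      (fun i h => by rw [hz₁ i h, neg_zero]) hm' m'.2
    rw [dotProduct_neg, hl m'] at h1
    by_contra! h2
    have := mul_pos hd h2
    omega

end FakeWPSFan

namespace FakeWPSFan
variable {n : ℕ} (F : FakeWPSFan n) (k : Type u) [Field k]

/-- `exists_hasToricCurve` for nonnegative coefficients, one of which is zero off `J`. -/
lemma exists_hasToricCurve_of_nonneg {P : Spec (.of k) ⟶ F.toricVariety k} {a : Fin (n + 1) → ℤ}
    (hpos : ∀ i, 0 < a i) (ha : ∑ i, a i • F.v i = 0) {J : Cone n} {w : Fin n → ℤ}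
    {c : Fin (n + 1) → ℚ} (hw : F.IsCombination w c) {β : ℚ} (hc : ∀ i, 0 ≤ c i)
    (hβ : ∀ i, c i ≤ β * a i) (h0 : ∃ i, i ∉ J.1 ∧ c i = 0) (h1 : ∃ i, i ∉ J.1 ∧ c i ≠ 0)
    {t : Multiplicative (F.perp J.1) →* kˣ}
    (hP : ∀ (l : F.perp J.1 →+ ℤ) (d : ℤ), 0 < d →
      (∀ m : F.perp J.1, (m : Fin n → ℤ) ⬝ᵥ w = d * l m) →
      P (IsLocalRing.closedPoint k) ∈ Set.range (F.translate k l t).imageι) :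
    ∃ q ≤ β * ∑ i, (a i : ℚ), F.HasToricCurve k P q := by
  have haq : ∀ i, (0 : ℚ) < a i := fun i => by exact_mod_cast hpos i
  obtain ⟨i₁, hi₁, hci₁⟩ := h1
  obtain ⟨i₂, hi₂, hmax⟩ := Finset.exists_max_image (J.1ᶜ) (fun i => c i / a i)
    ⟨i₁, Finset.mem_compl.2 hi₁⟩
  have hlt : 0 < c i₂ / a i₂ :=
    (div_pos (lt_of_le_of_ne (hc i₁) hci₁.symm) (haq i₁)).trans_le
      (hmax i₁ (Finset.mem_compl.2 hi₁))
  obtain ⟨q, hq, hcurve⟩ := F.exists_hasToricCurve k hpos ha hw hlt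
    (fun i _ => by rw [zero_mul]; exact hc i)
    (fun i hi => (div_le_iff₀ (haq i)).1 (hmax i (Finset.mem_compl.2 hi)))
    (h0.imp fun i h => ⟨h.1, by rw [h.2, zero_mul]⟩)
    ⟨i₂, Finset.mem_compl.1 hi₂, (div_mul_cancel₀ _ (haq i₂).ne').symm⟩ hP
  refine ⟨q, hq.trans ?_, hcurve⟩
  rw [sub_zero]
  exact mul_le_mul_of_nonneg_right ((div_le_iff₀ (haq i₂)).2 (hβ i₂))
    (Finset.sum_nonneg fun i _ => (haq i).le)

variable {k}

/-- A point in the orbit of `σ_I` lies on a curve of degree at most `β ∑ aᵢ` for each lattice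
vector `∑ cᵢ vᵢ` with `0 ≤ cᵢ ≤ β aᵢ` for which a coefficient off `I` vanishes. If not all of the
coefficients off `I` vanish, then this is a curve in the closure of the orbit; otherwise, it is a
curve in a larger orbit closure which has the point as an end. -/
lemma exists_cone_hasToricCurve (P : Spec (.of k) ⟶ F.toricVariety k)
    (hP : P ≫ (F.toricVariety k ↘ Spec (.of k)) = 𝟙 (Spec (.of k))) :
    ∃ I : Cone n, ∀ (a : Fin (n + 1) → ℤ), (∀ i, 0 < a i) → ∑ i, a i • F.v i = 0 →
      ∀ (w : Fin n → ℤ) (c : Fin (n + 1) → ℚ) (β : ℚ), F.IsCombination w c → (∀ i, 0 ≤ c i) →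
      (∀ i, c i ≤ β * a i) → (∃ i, i ∉ I.1 ∧ c i = 0) → (∃ i, c i ≠ 0) →
      ∃ q ≤ β * ∑ i, (a i : ℚ), F.HasToricCurve k P q := by
  classical
  obtain ⟨I, ev, τ, y, hPy, hy, h₁, h₂⟩ := F.exists_character k P hP
  refine ⟨I, fun a hpos ha w c β hw hc hβ h0 hne => ?_⟩
  by_cases hI : ∃ i, i ∉ I.1 ∧ c i ≠ 0
  · refine F.exists_hasToricCurve_of_nonneg k hpos ha hw hc hβ h0 hI (t := τ) fun l _ _ _ => ?_
    rw [hPy]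
    exact F.mem_range_curve_of_character hy h₁ h₂ l
  -- `w` lies in the relative interior of the image of `σ_I` modulo the span of `σ_J`, where `J`
  -- consists of the rays of `σ_I` with coefficient zero.
  · push Not at hI
    let J : Cone n := ⟨I.1.filter fun i => c i = 0, fun h => I.2 (Finset.eq_univ_of_forall fun i =>
      (Finset.mem_filter.1 (h.symm.subset (Finset.mem_univ i))).1)⟩
    have hJI : J.1 ⊆ I.1 := Finset.filter_subset _ _
    obtain ⟨r, hr⟩ := F.exists_retraction I.1
    let t : Multiplicative (F.perp J.1) →* kˣ :=
      τ.comp (AddMonoidHom.toMultiplicative (r.comp (F.perp J.1).subtype))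
    refine F.exists_hasToricCurve_of_nonneg k (J := J) hpos ha hw hc hβ
      (h0.imp fun i h => ⟨fun h' => h.1 (hJI h'), h.2⟩)
      (hne.imp fun i h => ⟨fun h' => h (Finset.mem_filter.1 h').2, h⟩) (t := t)
      fun l d hd hl => ?_
    rw [hPy]
    refine F.mem_range_curve_of_limit hJI hy h₁ h₂ l (fun m hm => ?_) fun m hm hm' => ?_
    · have h3 := hw.dotProduct_eq_zero_iff (I := I.1) (J := J.1) (fun i _ => hc i) hI
        (fun i hi hiJ => lt_of_le_of_ne (hc i) fun h => hiJ (Finset.mem_filter.2 ⟨hi, h.symm⟩))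
        hm m.2
      rw [← h3, hl m, mul_eq_zero, or_iff_right hd.ne']
    · exact congrArg (fun x => τ (Multiplicative.ofAdd x)) (hr ⟨m, hm⟩)

lemma isCombination_sum (z : Fin (n + 1) → ℤ) :
    F.IsCombination (∑ i, z i • F.v i) fun i => (z i : ℚ) := fun m => by
  simp only [dotProduct_sum, dotProduct_smul, smul_eq_mul]
  push_cast
  rfl

/-- The degree bound by the sum of the weights over any one of them; it is best for the largest. -/
lemma exists_hasToricCurve_le_div (P : Spec (.of k) ⟶ F.toricVariety k)
    (hP : P ≫ (F.toricVariety k ↘ Spec (.of k)) = 𝟙 (Spec (.of k))) {a : Fin (n + 1) → ℤ}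
    (hpos : ∀ i, 0 < a i) (ha : ∑ i, a i • F.v i = 0) (i₀ : Fin (n + 1)) :
    ∃ q ≤ (∑ i, (a i : ℚ)) / a i₀, F.HasToricCurve k P q := by
  classical
  have haq : ∀ i, (0 : ℚ) < a i := fun i => by exact_mod_cast hpos i
  obtain ⟨I, hI⟩ := F.exists_cone_hasToricCurve P hP
  suffices h : ∃ (w : Fin n → ℤ) (c : Fin (n + 1) → ℚ), F.IsCombination w c ∧ (∀ i, 0 ≤ c i) ∧
      (∀ i, c i ≤ (a i₀ : ℚ)⁻¹ * a i) ∧ (∃ i, i ∉ I.1 ∧ c i = 0) ∧ ∃ i, c i ≠ 0 by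
    obtain ⟨w, c, hw, hc, hβ, h0, hne⟩ := h
    obtain ⟨q, hq, h⟩ := hI a hpos ha w c _ hw hc hβ h0 hne
    exact ⟨q, by rwa [div_eq_inv_mul], h⟩
  -- If there is a ray other than `i₀` off `I`, then the direction is `v i₀`.
  by_cases hcase : ∃ j, j ∉ I.1 ∧ j ≠ i₀
  · obtain ⟨j, hj, hji⟩ := hcase
    refine ⟨F.v i₀, fun i => if i = i₀ then 1 else 0, fun m => by simp, fun i => ?_, fun i => ?_,
      ⟨j, hj, if_neg hji⟩, ⟨i₀, by simp⟩⟩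
    · dsimp only; split_ifs <;> norm_num
    · dsimp only
      split_ifs with h
      · rw [h, inv_mul_cancel₀ (haq i₀).ne']
      · exact (mul_pos (inv_pos.2 (haq i₀)) (haq i)).le
  · push Not at hcase
    obtain ⟨j, hj⟩ : ∃ j, j ∉ I.1 := by
      by_contra! h
      exact I.2 (Finset.eq_univ_of_forall h)
    have hj₀ : i₀ ∉ I.1 := hcase j hj ▸ hj
    -- Off `I` there is only the ray `i₀`, and its opposite vector is used.
    have hcomb : F.IsCombination (-F.v i₀) fun i =>
        (if i = i₀ then -1 else 0) - -(a i₀ : ℚ)⁻¹ * a i :=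
      IsCombination.sub_relation (fun m => by simp) ha _
    refine ⟨_, _, hcomb, fun i => ?_, fun i => ?_, ⟨i₀, hj₀, ?_⟩, ?_⟩
    · split_ifs with h
      · rw [h, neg_mul, inv_mul_cancel₀ (haq i₀).ne']; norm_num
      · have := mul_pos (inv_pos.2 (haq i₀)) (haq i)
        linarith
    · split_ifs with h <;> linarith
    · rw [if_pos rfl, neg_mul, inv_mul_cancel₀ (haq i₀).ne']; norm_num
    · have : ∃ i, i ≠ i₀ := by
        by_contra! h
        apply F.v_ne_zero i₀
        have h1 : ∑ i, a i • F.v i = a i₀ • F.v i₀ :=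
          Finset.sum_eq_single_of_mem i₀ (Finset.mem_univ _) fun i _ hi => absurd (h i) hi
        rw [ha] at h1
        exact (smul_eq_zero.1 h1.symm).resolve_left (hpos i₀).ne'
      obtain ⟨i, hi⟩ := this
      refine ⟨i, ?_⟩
      have := mul_pos (inv_pos.2 (haq i₀)) (haq i)
      rw [if_neg hi, neg_mul, sub_neg_eq_add, zero_add]
      exact this.ne'

lemma sum_div_le {a : Fin (n + 1) → ℤ} (hpos : ∀ i, 0 < a i) {i₀ : Fin (n + 1)}
    (hmax : ∀ i, a i ≤ a i₀) : (∑ i, (a i : ℚ)) / a i₀ ≤ 1 + n := by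
  have h0 : (0 : ℚ) < a i₀ := by exact_mod_cast hpos i₀
  rw [div_le_iff₀ h0]
  calc ∑ i, (a i : ℚ) ≤ ∑ _i : Fin (n + 1), (a i₀ : ℚ) :=
        Finset.sum_le_sum fun i _ => by exact_mod_cast hmax i
    _ = _ := by
      rw [Finset.sum_const, Finset.card_univ, Fintype.card_fin, nsmul_eq_mul]
      push_cast
      ring

/-- On a terminal fake weighted projective space, a sum of weights larger than `n` times the largest
weight forces all weights to be equal: the sum of the rays is a lattice vector with small
nonnegative coefficients in the rays of lower weights. -/
lemma sum_v_eq_zero_of_isTerminal (hT : IsTerminal k (F.toricVariety k) n) {a : Fin (n + 1) → ℤ}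
    (hpos : ∀ i, 0 < a i) (ha : ∑ i, a i • F.v i = 0) {i₀ : Fin (n + 1)} (hmax : ∀ i, a i ≤ a i₀)
    (hlt : (n : ℚ) < (∑ i, (a i : ℚ)) / a i₀) : ∑ i, F.v i = 0 := by
  have h0 : (0 : ℚ) < a i₀ := by exact_mod_cast hpos i₀
  have hcomb : F.IsCombination (∑ i, F.v i) fun i => 1 - (a i₀ : ℚ)⁻¹ * a i := by
    have := IsCombination.sub_relation (F.isCombination_sum fun _ => 1) ha (a i₀ : ℚ)⁻¹
    simpa using this
  have hz : 1 - (a i₀ : ℚ)⁻¹ * a i₀ = 0 := by rw [inv_mul_cancel₀ h0.ne', sub_self]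
  refine F.eq_zero_of_isTerminal k hT ⟨Finset.univ.erase i₀, fun h =>
    Finset.notMem_erase i₀ Finset.univ (h.symm.subset (Finset.mem_univ i₀))⟩ _
    (fun i => 1 - (a i₀ : ℚ)⁻¹ * a i) (fun i _ => ?_) (fun m => ?_) ?_
  · rw [sub_nonneg, ← div_eq_inv_mul, div_le_one h0]
    exact_mod_cast hmax i
  · rw [hcomb m, ← Finset.add_sum_erase _ _ (Finset.mem_univ i₀)]
    simp only [hz, zero_mul, zero_add]
  · have h1 : ∑ i, (1 - (a i₀ : ℚ)⁻¹ * a i) < 1 := by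
      rw [Finset.sum_sub_distrib, ← Finset.mul_sum, ← div_eq_inv_mul]
      simp only [Finset.sum_const, Finset.card_univ, Fintype.card_fin, nsmul_eq_mul, mul_one]
      push_cast
      linarith
    rwa [← Finset.add_sum_erase _ _ (Finset.mem_univ i₀), hz, zero_add] at h1

end FakeWPSFan

/-! ### Quotients of projective space, and the theorem -/

/-- At most `(p - 1) / (n + 1)` multiples of a nonzero residue class modulo `p` have a
representative in the last `(n + 1)`-th part of `{0, …, p - 1}`. -/
lemma card_filter_large_multiples {p : ℕ} [Fact p.Prime] (n : ℕ) {ζ : ZMod p} (hζ : ζ ≠ 0) :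
    (n + 1) * (Finset.univ.filter fun r : ZMod p =>
      n * p < (n + 1) * (r * ζ).val).card ≤ p - 1 := by
  classical
  have hp := (Fact.out : p.Prime).two_le
  have hle : (Finset.univ.filter fun r : ZMod p => n * p < (n + 1) * (r * ζ).val).card ≤
      (Finset.Ioo (n * p / (n + 1)) p).card := by
    refine Finset.card_le_card_of_injOn (fun r => (r * ζ).val) (fun r hr => ?_) fun r _ s _ h => ?_
    · have hr := (Finset.mem_filter.1 hr).2
      refine Finset.mem_coe.2 (Finset.mem_Ioo.2 ⟨?_, ZMod.val_lt _⟩)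
      exact (Nat.div_lt_iff_lt_mul (Nat.succ_pos n)).2 (by rwa [mul_comm _ (n + 1)])
    · exact mul_right_cancel₀ hζ (ZMod.val_injective p h)
  rw [Nat.card_Ioo] at hle
  have h1 : n * p < (n + 1) * (n * p / (n + 1) + 1) := Nat.lt_mul_div_succ _ (Nat.succ_pos n)
  obtain ⟨x, hx⟩ : ∃ x, x = n * p / (n + 1) := ⟨_, rfl⟩
  rw [← hx] at hle h1
  have h2 : x < p := by
    rw [hx]
    exact (Nat.div_lt_iff_lt_mul (Nat.succ_pos n)).2 (by nlinarith)
  obtain ⟨e, rfl⟩ : ∃ e, p = x + 1 + e := ⟨p - x - 1, by omega⟩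
  have h3 : x + 1 + e - x - 1 = e := by omega
  rw [h3] at hle
  refine (Nat.mul_le_mul_left _ hle).trans ?_
  have h4 : (n + 1) * e + 1 ≤ x + 1 + e := by nlinarith
  omega

/-- Given `n + 1` residue classes modulo `p`, one of which is zero, there is a multiplier which
moves all of them to the first `n / (n + 1)`-th part of `{0, …, p - 1}`. -/
lemma exists_small_multiples {p : ℕ} [Fact p.Prime] {n : ℕ} {ζ : Fin (n + 1) → ZMod p}
    {j : Fin (n + 1)} (hj : ζ j = 0) :
    ∃ r : ZMod p, r ≠ 0 ∧ ∀ i, (n + 1) * (r * ζ i).val ≤ n * p := by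
  classical
  have hp := (Fact.out : p.Prime).two_le
  let bad : Fin (n + 1) → Finset (ZMod p) := fun i =>
    Finset.univ.filter fun r => n * p < (n + 1) * (r * ζ i).val
  have hbad : ∀ i, (n + 1) * (bad i).card ≤ p - 1 := fun i => by
    by_cases hi : ζ i = 0
    · have : bad i = ∅ := by
        refine Finset.filter_eq_empty_iff.2 fun r _ => ?_
        simp [hi]
      simp [this]
    · exact card_filter_large_multiples n hi
  let B := insert 0 ((Finset.univ.erase j).biUnion bad)
  have hB : B.card < Fintype.card (ZMod p) := by
    have h1 : ((Finset.univ.erase j).biUnion bad).card ≤ ∑ i ∈ Finset.univ.erase j, (bad i).card :=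
      Finset.card_biUnion_le
    have h2 : (n + 1) * ∑ i ∈ Finset.univ.erase j, (bad i).card ≤ n * (p - 1) := by
      rw [Finset.mul_sum]
      refine (Finset.sum_le_card_nsmul _ _ (p - 1) fun i _ => hbad i).trans (le_of_eq ?_)
      simp
    have h3 : B.card ≤ _ := Finset.card_insert_le _ _
    rw [ZMod.card]
    obtain ⟨e, rfl⟩ : ∃ e, p = e + 2 := ⟨p - 2, by omega⟩
    have h4 : ∑ i ∈ Finset.univ.erase j, (bad i).card < e + 1 := by
      have : e + 2 - 1 = e + 1 := rfl
      rw [this] at h2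
      by_contra! h
      nlinarith
    omega
  obtain ⟨r, hr⟩ : ∃ r, r ∉ B := by
    by_contra! h
    exact hB.ne (Finset.card_eq_iff_eq_univ _ |>.2 (Finset.eq_univ_of_forall h))
  refine ⟨r, fun h => hr (h ▸ Finset.mem_insert_self _ _), fun i => ?_⟩
  by_cases hij : i = j
  · simp [hij, hj]
  · by_contra! h
    exact hr (Finset.mem_insert_of_mem (Finset.mem_biUnion.2
      ⟨i, Finset.mem_erase.2 ⟨hij, Finset.mem_univ i⟩, Finset.mem_filter.2 ⟨Finset.mem_univ r, h⟩⟩))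

namespace FakeWPSFan
variable {n : ℕ} (F : FakeWPSFan n)

/-- The rays generate a sublattice of finite index. -/
lemma exists_nsmul_mem_span (w : Fin n → ℤ) :
    ∃ d : ℕ, 0 < d ∧ d • w ∈ Submodule.span ℤ (Set.range F.v) := by
  obtain ⟨x, hx⟩ := (Submodule.mem_span_range_iff_exists_fun ℚ).1
    (show (fun j => (w j : ℚ)) ∈ Submodule.span ℚ (Set.range fun i j => (F.v i j : ℚ)) by
      rw [F.span_eq_top]; trivial)
  let d : ℕ := ∏ i, (x i).den
  have hz : ∀ i, ∃ z : ℤ, (z : ℚ) = d * x i := fun i => by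
    obtain ⟨e, he⟩ : (x i).den ∣ d :=
      Finset.dvd_prod_of_mem (fun i => (x i).den) (Finset.mem_univ i)
    refine ⟨e * (x i).num, ?_⟩
    rw [he]
    push_cast
    rw [mul_comm ((x i).den : ℚ), mul_assoc, mul_comm ((x i).den : ℚ), Rat.mul_den_eq_num]
  choose z hz using hz
  refine ⟨d, Finset.prod_pos fun i _ => (x i).pos,
    (Submodule.mem_span_range_iff_exists_fun ℤ).2 ⟨z, ?_⟩⟩
  ext j
  have h1 := congrFun hx j
  simp only [Finset.sum_apply, Pi.smul_apply, smul_eq_mul] at h1 ⊢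
  have h2 : ((∑ i, z i * F.v i j : ℤ) : ℚ) = ((d * w j : ℤ) : ℚ) := by
    push_cast
    rw [← h1, Finset.mul_sum]
    exact Finset.sum_congr rfl fun i _ => by rw [hz]; ring
  exact (Int.cast_injective h2).trans (nsmul_eq_mul _ _).symm

/-- If the rays do not generate the lattice, then there is a vector of prime order modulo the
sublattice that they generate. -/
lemma exists_prime_smul_mem_span (hs : Submodule.span ℤ (Set.range F.v) ≠ ⊤) :
    ∃ (p : ℕ) (w : Fin n → ℤ), p.Prime ∧ p • w ∈ Submodule.span ℤ (Set.range F.v) ∧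
      w ∉ Submodule.span ℤ (Set.range F.v) := by
  classical
  obtain ⟨w, hw⟩ : ∃ w, w ∉ Submodule.span ℤ (Set.range F.v) := by
    by_contra! h
    exact hs (Submodule.eq_top_iff'.2 h)
  have hex := F.exists_nsmul_mem_span w
  obtain ⟨hd, hmem⟩ := Nat.find_spec hex
  have hne1 : Nat.find hex ≠ 1 := fun h => hw (by rwa [h, one_smul] at hmem)
  obtain ⟨e, he⟩ := Nat.minFac_dvd (Nat.find hex)
  have hp := Nat.minFac_prime hne1
  have he0 : 0 < e := Nat.pos_of_ne_zero fun h => by rw [h, mul_zero] at he; omega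
  refine ⟨_, e • w, hp, ?_, fun h => ?_⟩
  · rw [smul_smul, ← he]; exact hmem
  · refine Nat.find_min hex (m := e) ?_ ⟨he0, h⟩
    rw [he]
    exact lt_mul_of_one_lt_left he0 hp.one_lt

variable {F} {k : Type u} [Field k]

/-- If `∑ vᵢ = 0` but the rays do not generate the lattice, then a lattice vector outside of the
sublattice generated by the rays provides a curve of degree at most `n`: all weights are equal to
`1`, so that coefficients in `[0, n / (n + 1)]` give degree at most `(n / (n + 1)) (n + 1)`. -/
lemma exists_hasToricCurve_le_of_span_ne_top (P : Spec (.of k) ⟶ F.toricVariety k)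
    (hP : P ≫ (F.toricVariety k ↘ Spec (.of k)) = 𝟙 (Spec (.of k))) (h0 : ∑ i, F.v i = 0)
    (hs : Submodule.span ℤ (Set.range F.v) ≠ ⊤) : ∃ q ≤ (n : ℚ), F.HasToricCurve k P q := by
  obtain ⟨I, hI⟩ := F.exists_cone_hasToricCurve P hP
  obtain ⟨j, hj⟩ : ∃ j, j ∉ I.1 := by
    by_contra! h
    exact I.2 (Finset.eq_univ_of_forall h)
  obtain ⟨p, w, hp, hpw, hw⟩ := F.exists_prime_smul_mem_span hs
  have : Fact p.Prime := ⟨hp⟩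
  have hpq : (0 : ℚ) < p := by exact_mod_cast hp.pos
  obtain ⟨z', hz'⟩ := (Submodule.mem_span_range_iff_exists_fun ℤ).1 hpw
  -- The coefficient at the ray `j` may be assumed to be zero, as the sum of the rays is zero.
  obtain ⟨z, hzj, hz⟩ : ∃ z : Fin (n + 1) → ℤ, z j = 0 ∧ ∑ i, z i • F.v i = p • w := by
    refine ⟨fun i => z' i - z' j, sub_self _, ?_⟩
    simp only [sub_smul, Finset.sum_sub_distrib]
    rw [← Finset.smul_sum, h0, smul_zero, sub_zero, hz']
  -- Not all coefficients are divisible by `p`, as `w` is not in the sublattice.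
  obtain ⟨i₁, hi₁⟩ : ∃ i, (z i : ZMod p) ≠ 0 := by
    by_contra! h
    have hdvd : ∀ i, ∃ y, z i = p * y := fun i => (ZMod.intCast_zmod_eq_zero_iff_dvd _ _).1 (h i)
    choose y hy using hdvd
    refine hw ((Submodule.mem_span_range_iff_exists_fun ℤ).2 ⟨y, ?_⟩)
    have hpz : (p : ℤ) ≠ 0 := by exact_mod_cast hp.ne_zero
    refine smul_right_injective _ hpz ?_
    simp only [Finset.smul_sum, smul_smul]
    simp only [hy] at hz
    rw [hz, natCast_zsmul]
  obtain ⟨r, hr, hsmall⟩ := exists_small_multiples (ζ := fun i => (z i : ZMod p)) (j := j)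
    (by rw [hzj, Int.cast_zero])
  -- The vector `w' = ∑ (ρ i / p) vᵢ` is congruent to `r w` modulo the sublattice, and `ρ i / p` is
  -- the fractional part of its coefficient, at most `n / (n + 1)` by the choice of `r`.
  let ρ : Fin (n + 1) → ℤ := fun i => ((r.val : ℤ) * z i) % p
  have hρ : ∀ i, ρ i = ((r * (z i : ZMod p)).val : ℤ) := fun i => by
    have : ((((r.val : ℤ) * z i : ℤ) : ZMod p).val : ℤ) = ρ i := ZMod.val_intCast _
    rw [← this]
    push_cast
    rw [ZMod.natCast_zmod_val]
  let w' : Fin n → ℤ := (r.val : ℤ) • w - ∑ i, (((r.val : ℤ) * z i) / p) • F.v i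
  have hw' : (p : ℤ) • w' = ∑ i, ρ i • F.v i := by
    have h1 : (p : ℤ) • w = ∑ i, z i • F.v i := by rw [hz, natCast_zsmul]
    simp only [w', smul_sub]
    rw [smul_comm, h1, Finset.smul_sum, Finset.smul_sum, ← Finset.sum_sub_distrib]
    refine Finset.sum_congr rfl fun i _ => ?_
    rw [smul_smul, smul_smul, ← sub_smul]
    congr 1
    have := Int.emod_add_mul_ediv ((r.val : ℤ) * z i) p
    simp only [ρ]
    linarith
  have hcomb : F.IsCombination w' fun i => (ρ i : ℚ) / p := fun m => by
    have h1 := F.isCombination_sum ρ m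
    rw [← hw', dotProduct_smul, smul_eq_mul] at h1
    push_cast at h1
    apply mul_left_cancel₀ hpq.ne'
    rw [h1, Finset.mul_sum]
    exact Finset.sum_congr rfl fun i _ => by field_simp
  have hnonneg : ∀ i, 0 ≤ (ρ i : ℚ) / p := fun i => by
    rw [hρ]
    positivity
  have hle : ∀ i, (ρ i : ℚ) / p ≤ (n : ℚ) / (n + 1) * (1 : ℤ) := fun i => by
    rw [Int.cast_one, mul_one, div_le_div_iff₀ hpq (by positivity), mul_comm, hρ]
    exact_mod_cast hsmall i
  have hj0 : (ρ j : ℚ) / p = 0 := by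
    rw [hρ, hzj]
    simp
  have hne : (ρ i₁ : ℚ) / p ≠ 0 := by
    rw [hρ]
    refine div_ne_zero ?_ hpq.ne'
    rw [Int.cast_natCast, Nat.cast_ne_zero, ZMod.val_ne_zero]
    exact mul_ne_zero hr hi₁
  obtain ⟨q, hq, hcurve⟩ := hI (fun _ => 1) (fun _ => one_pos) (by simpa using h0) w' _
    ((n : ℚ) / (n + 1)) hcomb hnonneg hle ⟨j, hj, hj0⟩ ⟨i₁, hne⟩
  refine ⟨q, hq.trans (le_of_eq ?_), hcurve⟩
  simp only [Int.cast_one, Finset.sum_const, Finset.card_univ, Fintype.card_fin, nsmul_eq_mul,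
    mul_one]
  push_cast
  field_simp

/-- The degree bound for terminal fake weighted projective spaces other than projective space. -/
lemma exists_hasToricCurve_le_of_isTerminal (P : Spec (.of k) ⟶ F.toricVariety k)
    (hP : P ≫ (F.toricVariety k ↘ Spec (.of k)) = 𝟙 (Spec (.of k)))
    (hT : IsTerminal k (F.toricVariety k) n)
    (hne : ¬ ∃ e : F.toricVariety k ≅ projSpace k n, e.hom.IsOver (Spec (.of k))) :
    ∃ q ≤ (n : ℚ), F.HasToricCurve k P q := by
  obtain ⟨a, hpos, ha⟩ := F.relation
  obtain ⟨i₀, -, hmax⟩ := Finset.exists_max_image Finset.univ a Finset.univ_nonempty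
  have hmax : ∀ i, a i ≤ a i₀ := fun i => hmax i (Finset.mem_univ i)
  rcases le_or_gt ((∑ i, (a i : ℚ)) / a i₀) n with hle | hlt
  · obtain ⟨q, hq, h⟩ := F.exists_hasToricCurve_le_div P hP hpos ha i₀
    exact ⟨q, hq.trans hle, h⟩
  · have h0 := F.sum_v_eq_zero_of_isTerminal hT hpos ha hmax hlt
    exact exists_hasToricCurve_le_of_span_ne_top P hP h0
      fun hs => hne (F.exists_iso_projSpace k hs h0)

end FakeWPSFan

theorem mainTheorem5 {k : Type u} [Field k] [NumberField k] {n : ℕ} (F : FakeWPSFan n)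
    (P : Spec (.of k) ⟶ F.toricVariety k)
    (hP : P ≫ (F.toricVariety k ↘ Spec (.of k)) = 𝟙 (Spec (.of k))) :
    ∃ (C : Scheme.{u}) (_ : C.Over (Spec (.of k))) (_ : IsIntegral C)
      (i : C ⟶ F.toricVariety k),
      IsClosedImmersion i ∧ i.IsOver (Spec (.of k)) ∧
      -- `C` is a unibranch rational curve through `P`
      IsRationalCurve k C ∧ IsUnibranch C ∧
      (∃ P' : Spec (.of k) ⟶ C, P' ≫ i = P) ∧
      -- `C` is the closure of a translate of a one-parameter subgroup of the torus of `Z = V(σ_I)`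
      (∃ (I : FakeWPSFan.Cone n) (l : F.perp I.1 →+ ℤ) (t : Multiplicative (F.perp I.1) →* kˣ),
        Set.range i ⊆ F.orbitClosure k I ∧
        Set.range i =
          closure (Set.range (F.onePS k I l ≫ F.translation k I t ≫ F.orbitι k I))) ∧
      -- the bounds on `q = -K_W · C`
      ∃ (K : F.toricVariety k → ℤ) (q : ℚ),
        IsCanonicalDivisor k n K ∧ IsIntersectionNumber k (fun x => -K x) i q ∧
        q ≤ 1 + n ∧
        (IsTerminal k (F.toricVariety k) n →
          (¬ ∃ e : F.toricVariety k ≅ projSpace k n, e.hom.IsOver (Spec (.of k))) → q ≤ n) := by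
  suffices h : ∃ q : ℚ, F.HasToricCurve k P q ∧ q ≤ 1 + n ∧
      (IsTerminal k (F.toricVariety k) n →
        (¬ ∃ e : F.toricVariety k ≅ projSpace k n, e.hom.IsOver (Spec (.of k))) → q ≤ n) by
    obtain ⟨q, ⟨C, hC, hI, i, h₁, h₂, h₃, h₄, h₅, h₆, h₇⟩, hq, hq'⟩ := h
    exact ⟨C, hC, hI, i, h₁, h₂, h₃, h₄, h₅, h₆, F.canonicalDivisor k, q,
      F.isCanonicalDivisor_canonicalDivisor k, h₇, hq, hq'⟩
  by_cases h : IsTerminal k (F.toricVariety k) n ∧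
      ¬ ∃ e : F.toricVariety k ≅ projSpace k n, e.hom.IsOver (Spec (.of k))
  · obtain ⟨q, hq, hcurve⟩ := FakeWPSFan.exists_hasToricCurve_le_of_isTerminal P hP h.1 h.2
    exact ⟨q, hcurve, by linarith, fun _ _ => hq⟩
  · obtain ⟨a, hpos, ha⟩ := F.relation
    obtain ⟨i₀, -, hmax⟩ := Finset.exists_max_image Finset.univ a Finset.univ_nonempty
    have hmax : ∀ i, a i ≤ a i₀ := fun i => hmax i (Finset.mem_univ i)
    obtain ⟨q, hq, hcurve⟩ := F.exists_hasToricCurve_le_div P hP hpos ha i₀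
    exact ⟨q, hcurve, hq.trans (FakeWPSFan.sum_div_le hpos hmax), fun h₁ h₂ => absurd ⟨h₁, h₂⟩ h⟩
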